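/- Let $H$ be a real separable Hilbert space and let $A$ be a densely defined, nonnegative, self-adjoint (in general unbounded) operator on $H$ with compact inverse. Let $P_\mu$ be the orthogonal projection onto the eigenspace of $A$ for the eigenvalue $\mu$; for $r\le 0$ put $\|x\|_r=\|A^{r/2}x\|$, where $A^{\sigma}x=\sum_{\mu}\mu^{\sigma}P_\mu x$, the sum being over the eigenvalues $\mu$ of $A$. Let $0\neq b\in L^1_{\mathrm{loc}}([0,\infty))$ be a real kernel that is differentiable on $(0,\infty)$ and $3$-monotone, i.e. $b$ and $-\dot b$ are nonnegative, nonincreasing and convex on $(0,\infty)$, with $\lim_{t\to\infty}b(t)=0$. Let $\widehat b(\lambda)=\int_0^\infty e^{-\lambda t}b(t)\,dt$ for $\operatorname{Re}\lambda>0$ and assume that $$\rho:=1+\frac{2}{\pi}\sup\{|\arg\widehat b(\lambda)| : \operatorname{Re}\lambda>0\}\in(1,2).$$ A resolvent family of the equation $\dot u(t)+\int_0^t b(t-r)Au(r)\,dr=0$ is a family $\{S(t)\}_{t\ge0}$ of bounded linear operators on $H$ that is strongly continuous on $[0,\infty)$ with $S(0)=I$, satisfies $S(t)D(A)\subset D(A)$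 and $AS(t)x=S(t)Ax$ for $x\in D(A)$, $t\ge 0$, and satisfies $$S(t)x+\int_0^t\Big(\int_0^{t-r}b(\tau)\,d\tau\Big)AS(r)x\,dr=x,\qquad x\in D(A),\ t\ge0.$$ Then a resolvent family exists, and every resolvent family $S$ has the following property. For every $T>0$ and every $\gamma\in\mathbb R$ there is a constant $C>0$, depending (for given $A$ and $b$) only on $T$ and $\gamma$, such that for all $s$ with $0<s\le\frac1\rho$ and $\gamma<\frac{\rho s}{2}$, all integers $n\ge1$ and $\Delta t>0$ with $n\Delta t=T$, and all $x\in H$, with $t_k=k\Delta t$, $$\left(\sum_{k=1}^{n}\int_{t_{k-1}}^{t_k}\big\|\big(S(t_n-r)-S(t_n-t_{k-1})\big)x\big\|^2\,dr\right)^{1/2}\le C\,\Delta t^{\gamma}\,\|x\|_{s-\frac1\rho}.$$ -/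

import Mathlib

open Set Filter Topology MeasureTheory

noncomputable section

namespace StochVolterra

/-- The Laplace transform of a real kernel on the half-line `(0, ∞)`. -/
def laplace (b : ℝ → ℝ) (z : ℂ) : ℂ :=
  ∫ t in Ioi (0 : ℝ), Complex.exp (-(z * (t : ℂ))) * (b t : ℂ)

/-- `ρ = 1 + (2 / π) * sup { |arg (laplace b z)| : Re z > 0 }`. -/
def rho (b : ℝ → ℝ) : ℝ :=
  1 + 2 / Real.pi * sSup {y : ℝ | ∃ z : ℂ, 0 < z.re ∧ y = |Complex.arg (laplace b z)|}

/-- The standing assumption on the kernel: `b` is a nonzero, locally integrable (up to `0`),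
3-monotone kernel on `(0, ∞)` that vanishes at infinity, with `1 < ρ < 2`. Only the values of `b`
on `(0, ∞)` matter. -/
structure IsKernel (b : ℝ → ℝ) : Prop where
  ne_zero : ∃ t : ℝ, 0 < t ∧ b t ≠ 0
  locallyIntegrable : ∀ T : ℝ, 0 < T → IntegrableOn b (Ioc 0 T)
  differentiableOn : DifferentiableOn ℝ b (Ioi 0)
  nonneg : ∀ t : ℝ, 0 < t → 0 ≤ b t
  antitoneOn : AntitoneOn b (Ioi 0)
  convexOn : ConvexOn ℝ (Ioi 0) b
  neg_deriv_nonneg : ∀ t : ℝ, 0 < t → 0 ≤ -deriv b t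
  neg_deriv_antitoneOn : AntitoneOn (fun t => -deriv b t) (Ioi 0)
  neg_deriv_convexOn : ConvexOn ℝ (Ioi 0) (fun t => -deriv b t)
  tendsto_zero : Tendsto b atTop (𝓝 0)
  one_lt_rho : 1 < rho b
  rho_lt_two : rho b < 2

section Operators

variable {H : Type*} [NormedAddCommGroup H] [InnerProductSpace ℝ H] [CompleteSpace H]

/-- The standing assumption on the operator: `A` is a densely defined, nonnegative, self-adjoint,
in general unbounded, operator on `H` with a compact inverse. -/
structure IsPosOperator (A : H →ₗ.[ℝ] H) : Prop where
  dense_domain : Dense (A.domain : Set H)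
  isSelfAdjoint : IsSelfAdjoint A
  nonneg : ∀ x : A.domain, 0 ≤ inner ℝ (A x) (x : H)
  compact_inverse : ∃ K : H →L[ℝ] H, IsCompactOperator K ∧
    (∀ y : H, ∃ h : K y ∈ A.domain, A ⟨K y, h⟩ = y) ∧ ∀ x : A.domain, K (A x) = (x : H)

/-- The eigenspace `{x ∈ D(A) : A x = μ x}`; it is `{0}` if `μ` is not an eigenvalue. -/
def eigenspace (A : H →ₗ.[ℝ] H) (μ : ℝ) : Submodule ℝ H where
  carrier := {x | ∃ h : x ∈ A.domain, A ⟨x, h⟩ = μ • x}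
  zero_mem' := ⟨A.domain.zero_mem, by
    have h0 : (⟨0, A.domain.zero_mem⟩ : A.domain) = 0 := rfl
    rw [h0, LinearPMap.map_zero, smul_zero]⟩
  add_mem' := by
    rintro x y ⟨hx, ex⟩ ⟨hy, ey⟩
    refine ⟨A.domain.add_mem hx hy, ?_⟩
    have h1 : (⟨x + y, A.domain.add_mem hx hy⟩ : A.domain) = ⟨x, hx⟩ + ⟨y, hy⟩ := rfl
    rw [h1, LinearPMap.map_add, ex, ey, smul_add]
  smul_mem' := by
    rintro c x ⟨hx, ex⟩
    refine ⟨A.domain.smul_mem c hx, ?_⟩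
    have h1 : (⟨c • x, A.domain.smul_mem c hx⟩ : A.domain) = c • ⟨x, hx⟩ := rfl
    rw [h1, LinearPMap.map_smul, ex, smul_comm]

/-- The orthogonal projection of `H` onto the eigenspace of `A` for `μ`. (For closed `A`, in
particular for self-adjoint `A`, the eigenspace is closed, and taking the closure, which makes the
definition meaningful for every `A`, changes nothing.) -/
def eigenproj (A : H →ₗ.[ℝ] H) (μ : ℝ) : H →L[ℝ] H :=
  (eigenspace A μ).topologicalClosure.starProjection

/-- The fractional power `A ^ σ x = ∑ μ ^ σ P_μ x` through the spectral decomposition of `A`, the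
sum running over the eigenvalues `μ` (all other terms are `0`) and `P_μ` being the orthogonal
projection onto the eigenspace of `μ`. The domain of `A ^ σ` consists of the `x` for which the
series converges; for `σ ≤ 0` this is all of `H`. -/
def fracPow (A : H →ₗ.[ℝ] H) (σ : ℝ) (x : H) : H :=
  ∑' μ : ℝ, (μ ^ σ) • eigenproj A μ x

/-- The norm `‖x‖_r = ‖A ^ (r / 2) x‖`. -/
def fracNorm (A : H →ₗ.[ℝ] H) (r : ℝ) (x : H) : ℝ :=
  ‖fracPow A (r / 2) x‖

/-- `S` is the resolvent family of the Volterra equation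
`u' (t) + ∫₀ᵗ b (t - r) A u(r) dr = 0`, that is, in integrated form, of
`u(t) + ∫₀ᵗ a (t - r) A u(r) dr = u(0)` with `a t = ∫₀ᵗ b`:
it is strongly continuous on `[0, ∞)` with `S 0 = I`, it commutes with `A`, and it solves the
equation for every initial value `x` in `D(A)` (note `A S(r) x = S(r) A x`).
These conditions determine `S t` for `t ≥ 0`; the values at `t < 0` are irrelevant. -/
structure IsResolventFamily (A : H →ₗ.[ℝ] H) (b : ℝ → ℝ) (S : ℝ → H →L[ℝ] H) : Prop where
  continuousOn : ∀ x : H, ContinuousOn (fun t => S t x) (Ici 0)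
  zero : S 0 = ContinuousLinearMap.id ℝ H
  commute : ∀ t : ℝ, 0 ≤ t → ∀ x : A.domain,
    ∃ h : S t x ∈ A.domain, A ⟨S t x, h⟩ = S t (A x)
  equation : ∀ t : ℝ, 0 ≤ t → ∀ x : A.domain,
    S t x + ∫ r in (0 : ℝ)..t, (∫ τ in (0 : ℝ)..(t - r), b τ) • S r (A x) = (x : H)

end Operators

end StochVolterra

end

/-! The spectral decomposition of `A` reduces everything to scalars: `P_μ S(t)x = s_μ(t) P_μ x`,
where `s_μ` solves `s' + μ (b * s) = 0`, `s(0) = 1`. By Parseval the squared error is the sum over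
eigenvalues of `‖P_μ x‖²` times the discretisation error `E_μ` of `s_μ`. It suffices to show `E_μ ≤
C h^(2γ) μ^(s - 1/ρ)` with `C` uniform in `μ ≥ μ₀ > 0` and in the exponent `s`.

Each mode has a characteristic frequency `x`, the solution of `μ b̂(x) = x`. The core estimates are
`∫₀ᵀ |s_μ'|² ≤ C x` and `∫₀ᵀ |t s_μ'|² ≤ C / x` (`IsKernel.exists_integral_sq_le`). A Hardy
inequality on each time step gives `E_μ ≤ 4 h² ∫ |s_μ'|²` and `E_μ ≤ 4 ∫ |t s_μ'|²`. Hence `E_μ ≤ C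
min(h² x, 1/x) ≤ C h^(ρs) x^(ρs-1)` since `0 < ρs ≤ 1`, and `x ≥ c μ^(1/ρ)` finishes because the
exponent `ρs - 1` is nonpositive.

The two square integrals come from Plancherel on the line `Re z = 1/T`, using `ŝ_μ = 1 / (z + μ
b̂(z))`. Three facts about `b̂` on the right half-plane are needed: `|b̂(z)|` is comparable to
`b̂(|z|)`; `|z b̂'(z)|` is at most a multiple of `b̂(|z|)`; and `|z + μ b̂(z)|` dominates `|z|`, `x`
and `μ |b̂(z)|`. The first two hold because `b` is the integral of the nonincreasing function `-b'`,
and a nonincreasing weight transfers inequalities between primitives to inequalities between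
integrals (`integral_mul_nonneg_of_antitoneOn`). The third holds because `ρ < 2` confines `b̂` to a
sector strictly inside the right half-plane.

The growth of `x` is the Schwarz lemma: a suitable root of `b̂` maps the right half-plane into
itself, which forces `x |b̂'(x)| ≤ (ρ - 1) b̂(x)`, so that `x^(ρ-1) b̂(x)` is nondecreasing
(`IsKernel.rpow_mul_realLaplace_mono`). The a priori bound `|s_μ| ≤ 1`, which legitimises the
transforms, is an energy estimate based on the positive type of `b`. -/

noncomputable section

namespace StochVolterra

/-! ### Plancherel's theorem for integrable square-integrable functions -/

section Plancherel

open FourierTransform SchwartzMap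

/-- On `L¹ ∩ L²` the `L²` Fourier transform is given by the Fourier integral. -/
theorem fourier_toLp_ae_eq {f : ℝ → ℂ} (h1 : Integrable f) (h2 : MemLp f 2) :
    ((𝓕 (h2.toLp f) : Lp ℂ 2 (volume : Measure ℝ)) : ℝ → ℂ) =ᵐ[volume] 𝓕 f := by
  have hcont : Continuous (𝓕 f) := by
    simpa using! VectorFourier.fourierIntegral_continuous (L := innerₗ ℝ)
      Real.continuous_fourierChar continuous_inner h1
  -- Both sides are compared as distributions: the `L²` transform agrees with the tempered one, and
  -- the Fourier integral moves onto the test function by Fubini.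
  refine ae_eq_of_integral_contDiff_smul_eq
    ((Lp.memLp _).locallyIntegrable (by norm_num)) hcont.locallyIntegrable ?_
  intro g hg hgs
  have hgc : HasCompactSupport (fun x => (g x : ℂ)) := hgs.comp_left (g := fun r : ℝ => (r : ℂ)) rfl
  have hgd : ContDiff ℝ (⊤ : ℕ∞) (fun x => (g x : ℂ)) :=
    Complex.ofRealCLM.contDiff.comp hg
  set φ : 𝓢(ℝ, ℂ) := hgc.toSchwartzMap hgd with hφ
  have e1 := congrArg (fun T => T φ) (Lp.fourier_toTemperedDistribution_eq (h2.toLp f))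
  simp only [TemperedDistribution.fourier_apply, Lp.toTemperedDistribution_apply] at e1
  have e2 : ∫ x, (𝓕 φ) x • (h2.toLp f) x = ∫ x, (𝓕 φ) x • f x := by
    refine integral_congr_ae ?_
    filter_upwards [h2.coeFn_toLp] with x hx
    rw [hx]
  have e3 : ∫ x, (𝓕 φ) x • f x = ∫ x, φ x • (𝓕 f) x := by
    simpa using! VectorFourier.integral_fourierIntegral_smul_eq_flip (L := innerₗ ℝ)
      Real.continuous_fourierChar continuous_inner φ.integrable h1
  have e4 : ∀ u : ℝ → ℂ, ∫ x, φ x • u x = ∫ x, g x • u x := by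
    intro u
    rfl
  rw [← e4, ← e4, ← e1, e2, e3]

theorem memLp_fourier {f : ℝ → ℂ} (h1 : Integrable f) (h2 : MemLp f 2) :
    MemLp (𝓕 f) 2 :=
  (memLp_congr_ae (fourier_toLp_ae_eq h1 h2)).1 (Lp.memLp _)

/-- Plancherel's theorem on `L¹ ∩ L²`, for inner products. -/
theorem integral_inner_fourier {f g : ℝ → ℂ} (hf1 : Integrable f) (hf2 : MemLp f 2)
    (hg1 : Integrable g) (hg2 : MemLp g 2) :
    ∫ ξ, inner ℂ (𝓕 f ξ) (𝓕 g ξ) = ∫ t, inner ℂ (f t) (g t) := by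
  have h := Lp.inner_fourier_eq (hf2.toLp f) (hg2.toLp g)
  rw [L2.inner_def, L2.inner_def] at h
  have e1 : ∫ ξ, inner ℂ ((𝓕 (hf2.toLp f) : Lp ℂ 2 (volume : Measure ℝ)) ξ)
      ((𝓕 (hg2.toLp g) : Lp ℂ 2 (volume : Measure ℝ)) ξ) = ∫ ξ, inner ℂ (𝓕 f ξ) (𝓕 g ξ) := by
    refine integral_congr_ae ?_
    filter_upwards [fourier_toLp_ae_eq hf1 hf2, fourier_toLp_ae_eq hg1 hg2] with x hx hy
    rw [hx, hy]
  have e2 : ∫ ξ, inner ℂ ((hf2.toLp f) ξ) ((hg2.toLp g) ξ) = ∫ ξ, inner ℂ (f ξ) (g ξ) := by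
    refine integral_congr_ae ?_
    filter_upwards [hf2.coeFn_toLp, hg2.coeFn_toLp] with x hx hy
    rw [hx, hy]
  rw [← e1, ← e2]
  exact h

/-- Plancherel's theorem on `L¹ ∩ L²`. -/
theorem integral_norm_sq_fourier {f : ℝ → ℂ} (hf1 : Integrable f) (hf2 : MemLp f 2) :
    ∫ ξ, ‖𝓕 f ξ‖ ^ 2 = ∫ t, ‖f t‖ ^ 2 := by
  have h := integral_inner_fourier hf1 hf2 hf1 hf2
  simp only [inner_self_eq_norm_sq_to_K] at h
  have h' : ((∫ ξ, ‖𝓕 f ξ‖ ^ 2 : ℝ) : ℂ) = ((∫ t, ‖f t‖ ^ 2 : ℝ) : ℂ) := by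
    rw [← integral_complex_ofReal, ← integral_complex_ofReal]
    simpa using h
  exact_mod_cast h'

end Plancherel

/-! ### Monotone weights: layer-cake comparison and integration by parts -/

section Layer

/-- A nonincreasing nonnegative weight vanishing at infinity preserves the sign of a function whose
primitive is nonnegative. -/
theorem integral_mul_nonneg_of_antitoneOn {β h : ℝ → ℝ} (hβ : AntitoneOn β (Ioi 0))
    (hβ0 : ∀ t, 0 < t → 0 ≤ β t) (hlim : Tendsto β atTop (𝓝 0)) (hh : Continuous h)
    (hint : IntegrableOn (fun t => h t * β t) (Ioi 0))
    (hH : ∀ c, 0 < c → 0 ≤ ∫ t in (0 : ℝ)..c, h t) :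
    0 ≤ ∫ t in Ioi (0 : ℝ), h t * β t := by
  have hβm : AEMeasurable β (volume.restrict (Ioi 0)) :=
    aemeasurable_restrict_of_antitoneOn measurableSet_Ioi hβ
  -- Layer-cake formula for the weight `β` under the measure `g⁺ dt`. Applied to `h` and `-h`, it
  -- reduces the claim to superlevel sets of `β`.
  have key : ∀ g : ℝ → ℝ, Continuous g →
      ∫⁻ t in Ioi (0 : ℝ), ENNReal.ofReal (g t * β t) =
        ∫⁻ v in Ioi (0 : ℝ), ((volume.restrict (Ioi 0)).withDensity
          (fun t => ENNReal.ofReal (g t))) {t | v < β t} := by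
    intro g hg
    have hgm : Measurable fun t => ENNReal.ofReal (g t) := by fun_prop
    have hac : (volume.restrict (Ioi (0:ℝ))).withDensity (fun t => ENNReal.ofReal (g t)) ≪
        volume.restrict (Ioi 0) := withDensity_absolutelyContinuous _ _
    have hpos : ∀ᵐ t ∂(volume.restrict (Ioi (0:ℝ))), 0 ≤ β t :=
      (ae_restrict_iff' measurableSet_Ioi).2 (Eventually.of_forall hβ0)
    rw [← lintegral_eq_lintegral_meas_lt _ (hac.ae_le hpos) (hβm.mono_ac hac),
      lintegral_withDensity_eq_lintegral_mul_non_measurable₀ _ hgm.aemeasurable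
        (Eventually.of_forall fun _ => ENNReal.ofReal_lt_top)]
    refine lintegral_congr_ae ?_
    filter_upwards [hpos] with t ht
    simp only [Pi.mul_apply]
    rw [ENNReal.ofReal_mul' ht]
  have hle : ∫⁻ t in Ioi (0 : ℝ), ENNReal.ofReal (-(h t * β t)) ≤
      ∫⁻ t in Ioi (0 : ℝ), ENNReal.ofReal (h t * β t) := by
    simp_rw [← neg_mul]
    rw [key (fun t => -h t) hh.neg, key _ hh]
    refine setLIntegral_mono' measurableSet_Ioi fun v hv => ?_
    have hv : 0 < v := hv
    set S := {t | 0 < t ∧ v < β t} with hS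
    -- Decay of `β` makes each superlevel set bounded; monotonicity makes it an interval starting at
    -- `0`, so only primitives of `h` over `(0, c]` occur.
    obtain ⟨R, hR⟩ := (hlim.eventually_lt_const hv).exists_forall_of_atTop
    have hbdd : BddAbove S := ⟨R, fun t ht => by
      by_contra hc
      exact absurd (hR t (not_le.1 hc).le) (not_lt.2 ht.2.le)⟩
    have hform : ∀ g : ℝ → ℝ, Continuous g → ((volume.restrict (Ioi 0)).withDensity
          (fun t => ENNReal.ofReal (g t))) {t | v < β t} =
          ∫⁻ t in Ioc 0 (sSup S), ENNReal.ofReal (g t) := by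
      intro g hg
      have hnull : NullMeasurableSet {t | v < β t} (volume.restrict (Ioi (0:ℝ))) :=
        nullMeasurableSet_lt aemeasurable_const hβm
      rw [withDensity_apply₀ _ hnull, Measure.restrict_restrict₀ hnull]
      have : ({t | v < β t} ∩ Ioi 0 : Set ℝ) = S := by
        ext t; simp [hS, and_comm]
      rw [this]
      refine setLIntegral_congr ?_
      rcases S.eq_empty_or_nonempty with he | hne
      · rw [he, Real.sSup_empty]; simp
      · have h1 : Ioo 0 (sSup S) ⊆ S := by
          intro t ht
          obtain ⟨u, hu, htu⟩ := exists_lt_of_lt_csSup hne ht.2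
          exact ⟨ht.1, hu.2.trans_le (hβ ht.1 hu.1 htu.le)⟩
        have h2 : S ⊆ Ioc 0 (sSup S) := fun t ht => ⟨ht.1, le_csSup hbdd ht⟩
        refine Filter.EventuallyEq.symm ?_
        have h3 : (Ioc 0 (sSup S) : Set ℝ) =ᵐ[volume] (Ioo 0 (sSup S) : Set ℝ) := Ioo_ae_eq_Ioc.symm
        refine Filter.EventuallyLE.antisymm ?_ (LE.le.eventuallyLE h2)
        exact h3.le.trans (LE.le.eventuallyLE h1)
    rw [hform (fun t => -h t) hh.neg, hform _ hh]
    rcases le_or_gt (sSup S) 0 with hc | hc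
    · simp [Ioc_eq_empty (not_lt.2 hc)]
    · have hi : IntegrableOn h (Ioc 0 (sSup S)) := (hh.intervalIntegrable _ _).1
      have h1 := hH _ hc
      rw [intervalIntegral.integral_of_le hc.le,
        integral_eq_lintegral_pos_part_sub_lintegral_neg_part hi] at h1
      have hf1 : ∫⁻ t in Ioc 0 (sSup S), ENNReal.ofReal (h t) ≠ ⊤ := hi.lintegral_lt_top.ne
      have hf2 : ∫⁻ t in Ioc 0 (sSup S), ENNReal.ofReal (-h t) ≠ ⊤ := hi.neg.lintegral_lt_top.ne
      exact (ENNReal.toReal_le_toReal hf2 hf1).1 (by linarith)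
  rw [integral_eq_lintegral_pos_part_sub_lintegral_neg_part hint]
  exact sub_nonneg.2 (ENNReal.toReal_mono hint.lintegral_lt_top.ne hle)

/-- Integration by parts against a primitive `b t = ∫ₜ^∞ β`. -/
theorem integral_mul_eq_integral_primitive {β b : ℝ → ℝ} {w : ℝ → ℂ}
    (hβm : AEMeasurable β (volume.restrict (Ioi 0))) (hβ0 : ∀ t, 0 < t → 0 ≤ β t)
    (hβi : ∀ t, 0 < t → IntegrableOn β (Ioi t)) (hb : ∀ t, 0 < t → b t = ∫ r in Ioi t, β r)
    (hw : Continuous w) (hint : IntegrableOn (fun t => w t * b t) (Ioi 0)) :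
    IntegrableOn (fun r => (∫ t in (0 : ℝ)..r, w t) * β r) (Ioi 0) ∧
      ∫ t in Ioi (0 : ℝ), w t * b t = ∫ r in Ioi (0 : ℝ), (∫ t in (0 : ℝ)..r, w t) * β r := by
  set ν := volume.restrict (Ioi (0:ℝ)) with hν
  -- Fubini on the triangle `t < r`: integrating in `r` gives `w t * b t`, integrating in `t` gives
  -- the primitive of `w` times `β r`. Absolute integrability is inherited from `w * b` because `β ≥
  -- 0`.
  set G : ℝ × ℝ → ℂ := {p : ℝ × ℝ | p.1 < p.2}.indicator (fun p => w p.1 * (β p.2 : ℂ)) with hG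
  have hmeas : AEStronglyMeasurable G (ν.prod ν) := by
    refine AEStronglyMeasurable.indicator ?_ (measurableSet_lt measurable_fst measurable_snd)
    exact (hw.measurable.comp measurable_fst).aestronglyMeasurable.mul
      ((Complex.measurable_ofReal.comp_aemeasurable hβm).aestronglyMeasurable.comp_snd)
  have hG1 : ∀ t, (fun r => G (t, r)) = (Ioi t).indicator (fun r => w t * (β r : ℂ)) := by
    intro t; ext r; simp [hG, indicator]
  have hG2 : ∀ r, (fun t => G (t, r)) = (Iio r).indicator (fun t => w t * (β r : ℂ)) := by
    intro r; ext t; simp [hG, indicator]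
  have hrest : ∀ t, 0 < t → ν.restrict (Ioi t) = volume.restrict (Ioi t) := by
    intro t ht
    rw [hν, Measure.restrict_restrict measurableSet_Ioi]
    congr 1
    exact inter_eq_left.2 (Ioi_subset_Ioi ht.le)
  have hsec : ∀ t, 0 < t → Integrable (fun r => G (t, r)) ν := by
    intro t ht
    rw [hG1, integrable_indicator_iff measurableSet_Ioi, IntegrableOn, hrest t ht]
    exact ((hβi t ht).ofReal).const_mul _
  have hinn : ∀ t, 0 < t → ∫ r, G (t, r) ∂ν = w t * b t := by
    intro t ht
    rw [hG1, integral_indicator measurableSet_Ioi, hrest t ht, integral_const_mul, hb t ht,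
      integral_complex_ofReal]
  have hinnn : ∀ t, 0 < t → ∫ r, ‖G (t, r)‖ ∂ν = ‖w t * b t‖ := by
    intro t ht
    have : (fun r => ‖G (t, r)‖) = (Ioi t).indicator (fun r => ‖w t‖ * ‖(β r : ℂ)‖) := by
      ext r
      rw [congrFun (hG1 t) r, norm_indicator_eq_indicator_norm]
      simp
    rw [this, integral_indicator measurableSet_Ioi, hrest t ht, integral_const_mul, norm_mul,
      Complex.norm_real, hb t ht]
    congr 1
    have hn : ∀ r ∈ Ioi t, ‖(β r : ℂ)‖ = β r := fun r hr => by
      rw [Complex.norm_real, Real.norm_of_nonneg (hβ0 r (ht.trans hr))]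
    rw [setIntegral_congr_fun measurableSet_Ioi hn, Real.norm_of_nonneg]
    exact setIntegral_nonneg measurableSet_Ioi fun r hr => hβ0 r (ht.trans hr)
  have hGi : Integrable G (ν.prod ν) := by
    rw [integrable_prod_iff hmeas]
    refine ⟨(ae_restrict_iff' measurableSet_Ioi).2 (Eventually.of_forall hsec), ?_⟩
    refine Integrable.congr hint.norm ?_
    exact (ae_restrict_iff' measurableSet_Ioi).2 (Eventually.of_forall fun t ht => (hinnn t ht).symm)
  have houter : ∀ r, 0 < r → ∫ t, G (t, r) ∂ν = (∫ t in (0 : ℝ)..r, w t) * β r := by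
    intro r hr
    rw [hG2, integral_indicator measurableSet_Iio, hν, Measure.restrict_restrict measurableSet_Iio,
      Iio_inter_Ioi, integral_mul_const, intervalIntegral.integral_of_le hr.le,
      integral_Ioc_eq_integral_Ioo]
  refine ⟨?_, ?_⟩
  · exact hGi.integral_prod_right.congr
      ((ae_restrict_iff' measurableSet_Ioi).2 (Eventually.of_forall houter))
  · rw [← setIntegral_congr_fun measurableSet_Ioi hinn, ← setIntegral_congr_fun measurableSet_Ioi houter]
    exact integral_integral_swap hGi

end Layer

/-! ### The kernel as an integral of its nonincreasing negative derivative -/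

namespace IsKernel

variable {b : ℝ → ℝ}

theorem hasDerivAt (hb : IsKernel b) {t : ℝ} (ht : 0 < t) : HasDerivAt b (deriv b t) t :=
  (hb.differentiableOn.differentiableAt (Ioi_mem_nhds ht)).hasDerivAt

theorem continuousOn (hb : IsKernel b) : ContinuousOn b (Ioi 0) :=
  hb.differentiableOn.continuousOn

theorem integrableOn_neg_deriv (hb : IsKernel b) {t : ℝ} (ht : 0 < t) :
    IntegrableOn (fun r => -deriv b r) (Ioi t) := by
  refine Integrable.neg ?_
  exact integrableOn_Ioi_deriv_of_nonpos (hb.hasDerivAt ht).continuousAt.continuousWithinAt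
    (fun r hr => hb.hasDerivAt (ht.trans hr))
    (fun r hr => by have := hb.neg_deriv_nonneg r (ht.trans hr); linarith) hb.tendsto_zero

theorem eq_integral_neg_deriv (hb : IsKernel b) {t : ℝ} (ht : 0 < t) :
    b t = ∫ r in Ioi t, -deriv b r := by
  rw [integral_neg, integral_Ioi_of_hasDerivAt_of_nonpos
    (hb.hasDerivAt ht).continuousAt.continuousWithinAt
    (fun r hr => hb.hasDerivAt (ht.trans hr))
    (fun r hr => by have := hb.neg_deriv_nonneg r (ht.trans hr); linarith) hb.tendsto_zero]
  ring

/-- By monotonicity, `-b'(t+1)` is at most the mean of `-b'` over `[t, t+1]`, which is at most `b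
t`. -/
theorem tendsto_neg_deriv (hb : IsKernel b) : Tendsto (fun t => -deriv b t) atTop (𝓝 0) := by
  have hle : ∀ t, 1 ≤ t → -deriv b (t + 1) ≤ b t := by
    intro t ht
    have h0 : 0 < t := by linarith
    rw [hb.eq_integral_neg_deriv h0]
    have hi := hb.integrableOn_neg_deriv h0
    calc -deriv b (t + 1) = ∫ r in Ioc t (t + 1), -deriv b (t + 1) := by simp
      _ ≤ ∫ r in Ioc t (t + 1), -deriv b r := by
          refine setIntegral_mono_on (by simp) (hi.mono_set Ioc_subset_Ioi_self)
            measurableSet_Ioc fun r hr => ?_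
          exact hb.neg_deriv_antitoneOn (h0.trans hr.1) (show (0:ℝ) < t + 1 by linarith) hr.2
      _ ≤ _ := by
          refine setIntegral_mono_set hi ?_ Ioc_subset_Ioi_self.eventuallyLE
          exact (ae_restrict_iff' measurableSet_Ioi).2
            (Eventually.of_forall fun r hr => hb.neg_deriv_nonneg r (h0.trans hr))
  have h1 : Tendsto (fun t => -deriv b (t + 1)) atTop (𝓝 0) := by
    refine tendsto_of_tendsto_of_tendsto_of_le_of_le' tendsto_const_nhds hb.tendsto_zero ?_ ?_
    · filter_upwards [eventually_ge_atTop 1] with t ht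
      exact hb.neg_deriv_nonneg _ (by linarith)
    · filter_upwards [eventually_ge_atTop 1] with t ht using hle t ht
  have h2 := h1.comp (tendsto_atTop_add_const_right atTop (-1 : ℝ) tendsto_id)
  refine h2.congr fun t => ?_
  simp

theorem aemeasurable (hb : IsKernel b) : AEMeasurable b (volume.restrict (Ioi 0)) :=
  aemeasurable_restrict_of_antitoneOn measurableSet_Ioi hb.antitoneOn

/-- Near `0` the bound on `w` leaves the locally integrable `b`; beyond `1` the kernel is at most `b
1` and the exponential is integrable. -/
theorem integrableOn_mul_of_bound (hb : IsKernel b) {w : ℝ → ℂ} (hw : Continuous w) {C κ : ℝ}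
    (hκ : 0 < κ) (hC : ∀ t, 0 < t → ‖w t‖ ≤ C * Real.exp (-(κ * t))) :
    IntegrableOn (fun t => w t * b t) (Ioi 0) := by
  have hm : AEStronglyMeasurable (fun t => w t * (b t : ℂ)) (volume.restrict (Ioi 0)) :=
    hw.aestronglyMeasurable.mul
      (Complex.measurable_ofReal.comp_aemeasurable hb.aemeasurable).aestronglyMeasurable
  have hC0 : 0 ≤ C := by
    have h := (norm_nonneg _).trans (hC 1 one_pos)
    exact nonneg_of_mul_nonneg_left h (Real.exp_pos _)
  rw [← Ioc_union_Ioi_eq_Ioi (zero_le_one (α := ℝ))]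
  refine IntegrableOn.union ?_ ?_
  · refine Integrable.mono' ((hb.locallyIntegrable 1 one_pos).const_mul C)
      (hm.mono_set Ioc_subset_Ioi_self) ?_
    refine (ae_restrict_iff' measurableSet_Ioc).2 (Eventually.of_forall fun t ht => ?_)
    rw [norm_mul, Complex.norm_real, Real.norm_of_nonneg (hb.nonneg t ht.1)]
    refine mul_le_mul_of_nonneg_right ((hC t ht.1).trans ?_) (hb.nonneg t ht.1)
    refine mul_le_of_le_one_right hC0 (Real.exp_le_one_iff.2 ?_)
    have := mul_pos hκ ht.1
    linarith
  · have he : IntegrableOn (fun t : ℝ => C * b 1 * Real.exp (-κ * t)) (Ioi 1) :=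
      (exp_neg_integrableOn_Ioi 1 hκ).const_mul _
    refine Integrable.mono' he (hm.mono_set (Ioi_subset_Ioi zero_le_one)) ?_
    refine (ae_restrict_iff' measurableSet_Ioi).2 (Eventually.of_forall fun t ht => ?_)
    have ht' : (1:ℝ) < t := ht
    have h0 : 0 < t := by linarith
    rw [norm_mul, Complex.norm_real, Real.norm_of_nonneg (hb.nonneg t h0)]
    calc ‖w t‖ * b t ≤ (C * Real.exp (-(κ * t))) * b 1 :=
          mul_le_mul (hC t h0) (hb.antitoneOn (show (0:ℝ) < 1 from one_pos) h0 ht'.le)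
            (hb.nonneg t h0) (by positivity)
      _ = _ := by rw [neg_mul]; ring

theorem integral_mul_eq (hb : IsKernel b) {w : ℝ → ℂ} (hw : Continuous w)
    (hint : IntegrableOn (fun t => w t * b t) (Ioi 0)) :
    IntegrableOn (fun r => (∫ t in (0 : ℝ)..r, w t) * ((-deriv b r : ℝ) : ℂ)) (Ioi 0) ∧
      ∫ t in Ioi (0 : ℝ), w t * b t =
        ∫ r in Ioi (0 : ℝ), (∫ t in (0 : ℝ)..r, w t) * ((-deriv b r : ℝ) : ℂ) :=
  integral_mul_eq_integral_primitive (β := fun r => -deriv b r)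
    (aemeasurable_restrict_of_antitoneOn measurableSet_Ioi hb.neg_deriv_antitoneOn)
    hb.neg_deriv_nonneg (fun _ ht => hb.integrableOn_neg_deriv ht)
    (fun _ ht => hb.eq_integral_neg_deriv ht) hw hint

end IsKernel

/-- The Laplace transform of a real kernel at a real argument. -/
def realLaplace (b : ℝ → ℝ) (x : ℝ) : ℝ :=
  ∫ t in Ioi (0 : ℝ), Real.exp (-(x * t)) * b t

/-! ### Explicit inequalities for exponentials on the right half-plane -/

section Elementary

theorem div_one_add_le_one_sub_exp_neg {u : ℝ} (hu : 0 ≤ u) :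
    u / (1 + u) ≤ 1 - Real.exp (-u) := by
  have h1 : 1 + u ≤ Real.exp u := by linarith [Real.add_one_le_exp u]
  have h2 : Real.exp (-u) ≤ 1 / (1 + u) := by
    rw [Real.exp_neg, ← one_div]
    exact one_div_le_one_div_of_le (by linarith) h1
  have h3 : u / (1 + u) = 1 - 1 / (1 + u) := by
    field_simp
    ring
  linarith

theorem norm_exp_neg_le_one {z : ℂ} (hz : 0 ≤ z.re) : ‖Complex.exp (-z)‖ ≤ 1 := by
  rw [Complex.norm_exp, Real.exp_le_one_iff]
  simpa using hz

theorem norm_one_sub_exp_neg_le {z : ℂ} (hz : 0 ≤ z.re) :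
    ‖1 - Complex.exp (-z)‖ ≤ 4 * (1 - Real.exp (-‖z‖)) := by
  have hu := norm_nonneg z
  have h0 := div_one_add_le_one_sub_exp_neg hu
  rcases le_or_gt ‖z‖ 1 with h | h
  · have h1 : ‖1 - Complex.exp (-z)‖ ≤ 2 * ‖z‖ := by
      rw [norm_sub_rev]
      simpa using Complex.norm_exp_sub_one_le (x := -z) (by simpa using h)
    have h2 : ‖z‖ / 2 ≤ ‖z‖ / (1 + ‖z‖) :=
      div_le_div_of_nonneg_left hu (by linarith) (by linarith)
    linarith
  · have h1 : ‖1 - Complex.exp (-z)‖ ≤ 2 := by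
      refine (norm_sub_le _ _).trans ?_
      have := norm_exp_neg_le_one hz
      rw [norm_one]; linarith
    have h2 : 1 / 2 ≤ ‖z‖ / (1 + ‖z‖) := by
      rw [div_le_div_iff₀ (by norm_num) (by linarith)]; linarith
    linarith

/-- The left side is `z ^ 3` times the second primitive of `t e^(-zt)` at `t = 1`. The right side
has the size `min(|z|², |z|)` of the second primitive of a comparison kernel, so this is the
inequality between primitives behind the bound on `b̂'`. -/
theorem norm_add_exp_neg_mul_le {z : ℂ} (hz : 0 ≤ z.re) :
    ‖z - 2 + Complex.exp (-z) * (z + 2)‖ ≤ 24 * (‖z‖ ^ 2 / (2 * (1 + ‖z‖))) := by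
  have hu := norm_nonneg z
  rcases le_or_gt ‖z‖ 1 with h | h
  · have h1 : ‖Complex.exp (-z) - 1 - -z‖ ≤ ‖z‖ ^ 2 := by
      simpa using Complex.norm_exp_sub_one_sub_id_le (x := -z) (by simpa using h)
    have e : z - 2 + Complex.exp (-z) * (z + 2) =
        -z ^ 2 + (Complex.exp (-z) - 1 - -z) * (z + 2) := by ring
    have h2 : ‖z + 2‖ ≤ 3 := (norm_add_le _ _).trans (by simp; linarith)
    rw [e]
    calc _ ≤ ‖z‖ ^ 2 + ‖z‖ ^ 2 * 3 := by
          refine (norm_add_le _ _).trans (add_le_add (by simp) ?_)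
          rw [norm_mul]
          exact mul_le_mul h1 h2 (norm_nonneg _) (by positivity)
      _ ≤ _ := by
          have : ‖z‖ ^ 2 / 4 ≤ ‖z‖ ^ 2 / (2 * (1 + ‖z‖)) :=
            div_le_div_of_nonneg_left (by positivity) (by linarith) (by linarith)
          nlinarith [sq_nonneg ‖z‖]
  · have h1 : ‖z - 2 + Complex.exp (-z) * (z + 2)‖ ≤ 2 * ‖z‖ + 4 := by
      have h3 : ‖z + 2‖ ≤ ‖z‖ + 2 := (norm_add_le _ _).trans (by simp)
      have h4 : ‖z - 2‖ ≤ ‖z‖ + 2 := (norm_sub_le _ _).trans (by simp)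
      have h5 : ‖Complex.exp (-z) * (z + 2)‖ ≤ 1 * (‖z‖ + 2) := by
        rw [norm_mul]
        exact mul_le_mul (norm_exp_neg_le_one hz) h3 (norm_nonneg _) zero_le_one
      linarith [norm_add_le (z - 2) (Complex.exp (-z) * (z + 2))]
    refine h1.trans ?_
    rw [← mul_div_assoc, le_div_iff₀ (by linarith)]
    nlinarith

theorem integral_exp_neg_mul {z : ℂ} (hz : z ≠ 0) (r : ℝ) :
    ∫ t in (0 : ℝ)..r, Complex.exp (-(z * t)) = (1 - Complex.exp (-(z * r))) / z := by
  have h := integral_exp_mul_complex (a := 0) (b := r) (c := -z) (neg_ne_zero.2 hz)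
  simp only [neg_mul, Complex.ofReal_zero, mul_zero, Complex.exp_zero] at h
  rw [h, div_neg, ← neg_div]
  ring

theorem hasDerivAt_cexp_neg_mul (z : ℂ) (t : ℝ) :
    HasDerivAt (fun t : ℝ => Complex.exp (-(z * t))) (-z * Complex.exp (-(z * t))) t := by
  have h1 : HasDerivAt (fun t : ℝ => -(z * (t : ℂ))) (-z) t := by
    simpa using! (Complex.ofRealCLM.hasDerivAt (x := t)).const_mul z |>.neg
  simpa [mul_comm] using h1.cexp

/-- The primitive of `t ↦ t e ^ (-z t)`. -/
theorem integral_mul_exp_neg_mul {z : ℂ} (hz : z ≠ 0) (r : ℝ) :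
    ∫ t in (0 : ℝ)..r, (t : ℂ) * Complex.exp (-(z * t)) =
      (1 - Complex.exp (-(z * r)) * (1 + z * r)) / z ^ 2 := by
  have hd : ∀ t : ℝ, HasDerivAt
      (fun t : ℝ => (1 - Complex.exp (-(z * t)) * (1 + z * t)) / z ^ 2)
      ((t : ℂ) * Complex.exp (-(z * t))) t := by
    intro t
    have h1 : HasDerivAt (fun t : ℝ => (1 + z * (t : ℂ))) z t := by
      simpa using ((Complex.ofRealCLM.hasDerivAt (x := t)).const_mul z).const_add 1
    have h2 := ((hasDerivAt_cexp_neg_mul z t).mul h1).const_sub 1 |>.div_const (z ^ 2)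
    convert! h2 using 1
    field_simp
    ring
  rw [intervalIntegral.integral_eq_sub_of_hasDerivAt (fun t _ => hd t)
    (Continuous.intervalIntegrable (by fun_prop) _ _)]
  simp

/-- The second primitive of `t ↦ t e ^ (-z t)`. -/
theorem integral_integral_mul_exp_neg_mul {z : ℂ} (hz : z ≠ 0) (c : ℝ) :
    ∫ r in (0 : ℝ)..c, ∫ t in (0 : ℝ)..r, (t : ℂ) * Complex.exp (-(z * t)) =
      (z * c - 2 + Complex.exp (-(z * c)) * (z * c + 2)) / z ^ 3 := by
  simp_rw [integral_mul_exp_neg_mul hz]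
  have hd : ∀ t : ℝ, HasDerivAt
      (fun t : ℝ => (z * t - 2 + Complex.exp (-(z * t)) * (z * t + 2)) / z ^ 3)
      ((1 - Complex.exp (-(z * t)) * (1 + z * t)) / z ^ 2) t := by
    intro t
    have h0 : HasDerivAt (fun t : ℝ => z * (t : ℂ)) z t := by
      simpa using (Complex.ofRealCLM.hasDerivAt (x := t)).const_mul z
    have h2 := ((h0.sub_const 2).add ((hasDerivAt_cexp_neg_mul z t).mul (h0.add_const 2))).div_const
      (z ^ 3)
    convert! h2 using 1
    field_simp
    ring
  rw [intervalIntegral.integral_eq_sub_of_hasDerivAt (fun t _ => hd t)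
    (Continuous.intervalIntegrable (by fun_prop) _ _)]
  simp

theorem le_integral_one_sub_exp_neg {x c : ℝ} (hx : 0 < x) (hc : 0 < c) :
    x * c ^ 2 / (2 * (1 + x * c)) ≤ ∫ t in (0 : ℝ)..c, (1 - Real.exp (-(x * t))) := by
  have hxc : 0 < x * c := mul_pos hx hc
  calc x * c ^ 2 / (2 * (1 + x * c)) = ∫ t in (0 : ℝ)..c, x / (1 + x * c) * t := by
        rw [intervalIntegral.integral_const_mul, integral_id]
        field_simp
        ring
    _ ≤ _ := by
        refine intervalIntegral.integral_mono_on hc.le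
          (Continuous.intervalIntegrable (by fun_prop) _ _)
          (Continuous.intervalIntegrable (by fun_prop) _ _) fun t ht => ?_
        have h0 : 0 ≤ x * t := mul_nonneg hx.le ht.1
        refine le_trans ?_ (div_one_add_le_one_sub_exp_neg h0)
        rw [div_mul_eq_mul_div]
        exact div_le_div_of_nonneg_left h0 (by linarith)
          (by nlinarith [mul_le_mul_of_nonneg_left ht.2 hx.le])

/-- Jordan's inequality on either side of `π / 2`; the slope is so small because `3` is close to
`π`. -/
theorem mul_le_sin_of_le_three {y : ℝ} (h0 : 0 ≤ y) (h3 : y ≤ 3) : y / 40 ≤ Real.sin y := by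
  have hpi := Real.pi_gt_d2
  have hpi' := Real.pi_lt_d2
  have hk : (0.63:ℝ) ≤ 2 / Real.pi := by
    rw [le_div_iff₀ (by linarith)]; linarith
  rcases le_or_gt y (Real.pi / 2) with h | h
  · have := Real.mul_le_sin h0 h
    nlinarith
  · have h1 := Real.mul_le_sin (x := Real.pi - y) (by linarith) (by linarith)
    rw [Real.sin_pi_sub] at h1
    nlinarith

/-- Pointwise lower bound for `Re ((1 - i) (1 - e ^ (-z)))` near the origin of the quadrant. -/
theorem le_re_one_sub_exp_neg {z : ℂ} (hx : 0 ≤ z.re) (hy : 0 ≤ z.im) (h3 : ‖z‖ ≤ 3) :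
    1 / 1000 * ‖z‖ ≤ ((1 - Complex.I) * (1 - Complex.exp (-z))).re := by
  have e : ((1 - Complex.I) * (1 - Complex.exp (-z))).re =
      1 - Real.exp (-z.re) * Real.cos z.im + Real.exp (-z.re) * Real.sin z.im := by
    simp [Complex.mul_re, Complex.exp_re, Complex.exp_im]
  rw [e]
  have hx3 : z.re ≤ 3 := (Complex.re_le_norm z).trans h3
  have hy3 : z.im ≤ 3 := (Complex.im_le_norm z).trans h3
  -- The constant `1 / 1000` of the statement is `1 / 25` from `e^(-3)` times `1 / 40` from the
  -- sine.
  have hexp : (1:ℝ) / 25 ≤ Real.exp (-z.re) := by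
    have h1 : Real.exp (-3) ≤ Real.exp (-z.re) := Real.exp_le_exp.2 (by linarith)
    have h2 : Real.exp 3 ≤ 25 := by
      have : Real.exp 3 = Real.exp 1 ^ 3 := by rw [← Real.exp_nat_mul]; norm_num
      rw [this]
      have h4 := Real.exp_one_lt_d9
      calc Real.exp 1 ^ 3 ≤ (2.7182818286 : ℝ) ^ 3 :=
            pow_le_pow_left₀ (Real.exp_pos 1).le h4.le 3
        _ ≤ 25 := by norm_num
    have h5 : (1:ℝ) / 25 ≤ Real.exp (-3) := by
      rw [Real.exp_neg, ← one_div]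
      exact one_div_le_one_div_of_le (Real.exp_pos _) h2
    linarith
  have hs := mul_le_sin_of_le_three hy hy3
  have h1 := div_one_add_le_one_sub_exp_neg hx
  have h2 : z.re / 4 ≤ z.re / (1 + z.re) :=
    div_le_div_of_nonneg_left hx (by linarith) (by linarith)
  have h3' : Real.exp (-z.re) * Real.cos z.im ≤ Real.exp (-z.re) :=
    mul_le_of_le_one_right (Real.exp_pos _).le (Real.cos_le_one _)
  have h4 : 1 / 25 * (z.im / 40) ≤ Real.exp (-z.re) * Real.sin z.im :=
    mul_le_mul hexp hs (by positivity) (Real.exp_pos _).le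
  have h5 : ‖z‖ ≤ z.re + z.im := by
    have := Complex.norm_le_abs_re_add_abs_im z
    rwa [abs_of_nonneg hx, abs_of_nonneg hy] at this
  nlinarith

/-- The integrands are not ordered pointwise for large `t`, since the sine may become negative, but
their primitives are: the linear term `c` eventually dominates the bounded oscillation. -/
theorem le_integral_re_one_sub_exp_neg {z : ℂ} (hx : 0 < z.re) (hy : 0 ≤ z.im) {c : ℝ}
    (hc : 0 < c) :
    ∫ t in (0 : ℝ)..c, (1 / 1000 * (1 - Real.exp (-(‖z‖ * t)))) ≤
      ∫ t in (0 : ℝ)..c, ((1 - Complex.I) * (1 - Complex.exp (-(z * t)))).re := by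
  have hz : z ≠ 0 := fun h => by simp [h] at hx
  have hr : 0 < ‖z‖ := norm_pos_iff.2 hz
  have hcont : Continuous fun t : ℝ => ((1 - Complex.I) * (1 - Complex.exp (-(z * t)))).re := by
    fun_prop
  -- The threshold `3` lies between `2√2` and `π`: below it the sine is still nonnegative, above it
  -- the oscillating term, at most `2√2 / ‖z‖`, stays below `c`.
  rcases le_or_gt (‖z‖ * c) 3 with h | h
  · refine intervalIntegral.integral_mono_on hc.le
      (Continuous.intervalIntegrable (by fun_prop) _ _) (hcont.intervalIntegrable _ _)
      fun t ht => ?_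
    have hn : ‖z * (t : ℂ)‖ = ‖z‖ * t := by
      rw [norm_mul, Complex.norm_real, Real.norm_of_nonneg ht.1]
    have h1 := le_re_one_sub_exp_neg (z := z * t) (by simpa using mul_nonneg hx.le ht.1)
      (by simpa using mul_nonneg hy ht.1)
      (by rw [hn]; exact (mul_le_mul_of_nonneg_left ht.2 hr.le).trans h)
    rw [hn] at h1
    have h2 := Real.one_sub_le_exp_neg (‖z‖ * t)
    linarith
  · have h1 : ∫ t in (0 : ℝ)..c, (1 / 1000 * (1 - Real.exp (-(‖z‖ * t)))) ≤ 1 / 1000 * c := by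
      calc _ ≤ ∫ t in (0 : ℝ)..c, (1 / 1000 : ℝ) := by
            refine intervalIntegral.integral_mono_on hc.le
              (Continuous.intervalIntegrable (by fun_prop) _ _)
              (Continuous.intervalIntegrable (by fun_prop) _ _) fun t ht => ?_
            have := Real.exp_pos (-(‖z‖ * t))
            linarith
        _ = _ := by simp [mul_comm]
    refine h1.trans ?_
    have h2 : ∫ t in (0 : ℝ)..c, ((1 - Complex.I) * (1 - Complex.exp (-(z * t)))).re =
        ((1 - Complex.I) * (c - (1 - Complex.exp (-(z * c))) / z)).re := by
      have hi : IntervalIntegrable (fun t : ℝ => (1 - Complex.I) * (1 - Complex.exp (-(z * t))))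
          volume 0 c := Continuous.intervalIntegrable (by fun_prop) _ _
      have h3 := Complex.reCLM.intervalIntegral_comp_comm hi
      simp only [Complex.reCLM_apply] at h3
      rw [h3, intervalIntegral.integral_const_mul, intervalIntegral.integral_sub
        (by simp) (Continuous.intervalIntegrable (by fun_prop) _ _), integral_exp_neg_mul hz]
      simp
    rw [h2]
    have h4 : ((1 - Complex.I) * (c - (1 - Complex.exp (-(z * c))) / z)).re =
        c - ((1 - Complex.I) * ((1 - Complex.exp (-(z * c))) / z)).re := by
      rw [mul_sub, Complex.sub_re]; simp
    have h5 : ((1 - Complex.I) * ((1 - Complex.exp (-(z * c))) / z)).re ≤ 2.83 / ‖z‖ := by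
      refine (Complex.re_le_norm _).trans ?_
      have hI : ‖1 - Complex.I‖ ≤ 1.415 := by
        have : ‖1 - Complex.I‖ ^ 2 = 2 := by
          rw [← Complex.normSq_eq_norm_sq]; simp [Complex.normSq_apply]; norm_num
        nlinarith [norm_nonneg (1 - Complex.I)]
      have h6 : ‖1 - Complex.exp (-(z * c))‖ ≤ 2 := by
        refine (norm_sub_le _ _).trans ?_
        have := norm_exp_neg_le_one (z := z * c) (by simpa using mul_nonneg hx.le hc.le)
        rw [norm_one]; linarith
      rw [norm_mul, norm_div, ← mul_div_assoc]
      refine div_le_div_of_nonneg_right ?_ hr.le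
      nlinarith [norm_nonneg (1 - Complex.I), norm_nonneg (1 - Complex.exp (-(z * c)))]
    rw [h4]
    have h7 : 2.83 / ‖z‖ ≤ 2.83 / 3 * c := by
      rw [div_le_iff₀ hr]
      nlinarith
    nlinarith

end Elementary

/-- After rotation by a phase `u` making `u ∫ K β` real and nonnegative, this is the sign lemma for
`g - Re (u K)`. -/
theorem norm_integral_mul_le_of_antitoneOn {β g : ℝ → ℝ} {K : ℝ → ℂ} (hβ : AntitoneOn β (Ioi 0))
    (hβ0 : ∀ t, 0 < t → 0 ≤ β t) (hlim : Tendsto β atTop (𝓝 0)) (hK : Continuous K)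
    (hg : Continuous g) (hKi : IntegrableOn (fun t => K t * β t) (Ioi 0))
    (hgi : IntegrableOn (fun t => g t * β t) (Ioi 0))
    (hH : ∀ c, 0 < c → ‖∫ t in (0 : ℝ)..c, K t‖ ≤ ∫ t in (0 : ℝ)..c, g t) :
    ‖∫ t in Ioi (0 : ℝ), K t * β t‖ ≤ ∫ t in Ioi (0 : ℝ), g t * β t := by
  obtain ⟨u, hu, huI⟩ : ∃ u : ℂ, ‖u‖ = 1 ∧
      u * ∫ t in Ioi (0 : ℝ), K t * β t = ‖∫ t in Ioi (0 : ℝ), K t * β t‖ := by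
    set I := ∫ t in Ioi (0 : ℝ), K t * β t
    rcases eq_or_ne I 0 with h | h
    · exact ⟨1, by simp, by simp [h]⟩
    · have hn : (‖I‖ : ℂ) ≠ 0 := by exact_mod_cast norm_ne_zero_iff.2 h
      refine ⟨(starRingEnd ℂ) I / ‖I‖, ?_, ?_⟩
      · rw [norm_div, RCLike.norm_conj, Complex.norm_real, norm_norm,
          div_self (norm_ne_zero_iff.2 h)]
      · rw [div_mul_eq_mul_div, mul_comm, Complex.mul_conj, Complex.normSq_eq_norm_sq,
          div_eq_iff hn]
        push_cast; ring
  have hui : IntegrableOn (fun t => (u * (K t * β t)).re) (Ioi 0) := (hKi.const_mul u).re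
  have hre : ∫ t in Ioi (0 : ℝ), (u * (K t * β t)).re = ‖∫ t in Ioi (0 : ℝ), K t * β t‖ := by
    have h := Complex.reCLM.integral_comp_comm (hKi.const_mul u)
    simp only [Complex.reCLM_apply] at h
    rw [h, integral_const_mul, huI, Complex.ofReal_re]
  have e : ∀ t, (g t - (u * K t).re) * β t = g t * β t - (u * (K t * β t)).re := by
    intro t
    rw [← mul_assoc, Complex.re_mul_ofReal]; ring
  have h := integral_mul_nonneg_of_antitoneOn (h := fun t => g t - (u * K t).re) hβ hβ0 hlim
    (by fun_prop) (by simp_rw [e]; exact hgi.sub hui) (fun c hc => by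
      have hi : IntervalIntegrable (fun t => u * K t) volume 0 c :=
        Continuous.intervalIntegrable (by fun_prop) _ _
      have hri : IntervalIntegrable (fun t => (u * K t).re) volume 0 c :=
        Continuous.intervalIntegrable (by fun_prop) _ _
      have h3 := Complex.reCLM.intervalIntegral_comp_comm hi
      simp only [Complex.reCLM_apply] at h3
      rw [intervalIntegral.integral_sub (hg.intervalIntegrable _ _) hri, h3,
        intervalIntegral.integral_const_mul, sub_nonneg]
      refine (Complex.re_le_norm _).trans ?_
      rw [norm_mul, hu, one_mul]
      exact hH c hc)
  simp_rw [e] at h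
  rw [integral_sub hgi hui, hre] at h
  linarith

theorem laplace_ofReal (b : ℝ → ℝ) (x : ℝ) : laplace b x = (realLaplace b x : ℂ) := by
  rw [laplace, realLaplace, ← integral_complex_ofReal]
  refine integral_congr_ae (Eventually.of_forall fun t => ?_)
  push_cast
  rfl

theorem laplace_conj (b : ℝ → ℝ) (z : ℂ) :
    laplace b ((starRingEnd ℂ) z) = (starRingEnd ℂ) (laplace b z) := by
  rw [laplace, laplace, ← integral_conj]
  refine integral_congr_ae (Eventually.of_forall fun t => ?_)
  simp [← Complex.exp_conj]

/-! ### Size of the Laplace transform and of its derivative -/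

namespace IsKernel

variable {b : ℝ → ℝ}

theorem integrableOn_cexp_mul (hb : IsKernel b) {z : ℂ} (hz : 0 < z.re) :
    IntegrableOn (fun t : ℝ => Complex.exp (-(z * t)) * b t) (Ioi 0) := by
  refine hb.integrableOn_mul_of_bound (C := 1) (by fun_prop) hz fun t _ => ?_
  rw [Complex.norm_exp]
  simp

theorem integrableOn_exp_mul (hb : IsKernel b) {x : ℝ} (hx : 0 < x) :
    IntegrableOn (fun t : ℝ => Real.exp (-(x * t)) * b t) (Ioi 0) := by
  have h := (hb.integrableOn_cexp_mul (z := x) (by simpa using hx)).re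
  refine h.congr (Eventually.of_forall fun t => ?_)
  have : Complex.exp (-((x : ℂ) * t)) * b t = ((Real.exp (-(x * t)) * b t : ℝ) : ℂ) := by
    push_cast; rfl
  simp only [this, RCLike.re_eq_complex_re, Complex.ofReal_re]

theorem mul_exp_neg_le {κ : ℝ} (hκ : 0 < κ) {t : ℝ} :
    t * Real.exp (-(κ * t)) ≤ 2 / κ * Real.exp (-(κ / 2 * t)) := by
  have h1 : t ≤ 2 / κ * Real.exp (κ / 2 * t) := by
    have := Real.add_one_le_exp (κ / 2 * t)
    have h2 : t = 2 / κ * (κ / 2 * t) := by field_simp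
    calc t = 2 / κ * (κ / 2 * t) := h2
      _ ≤ _ := mul_le_mul_of_nonneg_left (by linarith) (by positivity)
  calc t * Real.exp (-(κ * t)) ≤ 2 / κ * Real.exp (κ / 2 * t) * Real.exp (-(κ * t)) :=
        mul_le_mul_of_nonneg_right h1 (Real.exp_pos _).le
    _ = _ := by rw [mul_assoc, ← Real.exp_add]; ring_nf

theorem integrableOn_mul_cexp_mul (hb : IsKernel b) {z : ℂ} (hz : 0 < z.re) :
    IntegrableOn (fun t : ℝ => (t : ℂ) * Complex.exp (-(z * t)) * b t) (Ioi 0) := by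
  refine hb.integrableOn_mul_of_bound (C := 2 / z.re) (κ := z.re / 2) (by fun_prop) (by linarith)
    fun t ht => ?_
  rw [norm_mul, Complex.norm_exp, Complex.norm_real, Real.norm_of_nonneg ht.le]
  simpa using mul_exp_neg_le hz

/-- One integration by parts brings in the nonincreasing weight `-b'`, against which the comparison
lemmas apply. -/
theorem laplace_eq_integral (hb : IsKernel b) {z : ℂ} (hz : 0 < z.re) :
    IntegrableOn (fun r : ℝ => (1 - Complex.exp (-(z * r))) / z * ((-deriv b r : ℝ) : ℂ)) (Ioi 0) ∧
      laplace b z =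
        ∫ r in Ioi (0 : ℝ), (1 - Complex.exp (-(z * r))) / z * ((-deriv b r : ℝ) : ℂ) := by
  have hz0 : z ≠ 0 := fun h => by simp [h] at hz
  have h := hb.integral_mul_eq (by fun_prop) (hb.integrableOn_cexp_mul hz)
  simp_rw [integral_exp_neg_mul hz0] at h
  exact h

theorem laplace_mul_eq_integral (hb : IsKernel b) {z : ℂ} (hz : 0 < z.re) :
    IntegrableOn (fun r : ℝ => (∫ t in (0 : ℝ)..r, (t : ℂ) * Complex.exp (-(z * t))) *
        ((-deriv b r : ℝ) : ℂ)) (Ioi 0) ∧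
      laplace (fun t => t * b t) z =
        ∫ r in Ioi (0 : ℝ), (∫ t in (0 : ℝ)..r, (t : ℂ) * Complex.exp (-(z * t))) *
          ((-deriv b r : ℝ) : ℂ) := by
  have h := hb.integral_mul_eq (by fun_prop) (hb.integrableOn_mul_cexp_mul hz)
  refine ⟨h.1, ?_⟩
  rw [← h.2, laplace]
  refine integral_congr_ae (Eventually.of_forall fun t => ?_)
  push_cast; ring

theorem realLaplace_eq_integral (hb : IsKernel b) {x : ℝ} (hx : 0 < x) :
    IntegrableOn (fun r : ℝ => (1 - Real.exp (-(x * r))) / x * (-deriv b r)) (Ioi 0) ∧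
      realLaplace b x = ∫ r in Ioi (0 : ℝ), (1 - Real.exp (-(x * r))) / x * (-deriv b r) := by
  have h := hb.laplace_eq_integral (z := x) (by simpa using hx)
  have e : ∀ r : ℝ, (1 - Complex.exp (-((x : ℂ) * r))) / x * ((-deriv b r : ℝ) : ℂ) =
      (((1 - Real.exp (-(x * r))) / x * (-deriv b r) : ℝ) : ℂ) := by
    intro r; push_cast; rfl
  simp_rw [e, laplace_ofReal, integral_complex_ofReal] at h
  refine ⟨?_, by exact_mod_cast h.2⟩
  exact h.1.re

theorem realLaplace_pos (hb : IsKernel b) {x : ℝ} (hx : 0 < x) : 0 < realLaplace b x := by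
  obtain ⟨t₀, ht₀, hne⟩ := hb.ne_zero
  have hpos : 0 < b t₀ := lt_of_le_of_ne (hb.nonneg t₀ ht₀) (Ne.symm hne)
  calc 0 < t₀ * (Real.exp (-(x * t₀)) * b t₀) := by positivity
    _ = ∫ t in Ioc 0 t₀, Real.exp (-(x * t₀)) * b t₀ := by simp [ht₀.le]
    _ ≤ ∫ t in Ioc 0 t₀, Real.exp (-(x * t)) * b t := by
        refine setIntegral_mono_on (integrableOn_const measure_Ioc_lt_top.ne)
          ((hb.integrableOn_exp_mul hx).mono_set Ioc_subset_Ioi_self) measurableSet_Ioc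
          fun t ht => ?_
        refine mul_le_mul (Real.exp_le_exp.2 ?_) (hb.antitoneOn ht.1 ht₀ ht.2) hpos.le
          (Real.exp_pos _).le
        nlinarith [ht.2]
    _ ≤ _ := by
        refine setIntegral_mono_set (hb.integrableOn_exp_mul hx) ?_
          (LE.le.eventuallyLE Ioc_subset_Ioi_self)
        exact (ae_restrict_iff' measurableSet_Ioi).2 (Eventually.of_forall fun t ht =>
          mul_nonneg (Real.exp_pos _).le (hb.nonneg t ht))

theorem realLaplace_antitone (hb : IsKernel b) {x y : ℝ} (hx : 0 < x) (hxy : x ≤ y) :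
    realLaplace b y ≤ realLaplace b x := by
  refine setIntegral_mono_on (hb.integrableOn_exp_mul (hx.trans_le hxy))
    (hb.integrableOn_exp_mul hx) measurableSet_Ioi fun t ht => ?_
  refine mul_le_mul_of_nonneg_right (Real.exp_le_exp.2 ?_) (hb.nonneg t ht)
  have : 0 < t := ht
  nlinarith

/-- Here a pointwise comparison of `1 - e^(-zr)` with `1 - e^(-|z|r)` against `-b' ≥ 0` is enough.
-/
theorem norm_laplace_le (hb : IsKernel b) {z : ℂ} (hz : 0 < z.re) :
    ‖laplace b z‖ ≤ 4 * realLaplace b ‖z‖ := by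
  have hr : 0 < ‖z‖ := norm_pos_iff.2 fun h => by simp [h] at hz
  rw [(hb.laplace_eq_integral hz).2, (hb.realLaplace_eq_integral hr).2, ← integral_const_mul]
  refine (norm_integral_le_integral_norm _).trans ?_
  refine setIntegral_mono_on (hb.laplace_eq_integral hz).1.norm
    ((hb.realLaplace_eq_integral hr).1.const_mul 4) measurableSet_Ioi fun r hrr => ?_
  have hr0 : 0 < r := hrr
  rw [norm_mul, Complex.norm_real, Real.norm_of_nonneg (hb.neg_deriv_nonneg r hrr), norm_div,
    ← mul_assoc]
  refine mul_le_mul_of_nonneg_right ?_ (hb.neg_deriv_nonneg r hrr)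
  have h := norm_one_sub_exp_neg_le (z := z * r) (by simpa using (mul_pos hz hr0).le)
  rw [norm_mul, Complex.norm_real, Real.norm_of_nonneg hr0.le] at h
  rw [← mul_div_assoc]
  exact div_le_div_of_nonneg_right h hr.le

/-- `(1 - i) z b̂(z)` is the integral of `(1 - i)(1 - e^(-zt))` against `-b'`. For `Im z ≥ 0` the
factor `1 - i` adds the sine part to the real part, and the inequality between primitives survives
integration against the nonincreasing `-b'`. The step from `1 / 1000` to `1 / 2000` is the crude
bound `|1 - i| ≤ 2`. -/
theorem le_norm_laplace_of_im_nonneg (hb : IsKernel b) {z : ℂ} (hz : 0 < z.re) (hi : 0 ≤ z.im) :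
    1 / 2000 * realLaplace b ‖z‖ ≤ ‖laplace b z‖ := by
  have hz0 : z ≠ 0 := fun h => by simp [h] at hz
  have hr : 0 < ‖z‖ := norm_pos_iff.2 hz0
  have hA := hb.laplace_eq_integral hz
  have hB := hb.realLaplace_eq_integral hr
  have e1 : ∀ t : ℝ, (((1 - Complex.I) * (1 - Complex.exp (-(z * t)))).re) * (-deriv b t) =
      ((1 - Complex.I) * z * ((1 - Complex.exp (-(z * t))) / z * ((-deriv b t : ℝ) : ℂ))).re := by
    intro t
    rw [← Complex.re_mul_ofReal]
    congr 1
    field_simp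
  have e2 : ∀ t : ℝ, (1 / 1000 * (1 - Real.exp (-(‖z‖ * t)))) * (-deriv b t) =
      1 / 1000 * ‖z‖ * ((1 - Real.exp (-(‖z‖ * t))) / ‖z‖ * (-deriv b t)) := by
    intro t; field_simp
  have e3 : ∀ t : ℝ, (((1 - Complex.I) * (1 - Complex.exp (-(z * t)))).re -
      1 / 1000 * (1 - Real.exp (-(‖z‖ * t)))) * (-deriv b t) =
      (((1 - Complex.I) * (1 - Complex.exp (-(z * t)))).re) * (-deriv b t) -
      (1 / 1000 * (1 - Real.exp (-(‖z‖ * t)))) * (-deriv b t) := fun t => sub_mul _ _ _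
  have hi1 : IntegrableOn (fun t : ℝ =>
      (((1 - Complex.I) * (1 - Complex.exp (-(z * t)))).re) * (-deriv b t)) (Ioi 0) := by
    simp_rw [e1]
    exact (hA.1.const_mul _).re
  have hi2 : IntegrableOn (fun t : ℝ =>
      (1 / 1000 * (1 - Real.exp (-(‖z‖ * t)))) * (-deriv b t)) (Ioi 0) := by
    simp_rw [e2]
    exact hB.1.const_mul _
  have h := integral_mul_nonneg_of_antitoneOn
    (h := fun t => ((1 - Complex.I) * (1 - Complex.exp (-(z * t)))).re -
      1 / 1000 * (1 - Real.exp (-(‖z‖ * t)))) hb.neg_deriv_antitoneOn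
    hb.neg_deriv_nonneg hb.tendsto_neg_deriv (by fun_prop)
    (by simp_rw [e3]; exact hi1.sub hi2) (fun c hc => by
      rw [intervalIntegral.integral_sub (Continuous.intervalIntegrable (by fun_prop) _ _)
        (Continuous.intervalIntegrable (by fun_prop) _ _), sub_nonneg]
      exact le_integral_re_one_sub_exp_neg hz hi hc)
  have h3 := Complex.reCLM.integral_comp_comm (hA.1.const_mul ((1 - Complex.I) * z))
  simp only [Complex.reCLM_apply] at h3
  simp_rw [e3] at h
  rw [integral_sub hi1 hi2, setIntegral_congr_fun measurableSet_Ioi (fun t _ => e1 t),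
    setIntegral_congr_fun measurableSet_Ioi (fun t _ => e2 t), integral_const_mul, ← hB.2, h3,
    integral_const_mul, ← hA.2] at h
  have h4 : ((1 - Complex.I) * z * laplace b z).re ≤ 2 * ‖z‖ * ‖laplace b z‖ := by
    refine (Complex.re_le_norm _).trans ?_
    rw [norm_mul, norm_mul]
    have hI : ‖1 - Complex.I‖ ≤ 2 := (norm_sub_le _ _).trans (by norm_num)
    gcongr
  have h5 : ‖z‖ * (1 / 1000 * realLaplace b ‖z‖) ≤ ‖z‖ * (2 * ‖laplace b z‖) := by linarith
  have := le_of_mul_le_mul_left h5 hr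
  linarith

theorem le_norm_laplace (hb : IsKernel b) {z : ℂ} (hz : 0 < z.re) :
    1 / 2000 * realLaplace b ‖z‖ ≤ ‖laplace b z‖ := by
  rcases le_total 0 z.im with h | h
  · exact hb.le_norm_laplace_of_im_nonneg hz h
  · have := hb.le_norm_laplace_of_im_nonneg (z := (starRingEnd ℂ) z) (by simpa using hz)
      (by simpa using h)
    rwa [RCLike.norm_conj, laplace_conj, RCLike.norm_conj] at this

/-- The transform of `t b` is `-b̂'`. Its kernel against `-b'` is the first primitive of `t
e^(-zt)`, and the monotone comparison requires only its second primitive to be controlled. -/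
theorem norm_mul_laplace_mul_le (hb : IsKernel b) {z : ℂ} (hz : 0 < z.re) :
    ‖z * laplace (fun t => t * b t) z‖ ≤ 24 * realLaplace b ‖z‖ := by
  have hz0 : z ≠ 0 := fun h => by simp [h] at hz
  have hr : 0 < ‖z‖ := norm_pos_iff.2 hz0
  have hA := hb.laplace_mul_eq_integral hz
  have hB := hb.realLaplace_eq_integral hr
  have e : ∀ t : ℝ, (24 / ‖z‖ * ((1 - Real.exp (-(‖z‖ * t))) / ‖z‖)) * (-deriv b t) =
      24 / ‖z‖ * ((1 - Real.exp (-(‖z‖ * t))) / ‖z‖ * (-deriv b t)) := fun t => mul_assoc _ _ _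
  have hKc : Continuous fun r : ℝ => ∫ t in (0 : ℝ)..r, (t : ℂ) * Complex.exp (-(z * t)) := by
    simp_rw [integral_mul_exp_neg_mul hz0]
    fun_prop
  have h := norm_integral_mul_le_of_antitoneOn
    (g := fun t => 24 / ‖z‖ * ((1 - Real.exp (-(‖z‖ * t))) / ‖z‖)) hb.neg_deriv_antitoneOn
    hb.neg_deriv_nonneg hb.tendsto_neg_deriv hKc (by fun_prop) hA.1
    (by simp_rw [e]; exact hB.1.const_mul _) (fun c hc => by
      have hn : ‖z * (c : ℂ)‖ = ‖z‖ * c := by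
        rw [norm_mul, Complex.norm_real, Real.norm_of_nonneg hc.le]
      rw [integral_integral_mul_exp_neg_mul hz0, intervalIntegral.integral_const_mul,
        intervalIntegral.integral_div, norm_div, norm_pow]
      have h1 := norm_add_exp_neg_mul_le (z := z * c) (by simpa using (mul_pos hz hc).le)
      have h2 := le_integral_one_sub_exp_neg hr hc
      rw [hn] at h1
      set J := ∫ t in (0 : ℝ)..c, (1 - Real.exp (-(‖z‖ * t)))
      rw [div_le_iff₀ (by positivity)]
      have h3 : 24 / ‖z‖ * (J / ‖z‖) * ‖z‖ ^ 3 = 24 * (‖z‖ * J) := by field_simp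
      rw [h3]
      refine h1.trans ?_
      refine mul_le_mul_of_nonneg_left ?_ (by norm_num)
      calc (‖z‖ * c) ^ 2 / (2 * (1 + ‖z‖ * c)) = ‖z‖ * (‖z‖ * c ^ 2 / (2 * (1 + ‖z‖ * c))) := by
            ring
        _ ≤ _ := mul_le_mul_of_nonneg_left h2 hr.le)
  simp_rw [e] at h
  rw [← hA.2, integral_const_mul, ← hB.2] at h
  rw [norm_mul]
  calc ‖z‖ * ‖laplace (fun t => t * b t) z‖ ≤ ‖z‖ * (24 / ‖z‖ * realLaplace b ‖z‖) :=
        mul_le_mul_of_nonneg_left h hr.le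
    _ = _ := by field_simp

end IsKernel

/-! ### The sector condition and the Schwarz lemma -/

/-- An upper bound of the derivative, from the Schwarz lemma, for a holomorphic map between right
half-planes at a point of the real axis with real positive value. -/
theorem norm_mul_deriv_le_of_re_pos {f : ℂ → ℂ} (hf : DifferentiableOn ℂ f {z | 0 < z.re})
    (hpos : ∀ z : ℂ, 0 < z.re → 0 < (f z).re) {x y : ℝ} (hx : 0 < x) (hy : f x = y) :
    ‖(x : ℂ) * deriv f x‖ ≤ y := by
  have hopen : IsOpen {z : ℂ | 0 < z.re} := isOpen_lt continuous_const Complex.continuous_re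
  have hy0 : 0 < y := by
    have := hpos x (by simpa using hx)
    rwa [hy, Complex.ofReal_re] at this
  have hyc : (y : ℂ) ≠ 0 := by exact_mod_cast hy0.ne'
  -- Cayley transforms on both sides: `m` sends the unit disc to the half-plane with `0 ↦ x`, and
  -- `(f - y) / (f + y)` returns to the disc with value `0`. The derivative at `0` of the composite
  -- is `x f'(x) / y`.
  set m : ℂ → ℂ := fun w => x * ((1 + w) / (1 - w)) with hm
  have hw1 : ∀ w ∈ Metric.ball (0 : ℂ) 1, 1 - w ≠ 0 := by
    intro w hw h
    have : w = 1 := (sub_eq_zero.1 h).symm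
    simp [this] at hw
  have hmre : ∀ w ∈ Metric.ball (0 : ℂ) 1, 0 < (m w).re := by
    intro w hw
    have h1 := hw1 w hw
    have h2 : 0 < Complex.normSq (1 - w) := Complex.normSq_pos.2 h1
    have h3 : Complex.normSq w < 1 := by
      rw [Complex.normSq_eq_norm_sq]
      have : ‖w‖ < 1 := by simpa using hw
      nlinarith [norm_nonneg w]
    rw [Complex.normSq_apply] at h3
    simp only [hm, Complex.re_ofReal_mul, Complex.div_re]
    refine mul_pos hx ?_
    rw [← add_div]
    refine div_pos ?_ h2
    simp
    nlinarith
  have hfm : ∀ w ∈ Metric.ball (0 : ℂ) 1, f (m w) + y ≠ 0 := by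
    intro w hw h
    have := congrArg Complex.re h
    have h2 := hpos _ (hmre w hw)
    simp at this
    linarith
  set g : ℂ → ℂ := fun w => (f (m w) - y) / (f (m w) + y) with hg
  have hmd : ∀ w ∈ Metric.ball (0 : ℂ) 1, DifferentiableAt ℂ m w := by
    intro w hw
    exact (((differentiableAt_const _).add differentiableAt_id).div
      ((differentiableAt_const _).sub differentiableAt_id) (hw1 w hw)).const_mul _
  have hfd : ∀ z : ℂ, 0 < z.re → DifferentiableAt ℂ f z := fun z hz =>
    hf.differentiableAt (hopen.mem_nhds hz)
  have hgd : DifferentiableOn ℂ g (Metric.ball 0 1) := by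
    intro w hw
    have h1 : DifferentiableAt ℂ (fun w => f (m w)) w :=
      (hfd _ (hmre w hw)).comp w (hmd w hw)
    exact ((h1.sub_const _).div (h1.add_const _) (hfm w hw)).differentiableWithinAt
  have hm0 : m 0 = x := by simp [hm]
  have hg0 : g 0 = 0 := by simp [hg, hm0, hy]
  have hmaps : MapsTo g (Metric.ball 0 1) (Metric.closedBall (g 0) 1) := by
    intro w hw
    rw [hg0, mem_closedBall_zero_iff, hg, norm_div, div_le_one (norm_pos_iff.2 (hfm w hw))]
    have h2 := hpos _ (hmre w hw)
    refine le_of_sq_le_sq ?_ (norm_nonneg _)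
    rw [← Complex.normSq_eq_norm_sq, ← Complex.normSq_eq_norm_sq, Complex.normSq_apply,
      Complex.normSq_apply]
    simp
    nlinarith
  have h := Complex.norm_deriv_le_one_of_mapsTo_ball hgd hmaps one_pos
  have hm' : HasDerivAt m (2 * x) 0 := by
    have h1 : HasDerivAt (fun w : ℂ => (1 + w) / (1 - w)) ((1 * (1 - 0) - (1 + 0) * (-1)) / (1 - 0) ^ 2)
        0 := ((hasDerivAt_id (0:ℂ)).const_add 1).div ((hasDerivAt_id (0:ℂ)).const_sub 1) (by simp)
    have h2 := h1.const_mul (x : ℂ)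
    refine h2.congr_deriv ?_
    norm_num [mul_comm]
  have hfx : HasDerivAt f (deriv f x) (m 0) := by
    rw [hm0]; exact (hfd x (by simpa using hx)).hasDerivAt
  have hfm' : HasDerivAt (fun w => f (m w)) (deriv f x * (2 * x)) 0 := hfx.comp 0 hm'
  have hg' : HasDerivAt g (((deriv f x * (2 * x)) * (f (m 0) + y) -
      (f (m 0) - y) * (deriv f x * (2 * x))) / (f (m 0) + y) ^ 2) 0 :=
    (hfm'.sub_const _).div (hfm'.add_const _) (hfm 0 (by simp))
  rw [hg'.deriv, hm0, hy, sub_self, zero_mul, sub_zero] at h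
  have e : deriv f x * (2 * x) * (y + y) / (y + y : ℂ) ^ 2 = x * deriv f x / y := by
    have : (y : ℂ) + y ≠ 0 := by rw [← two_mul]; exact mul_ne_zero two_ne_zero hyc
    field_simp
    ring
  rw [e, norm_div, Complex.norm_real, Real.norm_of_nonneg hy0.le, div_le_one hy0] at h
  exact h

/-- The set of arguments is bounded by `π`, so its `sSup` is a genuine supremum. -/
theorem abs_arg_laplace_le (b : ℝ → ℝ) {z : ℂ} (hz : 0 < z.re) :
    |Complex.arg (laplace b z)| ≤ (rho b - 1) * (Real.pi / 2) := by
  have h : |Complex.arg (laplace b z)| ≤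
      sSup {y : ℝ | ∃ z : ℂ, 0 < z.re ∧ y = |Complex.arg (laplace b z)|} := by
    refine le_csSup ⟨Real.pi, ?_⟩ ⟨z, hz, rfl⟩
    rintro y ⟨w, _, rfl⟩
    exact Complex.abs_arg_le_pi _
  have e : sSup {y : ℝ | ∃ z : ℂ, 0 < z.re ∧ y = |Complex.arg (laplace b z)|} =
      (rho b - 1) * (Real.pi / 2) := by
    rw [rho]
    field_simp
    ring
  rwa [e] at h

namespace IsKernel

variable {b : ℝ → ℝ}

theorem hasDerivAt_laplace (hb : IsKernel b) {z : ℂ} (hz : 0 < z.re) :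
    HasDerivAt (laplace b) (-laplace (fun t => t * b t) z) z := by
  -- Differentiation under the integral sign on the ball of radius `Re z / 2`, where `t e^(-t Re z /
  -- 2) b t` dominates.
  have hε : 0 < z.re / 2 := by linarith
  have hbm := (Complex.measurable_ofReal.comp_aemeasurable hb.aemeasurable).aestronglyMeasurable
  have hF : ∀ w : ℂ, AEStronglyMeasurable (fun t : ℝ => Complex.exp (-(w * t)) * (b t : ℂ))
      (volume.restrict (Ioi 0)) := fun w =>
    (Continuous.aestronglyMeasurable (by fun_prop)).mul hbm
  have hbound := hb.integrableOn_mul_cexp_mul (z := ((z.re / 2 : ℝ) : ℂ)) (by simpa using hε)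
  have h := hasDerivAt_integral_of_dominated_loc_of_deriv_le (𝕜 := ℂ)
    (μ := volume.restrict (Ioi (0:ℝ)))
    (F := fun w t => Complex.exp (-(w * t)) * (b t : ℂ))
    (F' := fun w t => -(t * Complex.exp (-(w * t))) * (b t : ℂ)) (x₀ := z)
    (s := Metric.ball z (z.re / 2))
    (bound := fun t => ‖(t : ℂ) * Complex.exp (-(((z.re / 2 : ℝ) : ℂ) * t)) * b t‖)
    (Metric.ball_mem_nhds z hε) (Eventually.of_forall hF) (hb.integrableOn_cexp_mul hz)
    ((Continuous.aestronglyMeasurable (by fun_prop)).mul hbm)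
    ((ae_restrict_iff' measurableSet_Ioi).2 (Eventually.of_forall fun t ht w hw => by
      rw [norm_mul, norm_mul, norm_neg, norm_mul, norm_mul, Complex.norm_exp, Complex.norm_exp]
      have ht0 : (0:ℝ) < t := ht
      have h1 : z.re / 2 < w.re := by
        have h2 : |(w - z).re| ≤ ‖w - z‖ := Complex.abs_re_le_norm _
        have h3 : ‖w - z‖ < z.re / 2 := by simpa [dist_eq_norm] using hw
        have h4 := (abs_lt.1 (h2.trans_lt h3)).1
        rw [Complex.sub_re] at h4
        linarith
      have h5 : (-(w * (t : ℂ))).re ≤ (-(((z.re / 2 : ℝ) : ℂ) * t)).re := by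
        rw [Complex.neg_re, Complex.neg_re, Complex.re_mul_ofReal, Complex.re_mul_ofReal,
          Complex.ofReal_re]
        nlinarith
      gcongr))
    hbound.norm
    (Eventually.of_forall fun t w _ => by
      have h1 : HasDerivAt (fun w : ℂ => -(w * (t : ℂ))) (-t) w := by
        simpa using! ((hasDerivAt_id w).mul_const (t : ℂ)).neg
      have h2 := h1.cexp.mul_const (b t : ℂ)
      refine h2.congr_deriv ?_
      ring)
  refine h.2.congr_deriv ?_
  rw [laplace, ← integral_neg]
  refine integral_congr_ae (Eventually.of_forall fun t => ?_)
  push_cast; ring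

theorem laplace_ne_zero (hb : IsKernel b) {z : ℂ} (hz : 0 < z.re) : laplace b z ≠ 0 := by
  have hr : 0 < ‖z‖ := norm_pos_iff.2 fun h => by simp [h] at hz
  have := hb.le_norm_laplace hz
  have h2 := hb.realLaplace_pos hr
  exact norm_pos_iff.1 (by linarith)

/-- The sector containing `b̂` has half-angle strictly below `π / 2`, by `ρ < 2`. -/
theorem cos_pos (hb : IsKernel b) : 0 < Real.cos ((rho b - 1) * (Real.pi / 2)) := by
  have := hb.one_lt_rho
  have := hb.rho_lt_two
  have hp := Real.pi_pos
  exact Real.cos_pos_of_mem_Ioo ⟨by nlinarith, by nlinarith⟩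

theorem cos_mul_norm_le_re (hb : IsKernel b) {z : ℂ} (hz : 0 < z.re) :
    Real.cos ((rho b - 1) * (Real.pi / 2)) * ‖laplace b z‖ ≤ (laplace b z).re := by
  have h1 := abs_arg_laplace_le b hz
  have h2 : Real.cos ((rho b - 1) * (Real.pi / 2)) ≤ Real.cos (Complex.arg (laplace b z)) := by
    rw [← Real.cos_abs (Complex.arg _)]
    refine Real.cos_le_cos_of_nonneg_of_le_pi (abs_nonneg _) ?_ h1
    have := hb.rho_lt_two
    have hp := Real.pi_pos
    nlinarith
  calc _ ≤ Real.cos (Complex.arg (laplace b z)) * ‖laplace b z‖ :=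
        mul_le_mul_of_nonneg_right h2 (norm_nonneg _)
    _ = _ := by rw [mul_comm, Complex.norm_mul_cos_arg]

theorem re_laplace_pos (hb : IsKernel b) {z : ℂ} (hz : 0 < z.re) : 0 < (laplace b z).re :=
  (mul_pos hb.cos_pos (norm_pos_iff.2 (hb.laplace_ne_zero hz))).trans_le (hb.cos_mul_norm_le_re hz)

/-- For `θ > ρ - 1` the power `b̂^(1/θ)` maps the right half-plane into itself and is positive at
`x`, so the Schwarz lemma bounds its logarithmic derivative: `x |b̂'(x)| / (θ b̂(x)) ≤ 1`. Then `θ`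
decreases to `ρ - 1`. -/
theorem mul_realLaplace_mul_le (hb : IsKernel b) {x : ℝ} (hx : 0 < x) :
    x * realLaplace (fun t => t * b t) x ≤ (rho b - 1) * realLaplace b x := by
  have hφ := hb.realLaplace_pos hx
  have key : ∀ θ : ℝ, rho b - 1 < θ →
      x * realLaplace (fun t => t * b t) x / realLaplace b x ≤ θ := by
    intro θ hθ
    have hθ0 : 0 < θ := by linarith [hb.one_lt_rho]
    have hslit : ∀ z : ℂ, 0 < z.re → laplace b z ∈ Complex.slitPlane := fun z hz =>
      Or.inl (hb.re_laplace_pos hz)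
    set f : ℂ → ℂ := fun z => Complex.exp (Complex.log (laplace b z) / θ) with hf
    have hfd : ∀ z : ℂ, 0 < z.re → HasDerivAt f (Complex.exp (Complex.log (laplace b z) / θ) *
        (-laplace (fun t => t * b t) z / laplace b z / θ)) z := fun z hz =>
      (((hb.hasDerivAt_laplace hz).clog (hslit z hz)).div_const (θ : ℂ)).cexp
    have hfpos : ∀ z : ℂ, 0 < z.re → 0 < (f z).re := by
      intro z hz
      rw [hf, Complex.exp_re, Complex.div_ofReal_im, Complex.log_im]
      refine mul_pos (Real.exp_pos _) (Real.cos_pos_of_mem_Ioo ?_)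
      have h1 := abs_arg_laplace_le b hz
      have h2 : |Complex.arg (laplace b z) / θ| < Real.pi / 2 := by
        rw [abs_div, abs_of_pos hθ0, div_lt_iff₀ hθ0]
        refine h1.trans_lt ?_
        nlinarith [Real.pi_pos]
      exact abs_lt.1 h2
    have hfx : f x = ((Real.exp (Real.log (realLaplace b x) / θ) : ℝ) : ℂ) := by
      simp only [hf]
      rw [laplace_ofReal, ← Complex.ofReal_log hφ.le]
      push_cast; rfl
    have hxre : 0 < (x : ℂ).re := by simpa using hx
    have h := norm_mul_deriv_le_of_re_pos
      (fun z hz => (hfd z hz).differentiableAt.differentiableWithinAt) hfpos hx hfx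
    rw [(hfd x hxre).deriv] at h
    have hfx' : Complex.exp (Complex.log (laplace b x) / θ) =
      ((Real.exp (Real.log (realLaplace b x) / θ) : ℝ) : ℂ) := hfx
    rw [hfx', laplace_ofReal, laplace_ofReal] at h
    set y := Real.exp (Real.log (realLaplace b x) / θ)
    have hy : 0 < y := Real.exp_pos _
    have e : (x : ℂ) * ((y : ℂ) * (-(realLaplace (fun t => t * b t) x : ℂ) /
        (realLaplace b x : ℂ) / θ)) =
        ((-(y * (x * realLaplace (fun t => t * b t) x / realLaplace b x / θ)) : ℝ) : ℂ) := by
      push_cast; ring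
    rw [e, Complex.norm_real, norm_neg, Real.norm_eq_abs, abs_mul, abs_of_pos hy] at h
    have h3 : |x * realLaplace (fun t => t * b t) x / realLaplace b x / θ| ≤ 1 := by
      have : y * |x * realLaplace (fun t => t * b t) x / realLaplace b x / θ| ≤ y * 1 := by
        linarith
      exact le_of_mul_le_mul_left this hy
    have h4 := (le_abs_self _).trans h3
    rwa [div_le_one hθ0] at h4
  have := le_of_forall_gt_imp_ge_of_dense key
  rwa [div_le_iff₀ hφ] at this

theorem hasDerivAt_realLaplace (hb : IsKernel b) {x : ℝ} (hx : 0 < x) :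
    HasDerivAt (realLaplace b) (-realLaplace (fun t => t * b t) x) x := by
  have h := (hb.hasDerivAt_laplace (z := x) (by simpa using hx)).real_of_complex
  simpa [laplace_ofReal] using! h

/-- The derivative is `x^(ρ-2) ((ρ - 1) b̂(x) - x |b̂'(x)|)`, nonnegative by the Schwarz bound. -/
theorem rpow_mul_realLaplace_mono (hb : IsKernel b) {x y : ℝ} (hx : 0 < x) (hxy : x ≤ y) :
    x ^ (rho b - 1) * realLaplace b x ≤ y ^ (rho b - 1) * realLaplace b y := by
  have hd : ∀ t : ℝ, 0 < t → HasDerivAt (fun t => t ^ (rho b - 1) * realLaplace b t)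
      ((rho b - 1) * t ^ (rho b - 1 - 1) * realLaplace b t +
        t ^ (rho b - 1) * (-realLaplace (fun t => t * b t) t)) t := fun t ht =>
    (Real.hasDerivAt_rpow_const (Or.inl ht.ne')).mul (hb.hasDerivAt_realLaplace ht)
  have hmono : MonotoneOn (fun t => t ^ (rho b - 1) * realLaplace b t) (Ioi 0) := by
    refine monotoneOn_of_deriv_nonneg (convex_Ioi 0)
      (fun t ht => (hd t ht).continuousAt.continuousWithinAt)
      (fun t ht => ?_) (fun t ht => ?_)
    · rw [interior_Ioi] at ht
      exact (hd t ht).differentiableAt.differentiableWithinAt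
    · rw [interior_Ioi] at ht
      have ht0 : (0:ℝ) < t := ht
      rw [(hd t ht).deriv]
      have h1 := hb.mul_realLaplace_mul_le ht
      have h2 : t ^ (rho b - 1) = t * t ^ (rho b - 1 - 1) := by
        rw [Real.rpow_sub_one ht0.ne' (rho b - 1)]; field_simp
      rw [h2]
      have h3 : 0 < t ^ (rho b - 1 - 1) := Real.rpow_pos_of_pos ht0 _
      nlinarith
  exact hmono hx (hx.trans_le hxy) hxy

/-! ### The characteristic frequency of a mode -/

theorem exists_balance (hb : IsKernel b) {μ : ℝ} (hμ : 0 < μ) :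
    ∃ x : ℝ, 0 < x ∧ μ * realLaplace b x = x := by
  have hφ := hb.realLaplace_pos one_pos
  -- Since `b̂` is nonincreasing, `μ b̂(x) - x` has opposite signs at the smaller and the larger of
  -- `1` and `μ b̂(1)`.
  set lo := min 1 (μ * realLaplace b 1)
  set hi := max 1 (μ * realLaplace b 1)
  have hlo : 0 < lo := lt_min one_pos (mul_pos hμ hφ)
  have hlohi : lo ≤ hi := (min_le_left _ _).trans (le_max_left _ _)
  have hcont : ContinuousOn (fun x => μ * realLaplace b x - x) (Icc lo hi) := by
    intro x hx
    exact (((hb.hasDerivAt_realLaplace (hlo.trans_le hx.1)).continuousAt.const_mul μ).sub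
      continuousAt_id).continuousWithinAt
  have h1 : (0:ℝ) ≤ μ * realLaplace b lo - lo := by
    have := hb.realLaplace_antitone hlo (min_le_left _ _)
    have h2 : lo ≤ μ * realLaplace b 1 := min_le_right _ _
    nlinarith
  have h2 : μ * realLaplace b hi - hi ≤ 0 := by
    have := hb.realLaplace_antitone one_pos (le_max_left 1 (μ * realLaplace b 1))
    have h2 : μ * realLaplace b 1 ≤ hi := le_max_right _ _
    nlinarith
  obtain ⟨x, hx, hx0⟩ := intermediate_value_Icc' hlohi hcont ⟨h2, h1⟩
  exact ⟨x, hlo.trans_le hx.1, by simpa [sub_eq_zero] using hx0⟩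

/-- The characteristic frequency grows at least like `μ ^ (1 / ρ)`. -/
theorem exists_le_balance (hb : IsKernel b) {μ₀ : ℝ} (hμ₀ : 0 < μ₀) :
    ∃ c : ℝ, 0 < c ∧ ∀ μ, μ₀ ≤ μ → ∀ x, 0 < x → μ * realLaplace b x = x →
      c * μ ^ (1 / rho b) ≤ x := by
  obtain ⟨x₀, hx₀, hbal₀⟩ := hb.exists_balance hμ₀
  have hρ : 0 < rho b := by linarith [hb.one_lt_rho]
  have hφ₀ := hb.realLaplace_pos hx₀
  set c₁ := x₀ ^ (rho b - 1) * realLaplace b x₀ with hc₁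
  have hc₁0 : 0 < c₁ := mul_pos (Real.rpow_pos_of_pos hx₀ _) hφ₀
  refine ⟨c₁ ^ (1 / rho b), Real.rpow_pos_of_pos hc₁0 _, fun μ hμ x hx hbal => ?_⟩
  have hμ0 : 0 < μ := hμ₀.trans_le hμ
  have hxx : x₀ ≤ x := by
    by_contra hlt
    rw [not_le] at hlt
    have h1 := hb.realLaplace_antitone hx hlt.le
    nlinarith [mul_le_mul hμ h1 hφ₀.le hμ0.le]
  have h1 := hb.rpow_mul_realLaplace_mono hx₀ hxx
  have h2 : x ^ rho b = x ^ (rho b - 1) * x := by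
    rw [Real.rpow_sub_one hx.ne']; field_simp
  -- `x^ρ = x^(ρ-1) · μ b̂(x)` by the balance equation, and `x^(ρ-1) b̂(x) ≥ c₁` by monotonicity.
  have h3 : c₁ * μ ≤ x ^ rho b := by
    rw [h2]
    nth_rewrite 2 [← hbal]
    calc c₁ * μ ≤ x ^ (rho b - 1) * realLaplace b x * μ :=
          mul_le_mul_of_nonneg_right h1 hμ0.le
      _ = _ := by ring
  rw [← Real.mul_rpow hc₁0.le hμ0.le]
  calc (c₁ * μ) ^ (1 / rho b) ≤ (x ^ rho b) ^ (1 / rho b) :=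
        Real.rpow_le_rpow (by positivity) h3 (by positivity)
    _ = x := by rw [← Real.rpow_mul hx.le, mul_one_div_cancel hρ.ne', Real.rpow_one]

end IsKernel

/-! ### Scalar Volterra equations with continuous kernel -/

section Volterra

/-- Iterates of a Volterra operator. -/
def volterraIter (k : ℝ → ℝ) : ℕ → ℝ → ℝ
  | 0 => fun _ => 1
  | n + 1 => fun t => ∫ r in (0 : ℝ)..t, k (t - r) * volterraIter k n r

theorem continuous_volterraIter {k : ℝ → ℝ} (hk : Continuous k) (n : ℕ) :
    Continuous (volterraIter k n) := by
  induction n with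
  | zero => exact continuous_const
  | succ n ih =>
    refine intervalIntegral.continuous_parametric_intervalIntegral_of_continuous
      (f := fun t r => k (t - r) * volterraIter k n r) ?_ continuous_id
    fun_prop

theorem abs_volterraIter_le {k : ℝ → ℝ} (hk : Continuous k) {R M : ℝ}
    (hM : ∀ t ∈ Icc 0 R, |k t| ≤ M) (n : ℕ) :
    ∀ t ∈ Icc 0 R, |volterraIter k n t| ≤ (M * t) ^ n / n.factorial := by
  induction n with
  | zero => intro t _; simp [volterraIter]
  | succ n ih =>
    intro t ht
    have hM0 : 0 ≤ M := (abs_nonneg _).trans (hM t ht)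
    have hc := continuous_volterraIter hk n
    have e : ∫ r in (0 : ℝ)..t, M * ((M * r) ^ n / n.factorial) =
        (M * t) ^ (n + 1) / (n + 1).factorial := by
      have e1 : ∀ r : ℝ, M * ((M * r) ^ n / n.factorial) = M ^ (n + 1) / n.factorial * r ^ n := by
        intro r; rw [mul_pow]; ring
      simp_rw [e1]
      rw [intervalIntegral.integral_const_mul, integral_pow, Nat.factorial_succ]
      push_cast
      field_simp
      ring
    rw [← e, volterraIter]
    refine (intervalIntegral.abs_integral_le_integral_abs ht.1).trans ?_
    refine intervalIntegral.integral_mono_on ht.1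
      (Continuous.intervalIntegrable (by fun_prop) _ _)
      (Continuous.intervalIntegrable (by fun_prop) _ _) fun r hr => ?_
    rw [abs_mul]
    exact mul_le_mul (hM _ ⟨by linarith [hr.2], by linarith [hr.1, ht.2]⟩)
      (ih r ⟨hr.1, hr.2.trans ht.2⟩) (abs_nonneg _) hM0

theorem exists_abs_le_of_continuous {k : ℝ → ℝ} (hk : Continuous k) (R : ℝ) :
    ∃ M : ℝ, 0 ≤ M ∧ ∀ t ∈ Icc 0 R, |k t| ≤ M := by
  obtain ⟨M, hM⟩ := isCompact_Icc.exists_bound_of_continuousOn (hk.continuousOn (s := Icc 0 R))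
  exact ⟨max M 0, le_max_right _ _, fun t ht => (hM t ht).trans (le_max_left _ _)⟩

/-- A linear Volterra equation with continuous kernel is solvable on the half-line. -/
theorem exists_volterra_solution {k : ℝ → ℝ} (hk : Continuous k) :
    ∃ s : ℝ → ℝ, Continuous s ∧ (∀ t ≤ 0, s t = 1) ∧
      ∀ t, 0 ≤ t → s t + ∫ r in (0 : ℝ)..t, k (t - r) * s r = 1 := by
  -- The alternating Neumann series; the factorial bound on the iterates gives uniform convergence
  -- on every `[0, R]`.
  set c : ℕ → ℝ → ℝ := fun n t => (-1) ^ n * volterraIter k n t with hc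
  have hcc : ∀ n, Continuous (c n) := fun n => continuous_const.mul (continuous_volterraIter hk n)
  have hb : ∀ R M : ℝ, 0 ≤ M → (∀ t ∈ Icc 0 R, |k t| ≤ M) → ∀ n, ∀ t ∈ Icc 0 R,
      ‖c n t‖ ≤ (M * R) ^ n / n.factorial := by
    intro R M hM0 hM n t ht
    rw [hc, Real.norm_eq_abs, abs_mul, abs_pow, abs_neg, abs_one, one_pow, one_mul]
    refine (abs_volterraIter_le hk hM n t ht).trans ?_
    have := ht.1
    have := ht.2
    gcongr
  set s : ℝ → ℝ := fun t => ∑' n, c n t with hs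
  have hsum : ∀ t, 0 ≤ t → Summable fun n => c n t := by
    intro t ht
    obtain ⟨M, hM0, hM⟩ := exists_abs_le_of_continuous hk t
    exact Summable.of_norm_bounded (Real.summable_pow_div_factorial (M * t))
      fun n => hb t M hM0 hM n t ⟨ht, le_rfl⟩
  have hscont : ContinuousOn s (Ici 0) := by
    intro t ht
    obtain ⟨M, hM0, hM⟩ := exists_abs_le_of_continuous hk (t + 1)
    have h1 : ContinuousOn s (Icc 0 (t + 1)) :=
      continuousOn_tsum (fun n => (hcc n).continuousOn)
        (Real.summable_pow_div_factorial (M * (t + 1))) (fun n t ht => hb _ M hM0 hM n t ht)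
    refine (h1 t ⟨ht, by linarith⟩).mono_of_mem_nhdsWithin ?_
    have : Icc 0 (t + 1) = Ici 0 ∩ Iic (t + 1) := rfl
    rw [this]
    exact inter_mem_nhdsWithin _ (Iic_mem_nhds (by linarith))
  have hs0 : s 0 = 1 := by
    rw [hs]
    show ∑' n, c n 0 = 1
    rw [tsum_eq_single 0]
    · simp [hc, volterraIter]
    · intro n hn
      obtain ⟨m, rfl⟩ := Nat.exists_eq_succ_of_ne_zero hn
      simp [hc, volterraIter]
  have hmax : ∀ t, 0 ≤ t → s (max t 0) = s t := fun t ht => by rw [max_eq_left ht]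
  -- The constant extension to `t ≤ 0` gives continuity on the whole line, which later allows
  -- convolutions to be written with a fixed upper limit.
  refine ⟨fun t => s (max t 0), ?_, fun t ht => by
    simp only [max_eq_right ht, hs0], fun t ht => ?_⟩
  · exact hscont.comp_continuous (by fun_prop) fun t => mem_Ici.2 (le_max_right _ _)
  · have e : ∫ r in (0 : ℝ)..t, k (t - r) * s (max r 0) = ∫ r in (0 : ℝ)..t, k (t - r) * s r := by
      refine intervalIntegral.integral_congr fun r hr => ?_
      rw [uIcc_of_le ht] at hr
      simp only [hmax r hr.1]
    show s (max t 0) + ∫ r in (0 : ℝ)..t, k (t - r) * s (max r 0) = 1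
    rw [e, hmax t ht]
    obtain ⟨M, hM0, hM⟩ := exists_abs_le_of_continuous hk t
    have h1 : HasSum (fun n => ∫ r in (0 : ℝ)..t, k (t - r) * c n r)
        (∫ r in (0 : ℝ)..t, k (t - r) * s r) := by
      refine intervalIntegral.hasSum_integral_of_dominated_convergence
        (bound := fun n _ => M * ((M * t) ^ n / n.factorial))
        (fun n => (Continuous.aestronglyMeasurable (by have := hcc n; fun_prop)))
        (fun n => Eventually.of_forall fun r hr => ?_)
        (Eventually.of_forall fun r _ => (Real.summable_pow_div_factorial (M * t)).mul_left M)
        (by simp) (Eventually.of_forall fun r hr => ?_)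
      · rw [uIoc_of_le ht] at hr
        rw [norm_mul]
        exact mul_le_mul (hM _ ⟨by linarith [hr.2], by linarith [hr.1]⟩)
          (hb t M hM0 hM n r ⟨hr.1.le, hr.2⟩) (norm_nonneg _) hM0
      · rw [uIoc_of_le ht] at hr
        exact (hsum r hr.1.le).hasSum.mul_left _
    have h2 : ∀ n, ∫ r in (0 : ℝ)..t, k (t - r) * c n r = -c (n + 1) t := by
      intro n
      have : ∀ r, k (t - r) * c n r = (-1) ^ n * (k (t - r) * volterraIter k n r) := by
        intro r; simp only [hc]; ring
      simp_rw [this]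
      rw [intervalIntegral.integral_const_mul]
      simp only [hc, volterraIter]
      ring
    simp_rw [h2] at h1
    rw [← h1.tsum_eq, tsum_neg, hs]
    show ∑' n, c n t + -∑' n, c (n + 1) t = 1
    rw [(hsum t ht).tsum_eq_zero_add]
    simp [hc, volterraIter]

/-- A homogeneous linear Volterra equation has only the trivial solution. -/
theorem volterra_eq_zero {E : Type*} [NormedAddCommGroup E] [NormedSpace ℝ E] {k : ℝ → ℝ}
    (hk : Continuous k) {d : ℝ → E} (hd : ContinuousOn d (Ici 0))
    (heq : ∀ t, 0 ≤ t → d t = -∫ r in (0 : ℝ)..t, k (t - r) • d r) {t : ℝ} (ht : 0 ≤ t) :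
    d t = 0 := by
  obtain ⟨M, hM0, hM⟩ := exists_abs_le_of_continuous hk t
  obtain ⟨N, hN⟩ := isCompact_Icc.exists_bound_of_continuousOn
    (hd.mono (Icc_subset_Ici_self : Icc 0 t ⊆ Ici 0))
  have hN0 : 0 ≤ N := (norm_nonneg _).trans (hN t ⟨ht, le_rfl⟩)
  -- Feeding the bound back into the equation `n` times gains `(M u)^n / n!`, which tends to `0`.
  have key : ∀ n : ℕ, ∀ u ∈ Icc 0 t, ‖d u‖ ≤ N * ((M * u) ^ n / n.factorial) := by
    intro n
    induction n with
    | zero => intro u hu; simpa using hN u hu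
    | succ n ih =>
      intro u hu
      have e : ∫ r in (0 : ℝ)..u, M * (N * ((M * r) ^ n / n.factorial)) =
          N * ((M * u) ^ (n + 1) / (n + 1).factorial) := by
        have e1 : ∀ r : ℝ, M * (N * ((M * r) ^ n / n.factorial)) =
            N * M ^ (n + 1) / n.factorial * r ^ n := by
          intro r; rw [mul_pow]; ring
        simp_rw [e1]
        rw [intervalIntegral.integral_const_mul, integral_pow, Nat.factorial_succ]
        push_cast
        field_simp
        ring
      rw [heq u hu.1, norm_neg, ← e]
      refine intervalIntegral.norm_integral_le_of_norm_le hu.1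
        (Eventually.of_forall fun r hr => ?_) (Continuous.intervalIntegrable (by fun_prop) _ _)
      rw [norm_smul]
      exact mul_le_mul (hM _ ⟨by linarith [hr.2], by linarith [hr.1, hu.2]⟩)
        (ih r ⟨hr.1.le, hr.2.trans hu.2⟩) (norm_nonneg _) hM0
  have hlim : Tendsto (fun n : ℕ => N * ((M * t) ^ n / n.factorial)) atTop (𝓝 0) := by
    simpa using (FloorSemiring.tendsto_pow_div_factorial_atTop (M * t)).const_mul N
  have := ge_of_tendsto' hlim fun n => key n t ⟨ht, le_rfl⟩
  exact norm_le_zero_iff.1 this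

end Volterra

/-! ### The scalar resolvent of one mode -/

/-- Convolution on the half-line. -/
def lconv (b s : ℝ → ℝ) (t : ℝ) : ℝ :=
  ∫ τ in (0 : ℝ)..t, b τ * s (t - τ)

/-- The primitive of a kernel on the half-line, extended by zero. -/
def kernelPrimitive (b : ℝ → ℝ) (t : ℝ) : ℝ :=
  ∫ τ in (0 : ℝ)..t, (Ioi (0 : ℝ)).indicator b τ

theorem kernelPrimitive_of_nonneg (b : ℝ → ℝ) {t : ℝ} (ht : 0 ≤ t) :
    kernelPrimitive b t = ∫ τ in (0 : ℝ)..t, b τ := by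
  refine intervalIntegral.integral_congr_ae (Eventually.of_forall fun τ hτ => ?_)
  rw [uIoc_of_le ht] at hτ
  exact indicator_of_mem (show τ ∈ Ioi (0:ℝ) from hτ.1) _

/-- The resolvent of the scalar equation `s' + μ b * s = 0`, `s 0 = 1`. -/
structure IsScalarResolvent (b : ℝ → ℝ) (μ : ℝ) (s : ℝ → ℝ) : Prop where
  continuous : Continuous s
  zero : s 0 = 1
  continuousOn_lconv : ContinuousOn (lconv b s) (Ici 0)
  equation : ∀ t, 0 ≤ t → s t + ∫ r in (0 : ℝ)..t, (μ * kernelPrimitive b (t - r)) * s r = 1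
  hasDerivAt : ∀ t, 0 < t → HasDerivAt s (-(μ * lconv b s t)) t

namespace IsKernel

variable {b : ℝ → ℝ}

theorem intervalIntegrable (hb : IsKernel b) {t : ℝ} (ht : 0 ≤ t) :
    IntervalIntegrable b volume 0 t := by
  rw [intervalIntegrable_iff_integrableOn_Ioc_of_le ht]
  exact (hb.locallyIntegrable (t + 1) (by linarith)).mono_set
    (Ioc_subset_Ioc_right (by linarith))

theorem intervalIntegrable_indicator (hb : IsKernel b) (x y : ℝ) :
    IntervalIntegrable ((Ioi (0 : ℝ)).indicator b) volume x y := by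
  have h0 : ∀ t, IntervalIntegrable ((Ioi (0 : ℝ)).indicator b) volume 0 t := by
    intro t
    rcases le_total 0 t with ht | ht
    · refine (hb.intervalIntegrable ht).congr fun τ hτ => ?_
      rw [uIoc_of_le ht] at hτ
      exact (indicator_of_mem (show τ ∈ Ioi (0:ℝ) from hτ.1) _).symm
    · refine (intervalIntegrable_const (c := (0:ℝ))).congr fun τ hτ => ?_
      rw [uIoc_of_ge ht] at hτ
      exact (indicator_of_notMem (fun h : τ ∈ Ioi (0:ℝ) => absurd hτ.2 (not_le.2 h)) _).symm
  exact (h0 x).symm.trans (h0 y)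

theorem continuous_kernelPrimitive (hb : IsKernel b) : Continuous (kernelPrimitive b) :=
  intervalIntegral.continuous_primitive hb.intervalIntegrable_indicator 0

theorem intervalIntegrable_mul (hb : IsKernel b) {s : ℝ → ℝ} (hs : Continuous s) {t : ℝ}
    (ht : 0 ≤ t) (u : ℝ) : IntervalIntegrable (fun τ => b τ * s (u - τ)) volume 0 t :=
  (hb.intervalIntegrable ht).mul_continuousOn (by fun_prop)

theorem abs_lconv_le (hb : IsKernel b) {s : ℝ → ℝ}
    (h1 : ∀ t, 0 ≤ t → |s t| ≤ 1) {t : ℝ} (ht : 0 ≤ t) :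
    |lconv b s t| ≤ ∫ τ in (0 : ℝ)..t, b τ := by
  rw [← Real.norm_eq_abs]
  refine intervalIntegral.norm_integral_le_of_norm_le ht (Eventually.of_forall fun τ hτ => ?_)
    (hb.intervalIntegrable ht)
  rw [norm_mul, Real.norm_of_nonneg (hb.nonneg τ hτ.1)]
  exact mul_le_of_le_one_right (hb.nonneg τ hτ.1) (h1 _ (by linarith [hτ.2]))

theorem integral_le_exp_mul (hb : IsKernel b) {x t : ℝ} (hx : 0 < x) (ht : 0 ≤ t) :
    ∫ τ in (0 : ℝ)..t, b τ ≤ Real.exp (x * t) * realLaplace b x := by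
  rw [intervalIntegral.integral_of_le ht, realLaplace, ← integral_const_mul]
  have hi : IntegrableOn (fun τ => Real.exp (x * t) * (Real.exp (-(x * τ)) * b τ)) (Ioi 0) :=
    (hb.integrableOn_exp_mul hx).const_mul (Real.exp (x * t))
  calc ∫ τ in Ioc 0 t, b τ ≤
        ∫ τ in Ioc 0 t, Real.exp (x * t) * (Real.exp (-(x * τ)) * b τ) := by
        refine setIntegral_mono_on (hb.intervalIntegrable ht).1
          (hi.mono_set Ioc_subset_Ioi_self) measurableSet_Ioc fun τ hτ => ?_
        rw [← mul_assoc, ← Real.exp_add]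
        refine le_mul_of_one_le_left (hb.nonneg τ hτ.1) (Real.one_le_exp ?_)
        nlinarith [hτ.2]
    _ ≤ _ := by
        refine setIntegral_mono_set hi ?_ (LE.le.eventuallyLE Ioc_subset_Ioi_self)
        exact (ae_restrict_iff' measurableSet_Ioi).2 (Eventually.of_forall fun τ hτ =>
          mul_nonneg (Real.exp_pos _).le (mul_nonneg (Real.exp_pos _).le (hb.nonneg τ hτ)))

/-- `b` may be singular at `0`, so dominated convergence is applied with the fixed range `(0, R]`;
the surplus over `(t, R]` involves only the constant value of `s` on the negative axis and equals
`c` times a difference of primitives. -/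
theorem continuousOn_lconv (hb : IsKernel b) {s : ℝ → ℝ} (hs : Continuous s) {c : ℝ}
    (hs1 : ∀ t ≤ 0, s t = c) : ContinuousOn (lconv b s) (Ici 0) := by
  have key : ∀ R, 0 ≤ R → ContinuousOn (lconv b s) (Icc 0 R) := by
    intro R hR
    obtain ⟨N, hN⟩ := isCompact_Icc.exists_bound_of_continuousOn (hs.continuousOn (s := Icc (-R) R))
    have hc : ContinuousOn (fun t => ∫ τ in Ioc 0 R, b τ * s (t - τ)) (Icc 0 R) := by
      refine continuousOn_of_dominated (bound := fun τ => |b τ| * N)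
        (fun t _ => (hb.intervalIntegrable_mul hs hR t).1.aestronglyMeasurable)
        (fun t ht => (ae_restrict_iff' measurableSet_Ioc).2 (Eventually.of_forall fun τ hτ => ?_))
        ((hb.intervalIntegrable hR).1.norm.mul_const N)
        (Eventually.of_forall fun τ => by fun_prop)
      rw [norm_mul]
      exact mul_le_mul_of_nonneg_left
        (hN _ ⟨by linarith [ht.1, hτ.2], by linarith [ht.2, hτ.1]⟩) (abs_nonneg _)
    refine (hc.sub ((continuousOn_const (c := c)).mul
      (((continuousOn_const (c := kernelPrimitive b R)).sub
        hb.continuous_kernelPrimitive.continuousOn)))).congr fun t ht => ?_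
    have h1 := hb.intervalIntegrable_mul hs hR t
    have h2 := hb.intervalIntegrable_mul hs ht.1 t
    have e1 : ∫ τ in t..R, b τ * s (t - τ) = c * ∫ τ in t..R, b τ := by
      rw [← intervalIntegral.integral_const_mul]
      refine intervalIntegral.integral_congr fun τ hτ => ?_
      rw [uIcc_of_le ht.2] at hτ
      simp only [hs1 (t - τ) (by linarith [hτ.1]), mul_comm]
    have e2 := intervalIntegral.integral_interval_sub_left h1 h2
    have e3 := intervalIntegral.integral_interval_sub_left (hb.intervalIntegrable hR)
      (hb.intervalIntegrable ht.1)
    rw [e1, ← e3] at e2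
    show lconv b s t = (∫ τ in Ioc 0 R, b τ * s (t - τ)) -
      c * (kernelPrimitive b R - kernelPrimitive b t)
    rw [lconv, kernelPrimitive_of_nonneg b hR, kernelPrimitive_of_nonneg b ht.1,
      ← intervalIntegral.integral_of_le hR]
    linarith
  intro t ht
  have ht0 : (0:ℝ) ≤ t := ht
  refine (key (t + 1) (by linarith) t ⟨ht, by linarith⟩).mono_of_mem_nhdsWithin ?_
  have : Icc 0 (t + 1) = Ici 0 ∩ Iic (t + 1) := rfl
  rw [this]
  exact inter_mem_nhdsWithin _ (Iic_mem_nhds (by linarith))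

/-- Associativity of convolution, `(1 * b) * s = 1 * (b * s)`, by Fubini for the truncations to `(0,
t]`. It makes the integrated equation differentiable. -/
theorem integral_kernelPrimitive_mul (hb : IsKernel b) {s : ℝ → ℝ} (hs : Continuous s) {t : ℝ}
    (ht : 0 ≤ t) :
    ∫ r in (0 : ℝ)..t, kernelPrimitive b (t - r) * s r = ∫ u in (0 : ℝ)..t, lconv b s u := by
  set f : ℝ → ℝ := (Ioc 0 t).indicator s with hf
  set g : ℝ → ℝ := (Ioc 0 t).indicator b with hg
  have hfi : Integrable f := (integrable_indicator_iff measurableSet_Ioc).2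
    (hs.intervalIntegrable 0 t).1
  have hgi : Integrable g := (integrable_indicator_iff measurableSet_Ioc).2
    (hb.intervalIntegrable ht).1
  have hH := hfi.convolution_integrand (ContinuousLinearMap.mul ℝ ℝ) hgi
  simp only [ContinuousLinearMap.mul_apply'] at hH
  set ν := volume.restrict (Ioc 0 t) with hν
  have hH' : Integrable (fun p : ℝ × ℝ => f p.2 * g (p.1 - p.2)) (ν.prod volume) := by
    have : ν.prod (volume : Measure ℝ) = (volume.prod volume).restrict (Ioc 0 t ×ˢ univ) := by
      rw [← Measure.prod_restrict, Measure.restrict_univ]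
    rw [this]
    exact hH.mono_measure Measure.restrict_le_self
  have hswap := integral_integral_swap (f := fun u r => f r * g (u - r)) hH'
  have e1 : ∀ u ∈ Ioc 0 t, ∫ r, f r * g (u - r) = lconv b s u := by
    intro u hu
    have e : (fun r => f r * g (u - r)) = (Ioo 0 u).indicator (fun r => b (u - r) * s r) := by
      ext r
      by_cases hr : r ∈ Ioo 0 u
      · rw [indicator_of_mem hr, hf, hg,
          indicator_of_mem (show r ∈ Ioc 0 t from ⟨hr.1, hr.2.le.trans hu.2⟩),
          indicator_of_mem (show u - r ∈ Ioc 0 t from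
            ⟨by linarith [hr.2], by linarith [hr.1, hu.2]⟩), mul_comm]
      · rw [indicator_of_notMem hr]
        rcases le_or_gt r 0 with h | h
        · rw [hf, indicator_of_notMem (fun h' : r ∈ Ioc 0 t => absurd h'.1 (not_lt.2 h)), zero_mul]
        · have h2 : u ≤ r := not_lt.1 fun h' => hr ⟨h, h'⟩
          rw [hg, indicator_of_notMem (fun h' : u - r ∈ Ioc 0 t => by linarith [h'.1]), mul_zero]
    rw [e, integral_indicator measurableSet_Ioo, ← integral_Ioc_eq_integral_Ioo,
      ← intervalIntegral.integral_of_le hu.1.le]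
    have := intervalIntegral.integral_comp_sub_left (a := 0) (b := u) (fun τ => b τ * s (u - τ)) u
    simp only [sub_sub_cancel, sub_self, sub_zero] at this
    rw [this, lconv]
  have e2 : ∀ r ∈ Ioc 0 t, ∫ u in Ioc 0 t, f r * g (u - r) = kernelPrimitive b (t - r) * s r := by
    intro r hr
    have h0 : kernelPrimitive b (-r) = 0 := by
      have : kernelPrimitive b (-r) = ∫ τ in (0 : ℝ)..(-r), (0 : ℝ) := by
        refine intervalIntegral.integral_congr fun τ hτ => ?_
        rw [uIcc_of_ge (by linarith [hr.1])] at hτ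
        exact indicator_of_notMem (fun h : τ ∈ Ioi (0:ℝ) => absurd hτ.2 (not_le.2 h)) _
      rw [this, intervalIntegral.integral_zero]
    have h1 : ∫ u in Ioc 0 t, g (u - r) = kernelPrimitive b (t - r) := by
      have h2 : ∫ u in Ioc 0 t, g (u - r) = ∫ u in Ioc 0 t, (Ioi (0:ℝ)).indicator b (u - r) := by
        refine setIntegral_congr_fun measurableSet_Ioc fun u hu => ?_
        by_cases h : 0 < u - r
        · simp only [hg]
          rw [indicator_of_mem (show u - r ∈ Ioc 0 t from ⟨h, by linarith [hu.2, hr.1]⟩),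
            indicator_of_mem (show u - r ∈ Ioi (0:ℝ) from h)]
        · simp only [hg]
          rw [indicator_of_notMem (fun h' : u - r ∈ Ioc 0 t => h h'.1),
            indicator_of_notMem (fun h' : u - r ∈ Ioi (0:ℝ) => h h')]
      rw [h2, ← intervalIntegral.integral_of_le ht, intervalIntegral.integral_comp_sub_right,
        ← intervalIntegral.integral_interval_sub_left (hb.intervalIntegrable_indicator 0 _)
        (hb.intervalIntegrable_indicator 0 _), zero_sub]
      have h0' := h0
      rw [kernelPrimitive] at h0'
      rw [h0', sub_zero, kernelPrimitive]
    rw [integral_const_mul, h1, hf, indicator_of_mem hr, mul_comm]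
  rw [intervalIntegral.integral_of_le ht, intervalIntegral.integral_of_le ht,
    ← setIntegral_congr_fun measurableSet_Ioc e1, hswap]
  rw [← setIntegral_congr_fun measurableSet_Ioc e2]
  rw [← integral_indicator measurableSet_Ioc]
  refine integral_congr_ae (Eventually.of_forall fun r => ?_)
  by_cases hr : r ∈ Ioc 0 t
  · simp [hr, hν]
  · simp [hr, hf]

theorem exists_isScalarResolvent (hb : IsKernel b) (μ : ℝ) : ∃ s, IsScalarResolvent b μ s := by
  have hk : Continuous fun t => μ * kernelPrimitive b t :=
    continuous_const.mul hb.continuous_kernelPrimitive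
  obtain ⟨s, hs, hs1, heq⟩ := exists_volterra_solution hk
  have hv := hb.continuousOn_lconv hs hs1
  refine ⟨s, hs, hs1 0 le_rfl, hv, heq, fun t ht => ?_⟩
  have hform : ∀ u, 0 ≤ u → s u = 1 - μ * ∫ r in (0 : ℝ)..u, lconv b s r := by
    intro u hu
    have h := heq u hu
    simp_rw [mul_assoc] at h
    rw [intervalIntegral.integral_const_mul, hb.integral_kernelPrimitive_mul hs hu] at h
    linarith
  have hvi : IntervalIntegrable (lconv b s) volume 0 t :=
    (hv.mono (by rw [uIcc_of_le ht.le]; exact Icc_subset_Ici_self)).intervalIntegrable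
  have hvo : ContinuousOn (lconv b s) (Ioi 0) := hv.mono Ioi_subset_Ici_self
  have h1 := intervalIntegral.integral_hasDerivAt_right hvi
    (hvo.stronglyMeasurableAtFilter isOpen_Ioi t ht) (hvo.continuousAt (Ioi_mem_nhds ht))
  have h2 := (h1.const_mul μ).const_sub 1
  refine h2.congr_of_eventuallyEq ?_
  filter_upwards [Ioi_mem_nhds ht] with u hu using hform u (le_of_lt hu)

end IsKernel

/-! ### Laplace transforms as Fourier transforms of weighted functions -/

section Causal

open FourierTransform

/-- The exponentially weighted extension by zero of a function on the half-line. -/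
def causal (z : ℂ) (f : ℝ → ℝ) : ℝ → ℂ :=
  (Ioi (0 : ℝ)).indicator fun t => Complex.exp (-(z * t)) * f t

theorem causal_of_pos (z : ℂ) (f : ℝ → ℝ) {t : ℝ} (ht : 0 < t) :
    causal z f t = Complex.exp (-(z * t)) * f t := indicator_of_mem (s := Ioi (0:ℝ)) ht _

theorem causal_of_nonpos (z : ℂ) (f : ℝ → ℝ) {t : ℝ} (ht : t ≤ 0) : causal z f t = 0 :=
  indicator_of_notMem (fun h : t ∈ Ioi (0:ℝ) => absurd ht (not_le.2 h)) _

theorem integral_causal (z : ℂ) (f : ℝ → ℝ) : ∫ t, causal z f t = laplace f z :=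
  integral_indicator measurableSet_Ioi

theorem integrable_causal_iff (z : ℂ) (f : ℝ → ℝ) :
    Integrable (causal z f) ↔ IntegrableOn (fun t : ℝ => Complex.exp (-(z * t)) * f t) (Ioi 0) :=
  integrable_indicator_iff measurableSet_Ioi

theorem fourier_causal (σ : ℝ) (f : ℝ → ℝ) (ξ : ℝ) :
    𝓕 (causal σ f) ξ = laplace f (σ + 2 * Real.pi * ξ * Complex.I) := by
  rw [Real.fourier_real_eq_integral_exp_smul, ← integral_causal]
  refine integral_congr_ae (Eventually.of_forall fun t => ?_)
  rcases le_or_gt t 0 with h | h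
  · simp [causal_of_nonpos _ _ h]
  · simp only [causal_of_pos _ _ h, smul_eq_mul]
    rw [← mul_assoc, ← Complex.exp_add]
    congr 2
    push_cast
    ring

/-- The weight `e^(-zt)` is multiplicative, so it passes through convolution, and extension by zero
restricts the line integral to `(0, t)`. -/
theorem convolution_causal (z : ℂ) (b s : ℝ → ℝ) (t : ℝ) :
    convolution (causal z b) (causal z s) (ContinuousLinearMap.mul ℂ ℂ) volume t =
      causal z (lconv b s) t := by
  rw [convolution_def]
  simp only [ContinuousLinearMap.mul_apply']
  rcases le_or_gt t 0 with ht | ht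
  · rw [causal_of_nonpos _ _ ht]
    refine integral_eq_zero_of_ae (Eventually.of_forall fun r => ?_)
    rcases le_or_gt r 0 with hr | hr
    · simp [causal_of_nonpos _ _ hr]
    · simp [causal_of_nonpos z s (t := t - r) (by linarith)]
  · have e : (fun r => causal z b r * causal z s (t - r)) =
        (Ioo 0 t).indicator fun r => Complex.exp (-(z * t)) * ((b r * s (t - r) : ℝ) : ℂ) := by
      ext r
      by_cases hr : r ∈ Ioo 0 t
      · rw [indicator_of_mem hr, causal_of_pos _ _ hr.1, causal_of_pos _ _ (sub_pos.2 hr.2)]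
        have : Complex.exp (-(z * t)) =
            Complex.exp (-(z * r)) * Complex.exp (-(z * ((t - r : ℝ) : ℂ))) := by
          rw [← Complex.exp_add]; congr 1; push_cast; ring
        rw [this]; push_cast; ring
      · rw [indicator_of_notMem hr]
        rcases le_or_gt r 0 with h | h
        · rw [causal_of_nonpos _ _ h, zero_mul]
        · rw [causal_of_nonpos z s (t := t - r)
            (by by_contra h'; exact hr ⟨h, by linarith⟩), mul_zero]
    rw [e, integral_indicator measurableSet_Ioo, causal_of_pos _ _ ht, integral_const_mul,
      integral_complex_ofReal, ← integral_Ioc_eq_integral_Ioo,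
      ← intervalIntegral.integral_of_le ht.le, lconv]

theorem integrable_causal_lconv {z : ℂ} {b s : ℝ → ℝ} (hb : Integrable (causal z b))
    (hs : Integrable (causal z s)) : Integrable (causal z (lconv b s)) := by
  rw [← funext (convolution_causal z b s)]
  exact hb.integrable_convolution _ hs

theorem laplace_lconv {z : ℂ} {b s : ℝ → ℝ} (hb : Integrable (causal z b))
    (hs : Integrable (causal z s)) : laplace (lconv b s) z = laplace b z * laplace s z := by
  rw [← integral_causal, ← funext (convolution_causal z b s), integral_convolution _ hb hs,
    integral_causal, integral_causal]
  rfl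

theorem memLp_two_of_bound {f : ℝ → ℂ} (hf : Integrable f) {C : ℝ} (hC : ∀ t, ‖f t‖ ≤ C) :
    MemLp f 2 := by
  rw [memLp_two_iff_integrable_sq_norm hf.aestronglyMeasurable]
  refine Integrable.mono' (hf.norm.const_mul C) (hf.aestronglyMeasurable.norm.pow 2)
    (Eventually.of_forall fun t => ?_)
  rw [Real.norm_of_nonneg (by positivity), sq]
  exact mul_le_mul_of_nonneg_right (hC t) (norm_nonneg _)

theorem norm_causal_of_pos (z : ℂ) (f : ℝ → ℝ) {t : ℝ} (ht : 0 < t) :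
    ‖causal z f t‖ = Real.exp (-(z.re * t)) * |f t| := by
  rw [causal_of_pos _ _ ht, norm_mul, Complex.norm_exp, Complex.norm_real, Real.norm_eq_abs]
  simp

theorem integrable_causal_of_bound {z : ℂ} {f : ℝ → ℝ} (hf : ContinuousOn f (Ioi 0)) {C κ : ℝ}
    (hκ : κ < z.re) (hC : ∀ t, 0 < t → |f t| ≤ C * Real.exp (κ * t)) :
    Integrable (causal z f) := by
  rw [integrable_causal_iff]
  have he : IntegrableOn (fun t : ℝ => C * Real.exp (-(z.re - κ) * t)) (Ioi 0) :=
    (exp_neg_integrableOn_Ioi 0 (sub_pos.2 hκ)).const_mul _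
  refine Integrable.mono' he ?_ ?_
  · refine ContinuousOn.aestronglyMeasurable ?_ measurableSet_Ioi
    exact (Continuous.continuousOn (by fun_prop)).mul (Complex.continuous_ofReal.comp_continuousOn hf)
  · refine (ae_restrict_iff' measurableSet_Ioi).2 (Eventually.of_forall fun t ht => ?_)
    rw [← causal_of_pos z f ht, norm_causal_of_pos z f ht]
    calc _ ≤ Real.exp (-(z.re * t)) * (C * Real.exp (κ * t)) :=
          mul_le_mul_of_nonneg_left (hC t ht) (Real.exp_pos _).le
      _ = C * (Real.exp (-(z.re * t)) * Real.exp (κ * t)) := by ring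
      _ = _ := by rw [← Real.exp_add]; ring_nf

theorem norm_causal_le_of_bound {z : ℂ} {f : ℝ → ℝ} {C κ : ℝ} (hC0 : 0 ≤ C)
    (hκ : κ ≤ z.re) (hC : ∀ t, 0 < t → |f t| ≤ C * Real.exp (κ * t)) (t : ℝ) :
    ‖causal z f t‖ ≤ C := by
  rcases le_or_gt t 0 with ht | ht
  · rw [causal_of_nonpos _ _ ht, norm_zero]; exact hC0
  · rw [norm_causal_of_pos z f ht]
    calc _ ≤ Real.exp (-(z.re * t)) * (C * Real.exp (κ * t)) :=
          mul_le_mul_of_nonneg_left (hC t ht) (Real.exp_pos _).le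
      _ = C * Real.exp (-(z.re * t) + κ * t) := by rw [Real.exp_add]; ring
      _ ≤ C := mul_le_of_le_one_right hC0 (Real.exp_le_one_iff.2 (by nlinarith))

/-- Integration by parts; growth at a rate `κ < Re z` kills the boundary term at infinity. -/
theorem mul_laplace_of_hasDerivAt {z : ℂ} {f f' : ℝ → ℝ} (hc : ContinuousOn f (Ici 0))
    (hd : ∀ t, 0 < t → HasDerivAt f (f' t) t) {C κ : ℝ} (hκ : κ < z.re)
    (hC : ∀ t, 0 < t → |f t| ≤ C * Real.exp (κ * t)) (hi : Integrable (causal z f')) :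
    z * laplace f z = f 0 + laplace f' z := by
  have hfi : Integrable (causal z f) :=
    integrable_causal_of_bound (hc.mono Ioi_subset_Ici_self) hκ hC
  rw [integrable_causal_iff] at hfi hi
  have hlim : Tendsto (fun t : ℝ => Complex.exp (-(z * t)) * (f t : ℂ)) atTop (𝓝 0) := by
    rw [tendsto_zero_iff_norm_tendsto_zero]
    have h1 : Tendsto (fun t : ℝ => C * Real.exp (-((z.re - κ) * t))) atTop (𝓝 0) := by
      have h2 : Tendsto (fun t : ℝ => (z.re - κ) * t) atTop atTop :=
        tendsto_id.const_mul_atTop (sub_pos.2 hκ)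
      simpa using (Real.tendsto_exp_neg_atTop_nhds_zero.comp h2).const_mul C
    refine tendsto_of_tendsto_of_tendsto_of_le_of_le' tendsto_const_nhds h1
      (Eventually.of_forall fun t => norm_nonneg _) ?_
    filter_upwards [eventually_gt_atTop 0] with t ht
    rw [← causal_of_pos z f ht, norm_causal_of_pos z f ht]
    calc _ ≤ Real.exp (-(z.re * t)) * (C * Real.exp (κ * t)) :=
          mul_le_mul_of_nonneg_left (hC t ht) (Real.exp_pos _).le
      _ = C * (Real.exp (-(z.re * t)) * Real.exp (κ * t)) := by ring
      _ = _ := by rw [← Real.exp_add]; ring_nf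
  have h := integral_Ioi_of_hasDerivAt_of_tendsto (a := 0)
    (f := fun t : ℝ => Complex.exp (-(z * t)) * (f t : ℂ))
    (f' := fun t : ℝ => -z * (Complex.exp (-(z * t)) * (f t : ℂ)) +
      Complex.exp (-(z * t)) * (f' t : ℂ))
    ((Continuous.continuousWithinAt (by fun_prop)).mul
      ((Complex.continuous_ofReal.comp_continuousOn hc) 0 self_mem_Ici))
    (fun t ht => by
      refine ((hasDerivAt_cexp_neg_mul z t).mul (hd t ht).ofReal_comp).congr_deriv ?_
      ring)
    ((hfi.const_mul (-z)).add hi) hlim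
  rw [integral_add (hfi.const_mul (-z)) hi, integral_const_mul] at h
  simp only [Complex.ofReal_zero, mul_zero, neg_zero, Complex.exp_zero, one_mul, zero_sub] at h
  rw [laplace, laplace]
  linear_combination -h

/-- Plancherel's theorem for weighted functions on the half-line. -/
theorem integral_exp_mul_sq_eq {σ : ℝ} {f : ℝ → ℝ} (h1 : Integrable (causal σ f))
    (h2 : MemLp (causal σ f) 2) :
    ∫ t in Ioi (0 : ℝ), Real.exp (-(2 * σ * t)) * f t ^ 2 =
      ∫ ξ : ℝ, ‖laplace f (σ + 2 * Real.pi * ξ * Complex.I)‖ ^ 2 := by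
  simp_rw [← fourier_causal]
  rw [integral_norm_sq_fourier h1 h2, ← integral_indicator measurableSet_Ioi]
  refine integral_congr_ae (Eventually.of_forall fun t => ?_)
  rcases le_or_gt t 0 with ht | ht
  · rw [indicator_of_notMem (fun h : t ∈ Ioi (0:ℝ) => absurd ht (not_le.2 h))]
    simp [causal_of_nonpos _ _ ht]
  · simp only [norm_causal_of_pos _ _ ht]
    rw [indicator_of_mem (show t ∈ Ioi (0:ℝ) from ht), mul_pow, sq_abs, ← Real.exp_nat_mul]
    simp only [Complex.ofReal_re]
    congr 2
    push_cast; ring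

end Causal

/-! ### Positive type and the energy bound -/

theorem integrable_inner_of_memLp_two {f g : ℝ → ℂ} (hf : MemLp f 2) (hg : MemLp g 2) :
    Integrable fun t => inner ℂ (f t) (g t) := by
  refine (hf.norm.integrable_mul hg.norm).mono'
    (hf.aestronglyMeasurable.inner hg.aestronglyMeasurable) (Eventually.of_forall fun t => ?_)
  exact norm_inner_le_norm _ _

namespace IsKernel

open FourierTransform

variable {b : ℝ → ℝ}

theorem integrable_causal (hb : IsKernel b) {z : ℂ} (hz : 0 < z.re) : Integrable (causal z b) :=
  (integrable_causal_iff z b).2 (hb.integrableOn_cexp_mul hz)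

/-- A kernel whose Laplace transform has nonnegative real part is of positive type. -/
theorem integral_mul_lconv_nonneg (hb : IsKernel b) {s : ℝ → ℝ} (hs : Continuous s) {σ : ℝ}
    (hσ : 0 < σ) {T : ℝ} (hT : 0 ≤ T) :
    0 ≤ ∫ t in (0 : ℝ)..T, Real.exp (-(2 * σ * t)) * (s t * lconv b s t) := by
  -- Truncating at `T` makes Plancherel applicable to an arbitrary continuous `s` and, by causality,
  -- does not change `b * s` on `[0, T]`.
  set sT : ℝ → ℝ := (Iic T).indicator s with hsT
  set f := causal σ sT with hf
  set g := causal σ (lconv b sT) with hg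
  have hσre : 0 < (σ : ℂ).re := by simpa using hσ
  have hff : f = (Ioc 0 T).indicator fun t => Complex.exp (-(σ * t)) * s t := by
    ext t
    rcases le_or_gt t 0 with ht | ht
    · rw [hf, causal_of_nonpos _ _ ht, indicator_of_notMem fun h => absurd h.1 (not_lt.2 ht)]
    · rw [hf, causal_of_pos _ _ ht]
      by_cases h : t ≤ T
      · rw [indicator_of_mem (show t ∈ Ioc 0 T from ⟨ht, h⟩), hsT,
          indicator_of_mem (show t ∈ Iic T from h)]
      · rw [indicator_of_notMem (fun h' : t ∈ Ioc 0 T => h h'.2), hsT,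
          indicator_of_notMem (fun h' : t ∈ Iic T => h h')]
        simp
  have hcont : Continuous fun t : ℝ => Complex.exp (-(σ * t)) * (s t : ℂ) := by fun_prop
  have hfi : Integrable f := by
    rw [hff, integrable_indicator_iff measurableSet_Ioc]
    exact (hcont.intervalIntegrable 0 T).1
  obtain ⟨N, hN⟩ := isCompact_Icc.exists_bound_of_continuousOn (hcont.continuousOn (s := Icc 0 T))
  have hN0 : 0 ≤ N := (norm_nonneg _).trans (hN 0 ⟨le_rfl, hT⟩)
  have hfb : ∀ t, ‖f t‖ ≤ N := by
    intro t
    rw [hff]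
    by_cases h : t ∈ Ioc 0 T
    · rw [indicator_of_mem h]; exact hN t ⟨h.1.le, h.2⟩
    · rw [indicator_of_notMem h, norm_zero]; exact hN0
  have hf2 := memLp_two_of_bound hfi hfb
  have hk := hb.integrable_causal hσre
  have hgi : Integrable g := integrable_causal_lconv hk hfi
  have hgb : ∀ t, ‖g t‖ ≤ ∫ r, ‖causal σ b r‖ * N := by
    intro t
    rw [hg, ← convolution_causal, convolution_def]
    simp only [ContinuousLinearMap.mul_apply']
    refine norm_integral_le_of_norm_le (hk.norm.mul_const N) (Eventually.of_forall fun r => ?_)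
    rw [norm_mul]
    exact mul_le_mul_of_nonneg_left (hfb _) (norm_nonneg _)
  have hg2 := memLp_two_of_bound hgi hgb
  have hP := integral_inner_fourier hfi hf2 hgi hg2
  -- On the line `Re z = σ` the inner product is `b̂(z) |ŝ(z)|²`, with `s` truncated.
  have hre : ∀ ξ : ℝ, 0 ≤ (inner ℂ (𝓕 f ξ) (𝓕 g ξ)).re := by
    intro ξ
    rw [hf, hg, fourier_causal, fourier_causal]
    set z : ℂ := σ + 2 * Real.pi * ξ * Complex.I with hz
    have hzre : z.re = σ := by simp [hz]
    have hci : ∀ h : ℝ → ℝ, AEStronglyMeasurable h (volume.restrict (Ioi 0)) →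
        Integrable (causal σ h) → Integrable (causal z h) := by
      intro h hm hi
      rw [integrable_causal_iff] at hi ⊢
      refine Integrable.mono hi ((Continuous.aestronglyMeasurable (by fun_prop)).mul
        (Complex.continuous_ofReal.comp_aestronglyMeasurable hm)) (Eventually.of_forall fun t => ?_)
      rw [norm_mul, norm_mul, Complex.norm_exp, Complex.norm_exp]
      simp [hzre]
    have hsTm : AEStronglyMeasurable sT (volume.restrict (Ioi 0)) :=
      (hs.measurable.indicator measurableSet_Iic).aestronglyMeasurable
    rw [laplace_lconv (hb.integrable_causal (by rw [hzre]; exact hσ)) (hci _ hsTm hfi),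
      RCLike.inner_apply]
    have : laplace b z * laplace sT z * (starRingEnd ℂ) (laplace sT z) =
        laplace b z * ((Complex.normSq (laplace sT z) : ℝ) : ℂ) := by
      rw [mul_assoc, Complex.mul_conj]
    rw [this, Complex.re_mul_ofReal]
    exact mul_nonneg (hb.re_laplace_pos (by rw [hzre]; exact hσ)).le (Complex.normSq_nonneg _)
  have hLi : Integrable fun ξ => inner ℂ (𝓕 f ξ) (𝓕 g ξ) :=
    integrable_inner_of_memLp_two (memLp_fourier hfi hf2) (memLp_fourier hgi hg2)
  have hRi : Integrable fun t => inner ℂ (f t) (g t) := integrable_inner_of_memLp_two hf2 hg2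
  have h1 := Complex.reCLM.integral_comp_comm hLi
  have h2 := Complex.reCLM.integral_comp_comm hRi
  simp only [Complex.reCLM_apply] at h1 h2
  rw [hP, ← h2] at h1
  have h3 : ∫ t, (inner ℂ (f t) (g t)).re =
      ∫ t in (0 : ℝ)..T, Real.exp (-(2 * σ * t)) * (s t * lconv b s t) := by
    rw [intervalIntegral.integral_of_le hT, ← integral_indicator measurableSet_Ioc]
    refine integral_congr_ae (Eventually.of_forall fun t => ?_)
    by_cases h : t ∈ Ioc 0 T
    · simp only [hff, indicator_of_mem h]
      have hgv : g t = Complex.exp (-(σ * t)) * lconv b s t := by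
        rw [hg, causal_of_pos _ _ h.1]
        congr 2
        refine intervalIntegral.integral_congr fun τ hτ => ?_
        rw [uIcc_of_le h.1.le] at hτ
        simp only [hsT]
        rw [indicator_of_mem (show t - τ ∈ Iic T from by
          rw [mem_Iic]; linarith [hτ.1, h.2])]
      rw [hgv]
      have hE : ∀ r : ℝ, Complex.exp (-(σ * t)) * (r : ℂ) = ((Real.exp (-(σ * t)) * r : ℝ) : ℂ) := by
        intro r; push_cast; rfl
      rw [hE, hE, RCLike.inner_apply, Complex.conj_ofReal, ← Complex.ofReal_mul, Complex.ofReal_re]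
      have : Real.exp (-(2 * σ * t)) = Real.exp (-(σ * t)) * Real.exp (-(σ * t)) := by
        rw [← Real.exp_add]; congr 1; ring
      rw [this]; ring
    · simp only [hff, indicator_of_notMem h]
      simp
  rw [← h3, ← h1]
  exact integral_nonneg hre

end IsKernel

namespace IsScalarResolvent

variable {b : ℝ → ℝ} {μ : ℝ} {s : ℝ → ℝ}

/-- Energy estimate: differentiating `e^(-2σt) s²` gives `-2σ e^(-2σt) s² - 2μ e^(-2σt) s (b * s)`,
and the integrals of both terms are nonpositive. The weight is needed because positivity of `b̂` is
known only on the open half-plane; `σ → 0` removes it. -/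
theorem abs_le_one (hs : IsScalarResolvent b μ s) (hb : IsKernel b) (hμ : 0 ≤ μ) {T : ℝ}
    (hT : 0 ≤ T) : |s T| ≤ 1 := by
  have key : ∀ σ : ℝ, 0 < σ → s T ^ 2 ≤ Real.exp (2 * σ * T) := by
    intro σ hσ
    have hvc : ContinuousOn (lconv b s) (uIcc 0 T) :=
      hs.continuousOn_lconv.mono (by rw [uIcc_of_le hT]; exact Icc_subset_Ici_self)
    have hsc := hs.continuous
    have hd : ∀ t ∈ Ioo 0 T, HasDerivAt (fun t => Real.exp (-(2 * σ * t)) * s t ^ 2)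
        (-(2 * σ) * (Real.exp (-(2 * σ * t)) * s t ^ 2) -
          2 * μ * (Real.exp (-(2 * σ * t)) * (s t * lconv b s t))) t := by
      intro t ht
      have h1 : HasDerivAt (fun t => Real.exp (-(2 * σ * t)))
          (Real.exp (-(2 * σ * t)) * (-(2 * σ))) t := by
        have : HasDerivAt (fun t => -(2 * σ * t)) (-(2 * σ)) t := by
          simpa using! ((hasDerivAt_id t).const_mul (2 * σ)).neg
        exact this.exp
      refine (h1.mul ((hs.hasDerivAt t ht.1).pow 2)).congr_deriv ?_
      simp only [Pi.pow_apply]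
      push_cast
      ring
    have hi1 : IntervalIntegrable (fun t => -(2 * σ) * (Real.exp (-(2 * σ * t)) * s t ^ 2))
        volume 0 T := Continuous.intervalIntegrable (by fun_prop) _ _
    have hi2 : IntervalIntegrable (fun t => 2 * μ * (Real.exp (-(2 * σ * t)) *
        (s t * lconv b s t))) volume 0 T :=
      ContinuousOn.intervalIntegrable (by fun_prop)
    have h := intervalIntegral.integral_eq_sub_of_hasDerivAt_of_le hT
      (Continuous.continuousOn (by fun_prop)) hd (hi1.sub hi2)
    rw [intervalIntegral.integral_sub hi1 hi2, intervalIntegral.integral_const_mul,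
      intervalIntegral.integral_const_mul] at h
    have h1 := hb.integral_mul_lconv_nonneg hs.continuous hσ hT
    have h2 : 0 ≤ ∫ t in (0 : ℝ)..T, Real.exp (-(2 * σ * t)) * s t ^ 2 :=
      intervalIntegral.integral_nonneg hT fun t _ => by positivity
    have h3 : Real.exp (-(2 * σ * T)) * s T ^ 2 ≤ 1 := by
      have h0 : Real.exp (-(2 * σ * 0)) * s 0 ^ 2 = 1 := by simp [hs.zero]
      rw [h0] at h
      have := mul_nonneg hσ.le h2
      have := mul_nonneg hμ h1
      linarith
    rwa [Real.exp_neg, inv_mul_le_iff₀ (Real.exp_pos _), mul_one] at h3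
  have hlim : Tendsto (fun σ : ℝ => Real.exp (2 * σ * T)) (𝓝[>] 0) (𝓝 1) := by
    have : Continuous fun σ : ℝ => Real.exp (2 * σ * T) := by fun_prop
    simpa using (this.tendsto 0).mono_left nhdsWithin_le_nhds
  have h := ge_of_tendsto hlim (by filter_upwards [self_mem_nhdsWithin] with σ hσ using key σ hσ)
  exact (sq_le_one_iff_abs_le_one _).1 h

end IsScalarResolvent

/-! ### Transforms of the scalar resolvent and of its weighted derivative -/

theorem le_exp_div {κ : ℝ} (hκ : 0 < κ) (t : ℝ) : t ≤ 1 / κ * Real.exp (κ * t) := by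
  have := Real.add_one_le_exp (κ * t)
  calc t = 1 / κ * (κ * t) := by field_simp
    _ ≤ _ := mul_le_mul_of_nonneg_left (by linarith) (by positivity)

theorem laplace_const_mul (c : ℝ) (f : ℝ → ℝ) (z : ℂ) :
    laplace (fun t => c * f t) z = c * laplace f z := by
  rw [laplace, laplace, ← integral_const_mul]
  refine integral_congr_ae (Eventually.of_forall fun t => ?_)
  push_cast; ring

theorem IsKernel.integrable_causal_mul {b : ℝ → ℝ} (hb : IsKernel b) {z : ℂ} (hz : 0 < z.re) :
    Integrable (causal z fun t => t * b t) := by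
  rw [integrable_causal_iff]
  refine (hb.integrableOn_mul_cexp_mul hz).congr (Eventually.of_forall fun t => ?_)
  push_cast; ring

namespace IsScalarResolvent

variable {b : ℝ → ℝ} {μ : ℝ} {s : ℝ → ℝ}

theorem abs_le_exp (hs : IsScalarResolvent b μ s) (hb : IsKernel b) (hμ : 0 ≤ μ)
    (t : ℝ) (ht : 0 < t) : |s t| ≤ 1 * Real.exp (0 * t) := by
  simpa using hs.abs_le_one hb hμ ht.le

theorem abs_mul_le_exp (hs : IsScalarResolvent b μ s) (hb : IsKernel b) (hμ : 0 ≤ μ)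
    {κ : ℝ} (hκ : 0 < κ) (t : ℝ) (ht : 0 < t) :
    |t * s t| ≤ 1 / κ * Real.exp (κ * t) := by
  rw [abs_mul, abs_of_pos ht]
  exact (mul_le_of_le_one_right ht.le (hs.abs_le_one hb hμ ht.le)).trans (le_exp_div hκ t)

theorem abs_lconv_le_exp (hs : IsScalarResolvent b μ s) (hb : IsKernel b) (hμ : 0 ≤ μ)
    {κ : ℝ} (hκ : 0 < κ) (t : ℝ) (ht : 0 < t) :
    |lconv b s t| ≤ realLaplace b κ * Real.exp (κ * t) := by
  rw [mul_comm]
  exact (hb.abs_lconv_le (fun t ht => hs.abs_le_one hb hμ ht) ht.le).trans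
    (hb.integral_le_exp_mul hκ ht.le)

theorem abs_mul_lconv_le_exp (hs : IsScalarResolvent b μ s) (hb : IsKernel b) (hμ : 0 ≤ μ)
    {κ : ℝ} (hκ : 0 < κ) (t : ℝ) (ht : 0 < t) :
    |t * lconv b s t| ≤ realLaplace b κ / κ * Real.exp (2 * κ * t) := by
  rw [abs_mul, abs_of_pos ht]
  calc t * |lconv b s t| ≤ (1 / κ * Real.exp (κ * t)) * (realLaplace b κ * Real.exp (κ * t)) :=
        mul_le_mul (le_exp_div hκ t) (hs.abs_lconv_le_exp hb hμ hκ t ht) (abs_nonneg _)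
          (by positivity)
    _ = realLaplace b κ / κ * (Real.exp (κ * t) * Real.exp (κ * t)) := by ring
    _ = _ := by rw [← Real.exp_add]; ring_nf

theorem integrable_causal (hs : IsScalarResolvent b μ s) (hb : IsKernel b) (hμ : 0 ≤ μ)
    {z : ℂ} (hz : 0 < z.re) : Integrable (causal z s) :=
  integrable_causal_of_bound hs.continuous.continuousOn hz (hs.abs_le_exp hb hμ)

theorem integrable_causal_mul (hs : IsScalarResolvent b μ s) (hb : IsKernel b) (hμ : 0 ≤ μ)
    {z : ℂ} (hz : 0 < z.re) : Integrable (causal z fun t => t * s t) :=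
  integrable_causal_of_bound (continuous_id.mul hs.continuous).continuousOn
    (κ := z.re / 4) (by linarith) (hs.abs_mul_le_exp hb hμ (by linarith))

theorem integrable_causal_lconv (hs : IsScalarResolvent b μ s) (hb : IsKernel b) (hμ : 0 ≤ μ)
    {z : ℂ} (hz : 0 < z.re) : Integrable (causal z (lconv b s)) :=
  StochVolterra.integrable_causal_lconv (hb.integrable_causal hz) (hs.integrable_causal hb hμ hz)

theorem integrable_causal_mul_lconv (hs : IsScalarResolvent b μ s) (hb : IsKernel b) (hμ : 0 ≤ μ)
    {z : ℂ} (hz : 0 < z.re) :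
    Integrable (causal z fun t => t * lconv b s t) :=
  integrable_causal_of_bound
    (continuousOn_id.mul (hs.continuousOn_lconv.mono Ioi_subset_Ici_self))
    (κ := 2 * (z.re / 4)) (by linarith) (hs.abs_mul_lconv_le_exp hb hμ (by linarith))

theorem memLp_causal_lconv (hs : IsScalarResolvent b μ s) (hb : IsKernel b) (hμ : 0 ≤ μ)
    {z : ℂ} (hz : 0 < z.re) : MemLp (causal z (lconv b s)) 2 :=
  memLp_two_of_bound (hs.integrable_causal_lconv hb hμ hz)
    (norm_causal_le_of_bound (hb.realLaplace_pos (by linarith : 0 < z.re / 4)).le (by linarith)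
      (hs.abs_lconv_le_exp hb hμ (κ := z.re / 4) (by linarith)))

theorem memLp_causal_mul_lconv (hs : IsScalarResolvent b μ s) (hb : IsKernel b) (hμ : 0 ≤ μ)
    {z : ℂ} (hz : 0 < z.re) :
    MemLp (causal z fun t => t * lconv b s t) 2 :=
  memLp_two_of_bound (hs.integrable_causal_mul_lconv hb hμ hz)
    (norm_causal_le_of_bound (C := realLaplace b (z.re / 4) / (z.re / 4)) (κ := 2 * (z.re / 4))
      (div_nonneg (hb.realLaplace_pos (by linarith)).le (by linarith)) (by linarith)
      (hs.abs_mul_lconv_le_exp hb hμ (by linarith)))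

theorem mul_laplace_eq_one (hs : IsScalarResolvent b μ s) (hb : IsKernel b) (hμ : 0 ≤ μ)
    {z : ℂ} (hz : 0 < z.re) :
    (z + μ * laplace b z) * laplace s z = 1 := by
  have hi : Integrable (causal z fun t => -(μ * lconv b s t)) := by
    have := (hs.integrable_causal_lconv hb hμ hz).const_mul (-(μ : ℂ))
    refine this.congr (Eventually.of_forall fun t => ?_)
    rcases le_or_gt t 0 with ht | ht
    · simp [causal_of_nonpos _ _ ht]
    · simp only [causal_of_pos _ _ ht]; push_cast; ring
  have h := mul_laplace_of_hasDerivAt hs.continuous.continuousOn hs.hasDerivAt hz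
    (hs.abs_le_exp hb hμ) hi
  have e : laplace (fun t => -(μ * lconv b s t)) z = -(μ : ℂ) * laplace (lconv b s) z := by
    simp_rw [← neg_mul]
    rw [laplace_const_mul]; push_cast; rfl
  rw [e, laplace_lconv (hb.integrable_causal hz) (hs.integrable_causal hb hμ hz), hs.zero] at h
  push_cast at h
  linear_combination h

/-- Multiplication by `t` is a derivation for convolution: `t (b * s) = (t b) * s + b * (t s)`. -/
theorem laplace_mul_lconv (hs : IsScalarResolvent b μ s) (hb : IsKernel b) (hμ : 0 ≤ μ)
    {z : ℂ} (hz : 0 < z.re) :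
    laplace (fun t => t * lconv b s t) z =
      laplace (fun t => t * b t) z * laplace s z +
        laplace b z * laplace (fun t => t * s t) z := by
  have h1 := hb.integrable_causal_mul hz
  have h2 := hs.integrable_causal hb hμ hz
  have h3 := hb.integrable_causal hz
  have h4 := hs.integrable_causal_mul hb hμ hz
  rw [← laplace_lconv h1 h2, ← laplace_lconv h3 h4, ← integral_causal, ← integral_causal,
    ← integral_causal, ← integral_add (StochVolterra.integrable_causal_lconv h1 h2)
      (StochVolterra.integrable_causal_lconv h3 h4)]
  refine integral_congr_ae (Eventually.of_forall fun t => ?_)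
  rcases le_or_gt t 0 with ht | ht
  · simp [causal_of_nonpos _ _ ht]
  · simp only [causal_of_pos _ _ ht]
    rw [← mul_add, ← Complex.ofReal_add]
    congr 2
    have hi1 : IntervalIntegrable (fun τ => τ * b τ * s (t - τ)) volume 0 t := by
      have := (hb.intervalIntegrable ht.le).mul_continuousOn (g := fun τ => τ * s (t - τ))
        (by have := hs.continuous; fun_prop)
      exact this.congr fun τ _ => by ring
    have hi2 : IntervalIntegrable (fun τ => b τ * ((t - τ) * s (t - τ))) volume 0 t :=
      (hb.intervalIntegrable ht.le).mul_continuousOn (by have := hs.continuous; fun_prop)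
    simp only [lconv]
    rw [← intervalIntegral.integral_add hi1 hi2, ← intervalIntegral.integral_const_mul]
    exact intervalIntegral.integral_congr fun τ _ => by ring

/-- This is `-(b̂ / Q)' = (b̂ - z b̂') / Q²` with `Q = z + μ b̂`, the terms `μ b̂ b̂'` cancelling.
That cancellation leaves a numerator of the size of `b̂` itself. -/
theorem laplace_mul_lconv_eq (hs : IsScalarResolvent b μ s) (hb : IsKernel b) (hμ : 0 ≤ μ)
    {z : ℂ} (hz : 0 < z.re) :
    laplace (fun t => t * lconv b s t) z =
      (z * laplace (fun t => t * b t) z + laplace b z) * laplace s z ^ 2 := by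
  have hd : ∀ t, 0 < t → HasDerivAt (fun t => t * s t) (s t + (-μ) * (t * lconv b s t)) t := by
    intro t ht
    refine ((hasDerivAt_id t).mul (hs.hasDerivAt t ht)).congr_deriv ?_
    simp only [id]; ring
  have hi1 := hs.integrable_causal hb hμ hz
  have hi2 : Integrable (causal z fun t => (-μ) * (t * lconv b s t)) := by
    have := (hs.integrable_causal_mul_lconv hb hμ hz).const_mul (-(μ : ℂ))
    refine this.congr (Eventually.of_forall fun t => ?_)
    rcases le_or_gt t 0 with ht | ht
    · simp [causal_of_nonpos _ _ ht]
    · simp only [causal_of_pos _ _ ht]; push_cast; ring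
  have e : causal z (fun t => s t + (-μ) * (t * lconv b s t)) =
      causal z s + causal z (fun t => (-μ) * (t * lconv b s t)) := by
    ext t
    rcases le_or_gt t 0 with ht | ht
    · simp [causal_of_nonpos _ _ ht]
    · simp only [Pi.add_apply, causal_of_pos _ _ ht]; push_cast; ring
  have h := mul_laplace_of_hasDerivAt (z := z) (f := fun t => t * s t)
    (continuous_id.mul hs.continuous).continuousOn hd (κ := z.re / 4) (by linarith)
    (hs.abs_mul_le_exp hb hμ (by linarith)) (by rw [e]; exact hi1.add hi2)
  rw [← integral_causal _ (fun t => s t + (-μ) * (t * lconv b s t)), e,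
    integral_add' hi1 hi2, integral_causal, integral_causal, laplace_const_mul,
    hs.laplace_mul_lconv hb hμ hz] at h
  rw [hs.laplace_mul_lconv hb hμ hz]
  have hQ := hs.mul_laplace_eq_one hb hμ hz
  push_cast at h
  set X := laplace b z
  set D := laplace (fun t => t * b t) z
  set S := laplace s z
  set E := laplace (fun t => t * s t) z
  -- `E = -ŝ'` and `Q' = 1 - μ D`; the identity is read off from the equation for `t s` instead of
  -- by differentiating in `z`.
  have hE : E = (1 - μ * D) * S ^ 2 := by
    linear_combination (-E) * hQ + S * h
  rw [hE]
  linear_combination (-(D * S)) * hQ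

end IsScalarResolvent

/-! ### Lower bound of the symbol and the two square integrals -/

theorem integral_inv_sq_add_sq {x : ℝ} (hx : 0 < x) :
    Integrable (fun ξ : ℝ => (x ^ 2 + (2 * Real.pi * ξ) ^ 2)⁻¹) ∧
      ∫ ξ : ℝ, (x ^ 2 + (2 * Real.pi * ξ) ^ 2)⁻¹ = 1 / (2 * x) := by
  have hp := Real.pi_pos
  have e : ∀ ξ : ℝ, (x ^ 2 + (2 * Real.pi * ξ) ^ 2)⁻¹ =
      (x ^ 2)⁻¹ * (1 + (2 * Real.pi / x * ξ) ^ 2)⁻¹ := by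
    intro ξ
    rw [← mul_inv]
    congr 1
    field_simp
  have ha : 2 * Real.pi / x ≠ 0 := by positivity
  simp_rw [e]
  refine ⟨(integrable_inv_one_add_sq.comp_mul_left' ha).const_mul _, ?_⟩
  rw [integral_const_mul, Measure.integral_comp_mul_left (fun u : ℝ => (1 + u ^ 2)⁻¹),
    integral_univ_inv_one_add_sq, abs_of_pos (by positivity), smul_eq_mul]
  field_simp

namespace IsKernel

variable {b : ℝ → ℝ}

theorem re_le_norm_add (hb : IsKernel b) {μ : ℝ} (hμ : 0 ≤ μ) {z : ℂ} (hz : 0 < z.re) :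
    Real.cos ((rho b - 1) * (Real.pi / 2)) * (μ * ‖laplace b z‖) ≤ ‖z + μ * laplace b z‖ := by
  refine le_trans ?_ (Complex.re_le_norm _)
  rw [Complex.add_re, Complex.re_ofReal_mul]
  have := mul_le_mul_of_nonneg_left (hb.cos_mul_norm_le_re hz) hμ
  nlinarith

/-- The symbol is bounded below by the frequency and by the characteristic frequency. -/
theorem exists_le_norm_add (hb : IsKernel b) :
    ∃ K : ℝ, 1 ≤ K ∧ ∀ μ : ℝ, 0 < μ → ∀ x : ℝ, 0 < x → μ * realLaplace b x = x →
      ∀ z : ℂ, 0 < z.re → ‖z‖ ≤ K * ‖z + μ * laplace b z‖ ∧ x ≤ K * ‖z + μ * laplace b z‖ ∧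
        μ * ‖laplace b z‖ ≤ K * ‖z + μ * laplace b z‖ := by
  set c := Real.cos ((rho b - 1) * (Real.pi / 2)) with hc
  have hc0 : 0 < c := hb.cos_pos
  have hc1 : c ≤ 1 := Real.cos_le_one _
  have hinv : 1 ≤ 1 / c := by rw [le_div_iff₀ hc0]; linarith
  -- `1 / c` comes from the sector and `2000` from the comparison of `|b̂(z)|` with `b̂(|z|)`.
  refine ⟨2000 / c, by rw [le_div_iff₀ hc0]; linarith, fun μ hμ x hx hbal z hz => ?_⟩
  have hr : 0 < ‖z‖ := norm_pos_iff.2 fun h => by simp [h] at hz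
  set Q := z + μ * laplace b z with hQ
  have hQn := norm_nonneg Q
  have h1 : μ * ‖laplace b z‖ ≤ 1 / c * ‖Q‖ := by
    have h := hb.re_le_norm_add hμ.le hz
    rw [one_div, ← div_eq_inv_mul, le_div_iff₀ hc0]
    linarith
  have hK : 2000 / c * ‖Q‖ = 2000 * (1 / c * ‖Q‖) := by ring
  have hQ1 : ‖Q‖ ≤ 1 / c * ‖Q‖ := le_mul_of_one_le_left hQn hinv
  have h2 : ‖z‖ ≤ ‖Q‖ + μ * ‖laplace b z‖ := by
    have : z = Q - μ * laplace b z := by rw [hQ]; ring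
    calc ‖z‖ = ‖Q - μ * laplace b z‖ := by rw [← this]
      _ ≤ _ := by
        refine (norm_sub_le _ _).trans ?_
        rw [norm_mul, Complex.norm_real, Real.norm_of_nonneg hμ.le]
  rw [hK]
  refine ⟨by linarith, ?_, by linarith⟩
  -- For `|z| ≤ x` one has `x = μ b̂(x) ≤ μ b̂(|z|) ≤ 2000 μ |b̂(z)|`; otherwise the bound on `|z|`
  -- already bounds `x`.
  rcases le_total ‖z‖ x with h | h
  · have h3 := mul_le_mul_of_nonneg_left (hb.realLaplace_antitone hr h) hμ.le
    have h4 := mul_le_mul_of_nonneg_left (hb.le_norm_laplace hz) hμ.le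
    linarith
  · linarith

end IsKernel

/-- Uniform square-integrability of the derivative of the scalar resolvents. -/
theorem IsKernel.exists_integral_sq_le {b : ℝ → ℝ} (hb : IsKernel b) :
    ∃ C : ℝ, 0 < C ∧ ∀ μ : ℝ, 0 < μ → ∀ x : ℝ, 0 < x → μ * realLaplace b x = x →
      ∀ s : ℝ → ℝ, IsScalarResolvent b μ s → ∀ T : ℝ, 0 < T →
        ∫ t in (0 : ℝ)..T, (μ * lconv b s t) ^ 2 ≤ C * x ∧
        ∫ t in (0 : ℝ)..T, (t * (μ * lconv b s t)) ^ 2 ≤ C / x := by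
  obtain ⟨K, hK1, hK⟩ := hb.exists_le_norm_add
  have hK0 : 0 < K := by linarith
  set M : ℝ := 2 * (56000 * K ^ 2) ^ 2 with hM
  refine ⟨Real.exp 2 * M, by positivity, fun μ hμ x hx hbal s hs T hT => ?_⟩
  -- With this abscissa the weight `e^(-2σt)` is at least `e^(-2)` on `[0, T]`, whence the factor
  -- `e²`.
  set σ : ℝ := 1 / T with hσ
  have hσ0 : 0 < σ := by positivity
  -- Plancherel turns a Lorentzian bound on the transform into an `L²` bound, because the Lorentzian
  -- of width `x` has integral `1 / (2x)`. It is used with `A = M x²` for `b * s` and with `A = M`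
  -- for `t (b * s)`.
  have main : ∀ (f : ℝ → ℝ) (A : ℝ), 0 ≤ A → ContinuousOn f (Ici 0) →
      Integrable (causal σ f) → MemLp (causal σ f) 2 →
      (∀ z : ℂ, 0 < z.re → μ ^ 2 * ‖laplace f z‖ ^ 2 ≤ A * (x ^ 2 + ‖z‖ ^ 2)⁻¹) →
      ∫ t in (0 : ℝ)..T, (μ * f t) ^ 2 ≤ Real.exp 2 * (A / (2 * x)) := by
    intro f A hA hfc hf1 hf2 hbd
    have hP := integral_exp_mul_sq_eq hf1 hf2
    have hI := integral_inv_sq_add_sq hx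
    have hi : IntegrableOn (fun t => Real.exp (-(2 * σ * t)) * f t ^ 2) (Ioi 0) := by
      have h := hf2.integrable_norm_pow (by norm_num)
      refine (h.integrableOn (s := Ioi 0)).congr_fun (fun t ht => ?_) measurableSet_Ioi
      simp only [norm_causal_of_pos _ _ (mem_Ioi.1 ht), Complex.ofReal_re]
      rw [mul_pow, sq_abs, ← Real.exp_nat_mul]
      congr 2
      push_cast; ring
    have h1 : μ ^ 2 * ∫ t in Ioi (0 : ℝ), Real.exp (-(2 * σ * t)) * f t ^ 2 ≤ A / (2 * x) := by
      rw [hP, ← integral_const_mul]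
      calc _ ≤ ∫ ξ : ℝ, A * (x ^ 2 + (2 * Real.pi * ξ) ^ 2)⁻¹ := by
            refine integral_mono_of_nonneg (Eventually.of_forall fun ξ => by positivity)
              (hI.1.const_mul A) (Eventually.of_forall fun ξ => ?_)
            refine (hbd (σ + 2 * Real.pi * ξ * Complex.I) (by simpa using hσ0)).trans ?_
            refine mul_le_mul_of_nonneg_left ?_ hA
            refine inv_anti₀ (by positivity) ?_
            have : (2 * Real.pi * ξ) ^ 2 ≤ ‖(σ + 2 * Real.pi * ξ * Complex.I : ℂ)‖ ^ 2 := by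
              rw [← Complex.normSq_eq_norm_sq, Complex.normSq_apply]
              simp
              nlinarith [sq_nonneg σ]
            linarith
        _ = _ := by rw [integral_const_mul, hI.2]; ring
    have h2 : ∫ t in (0 : ℝ)..T, (μ * f t) ^ 2 ≤
        Real.exp 2 * (μ ^ 2 * ∫ t in Ioi (0 : ℝ), Real.exp (-(2 * σ * t)) * f t ^ 2) := by
      have hi' := hi.const_mul (Real.exp 2 * μ ^ 2)
      rw [← mul_assoc, ← integral_const_mul, intervalIntegral.integral_of_le hT.le]
      calc _ ≤ ∫ t in Ioc 0 T, Real.exp 2 * μ ^ 2 * (Real.exp (-(2 * σ * t)) * f t ^ 2) := by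
            refine setIntegral_mono_on ?_ (IntegrableOn.mono_set hi' Ioc_subset_Ioi_self)
              measurableSet_Ioc fun t ht => ?_
            · refine (ContinuousOn.integrableOn_Icc (a := 0) (b := T) ?_).mono_set Ioc_subset_Icc_self
              exact ((continuousOn_const.mul hfc).pow 2).mono Icc_subset_Ici_self
            · have h3 : 1 ≤ Real.exp 2 * Real.exp (-(2 * σ * t)) := by
                rw [← Real.exp_add]
                refine Real.one_le_exp ?_
                have : σ * t ≤ 1 := by
                  rw [hσ, one_div, ← div_eq_inv_mul, div_le_one hT]; exact ht.2
                linarith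
              rw [mul_pow]
              have h4 : 0 ≤ μ ^ 2 * f t ^ 2 := by positivity
              nlinarith
        _ ≤ _ := by
            refine setIntegral_mono_set hi' (Eventually.of_forall fun t => by positivity)
              (LE.le.eventuallyLE Ioc_subset_Ioi_self)
    exact h2.trans (mul_le_mul_of_nonneg_left h1 (Real.exp_pos _).le)
  have hσre : 0 < (σ : ℂ).re := by simpa using hσ0
  have hsum : ∀ z : ℂ, 0 < z.re → x ^ 2 + ‖z‖ ^ 2 ≤ 2 * K ^ 2 * ‖z + μ * laplace b z‖ ^ 2 := by
    intro z hz
    obtain ⟨h1, h2, -⟩ := hK μ hμ x hx hbal z hz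
    have h1' := pow_le_pow_left₀ (norm_nonneg _) h1 2
    have h2' := pow_le_pow_left₀ hx.le h2 2
    rw [mul_pow] at h1' h2'
    linarith
  have hQ0 : ∀ z : ℂ, 0 < z.re → 0 < ‖z + μ * laplace b z‖ := by
    intro z hz
    obtain ⟨-, h2, -⟩ := hK μ hμ x hx hbal z hz
    exact pos_of_mul_pos_right (hx.trans_le h2) hK0.le
  have hS : ∀ z : ℂ, 0 < z.re → ‖laplace s z‖ = ‖z + μ * laplace b z‖⁻¹ := by
    intro z hz
    have h := congrArg norm (hs.mul_laplace_eq_one hb hμ.le hz)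
    rw [norm_mul, norm_one] at h
    exact eq_inv_of_mul_eq_one_right h
  refine ⟨?_, ?_⟩
  · have h := main (lconv b s) (M * x ^ 2) (by positivity) hs.continuousOn_lconv
      (hs.integrable_causal_lconv hb hμ.le hσre) (hs.memLp_causal_lconv hb hμ.le hσre) ?_
    · refine h.trans ?_
      have e : Real.exp 2 * (M * x ^ 2 / (2 * x)) = Real.exp 2 * M * x / 2 := by
        field_simp
      rw [e]
      have : 0 ≤ Real.exp 2 * M * x := by positivity
      linarith
    · intro z hz
      obtain ⟨h1, h2, h3⟩ := hK μ hμ x hx hbal z hz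
      have hr : 0 < ‖z‖ := norm_pos_iff.2 fun h => by simp [h] at hz
      have hQ := hQ0 z hz
      rw [laplace_lconv (hb.integrable_causal hz) (hs.integrable_causal hb hμ.le hz), norm_mul,
        hS z hz, ← mul_pow]
      set q := ‖z + μ * laplace b z‖
      have hnn : 0 ≤ μ * (‖laplace b z‖ * q⁻¹) := by positivity
      rw [← div_eq_mul_inv (M * x ^ 2), le_div_iff₀ (by positivity)]
      -- At low frequency the transform of `μ (b * s)` is at most `K`; at high frequency `μ |b̂(z)|
      -- ≤ 4 μ b̂(x) = 4x`, and `1 / Q` supplies the decay.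
      rcases le_total ‖z‖ x with hzx | hzx
      · have h4 : μ * (‖laplace b z‖ * q⁻¹) ≤ K := by
          rw [← mul_assoc, ← div_eq_mul_inv, div_le_iff₀ hQ]; exact h3
        have h5 := pow_le_pow_left₀ hnn h4 2
        have h6 := pow_le_pow_left₀ hr.le hzx 2
        have h7 : K ^ 2 * (x ^ 2 + x ^ 2) ≤ M * x ^ 2 := by
          have : K ^ 2 ≤ K ^ 4 := pow_le_pow_right₀ hK1 (by norm_num)
          rw [hM]
          nlinarith [sq_nonneg x, sq_nonneg K, mul_nonneg (sq_nonneg K) (sq_nonneg x),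
            mul_le_mul_of_nonneg_right this (sq_nonneg x)]
        refine le_trans ?_ h7
        exact mul_le_mul h5 (by linarith) (by positivity) (by positivity)
      · have h4 : μ * ‖laplace b z‖ ≤ 4 * x := by
          have h5 := mul_le_mul_of_nonneg_left (hb.norm_laplace_le hz) hμ.le
          have h6 := mul_le_mul_of_nonneg_left (hb.realLaplace_antitone hx hzx) hμ.le
          linarith
        have h5 : μ * (‖laplace b z‖ * q⁻¹) ≤ 4 * x / q := by
          rw [← mul_assoc, ← div_eq_mul_inv]
          exact div_le_div_of_nonneg_right h4 hQ.le
        have h6 := pow_le_pow_left₀ hnn h5 2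
        calc _ ≤ (4 * x / q) ^ 2 * (2 * K ^ 2 * q ^ 2) :=
              mul_le_mul h6 (hsum z hz) (by positivity) (by positivity)
          _ = 32 * K ^ 2 * x ^ 2 := by field_simp; ring
          _ ≤ M * x ^ 2 := by
              have : K ^ 2 ≤ K ^ 4 := pow_le_pow_right₀ hK1 (by norm_num)
              rw [hM]
              nlinarith [sq_nonneg x, sq_nonneg K, mul_nonneg (sq_nonneg K) (sq_nonneg x),
                mul_le_mul_of_nonneg_right this (sq_nonneg x)]
  · have h := main (fun t => t * lconv b s t) M (by positivity)
      (continuousOn_id.mul hs.continuousOn_lconv)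
      (hs.integrable_causal_mul_lconv hb hμ.le hσre) (hs.memLp_causal_mul_lconv hb hμ.le hσre) ?_
    · have e : ∀ t, (t * (μ * lconv b s t)) ^ 2 = (μ * (t * lconv b s t)) ^ 2 := fun t => by ring
      simp_rw [e]
      refine h.trans ?_
      have e : Real.exp 2 * (M / (2 * x)) = Real.exp 2 * M / x / 2 := by
        field_simp
      rw [e]
      have : 0 ≤ Real.exp 2 * M / x := by positivity
      linarith
    · intro z hz
      obtain ⟨h1, h2, h3⟩ := hK μ hμ x hx hbal z hz
      have hQ := hQ0 z hz
      rw [hs.laplace_mul_lconv_eq hb hμ.le hz, norm_mul, norm_pow, hS z hz, ← mul_pow]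
      -- The bound `24 b̂(|z|) ≤ 24 · 2000 |b̂(z)|` needs `48001`; `56000` leaves room.
      have h4 : ‖z * laplace (fun t => t * b t) z + laplace b z‖ ≤ 56000 * ‖laplace b z‖ := by
        have h5 := hb.norm_mul_laplace_mul_le hz
        have h6 := hb.le_norm_laplace hz
        have := norm_add_le (z * laplace (fun t => t * b t) z) (laplace b z)
        linarith [norm_nonneg (laplace b z)]
      set q := ‖z + μ * laplace b z‖
      set N := ‖z * laplace (fun t => t * b t) z + laplace b z‖
      have h5 : μ * (N * q⁻¹ ^ 2) ≤ 56000 * K / q := by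
        have h6 : μ * N ≤ 56000 * K * q := by
          have := mul_le_mul_of_nonneg_left h4 hμ.le
          linarith
        calc μ * (N * q⁻¹ ^ 2) = (μ * N) * q⁻¹ ^ 2 := by ring
          _ ≤ (56000 * K * q) * q⁻¹ ^ 2 := mul_le_mul_of_nonneg_right h6 (by positivity)
          _ = _ := by field_simp
      have h6 := pow_le_pow_left₀ (show 0 ≤ μ * (N * q⁻¹ ^ 2) by positivity) h5 2
      rw [← div_eq_mul_inv M, le_div_iff₀ (by positivity)]
      calc _ ≤ (56000 * K / q) ^ 2 * (2 * K ^ 2 * q ^ 2) :=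
            mul_le_mul h6 (hsum z hz) (by positivity) (by positivity)
        _ = M := by rw [hM]; field_simp

/-! ### Time discretisation of one mode -/

/-- A Hardy-type inequality for the deviation from the right end point value. -/
theorem integral_sub_right_sq_le {s u : ℝ → ℝ} {a d : ℝ} (had : a ≤ d) (hs : Continuous s)
    (hu : ContinuousOn u (Icc a d)) (hd : ∀ t ∈ Ioo a d, HasDerivAt s (u t) t) :
    ∫ t in a..d, (s t - s d) ^ 2 ≤ 4 * ∫ t in a..d, ((t - a) * u t) ^ 2 := by
  have huc : ContinuousOn u (uIcc a d) := by rwa [uIcc_of_le had]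
  -- This product vanishes at both ends, so the integral of its derivative is zero.
  have hG : ∀ t ∈ Ioo a d, HasDerivAt (fun t => (t - a) * (s t - s d) ^ 2)
      ((s t - s d) ^ 2 + 2 * ((t - a) * ((s t - s d) * u t))) t := by
    intro t ht
    refine (((hasDerivAt_id t).sub_const a).mul (((hd t ht).sub_const (s d)).pow 2)).congr_deriv ?_
    simp only [id, Pi.pow_apply]
    push_cast
    ring
  have hi1 : IntervalIntegrable (fun t => (s t - s d) ^ 2) volume a d :=
    Continuous.intervalIntegrable (by fun_prop) _ _
  have hi2 : IntervalIntegrable (fun t => 2 * ((t - a) * ((s t - s d) * u t))) volume a d :=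
    ContinuousOn.intervalIntegrable (by fun_prop)
  have hi3 : IntervalIntegrable (fun t => ((t - a) * u t) ^ 2) volume a d :=
    ContinuousOn.intervalIntegrable (by fun_prop)
  have h := intervalIntegral.integral_eq_sub_of_hasDerivAt_of_le had
    (Continuous.continuousOn (by fun_prop)) hG (hi1.add hi2)
  simp only [sub_self, zero_mul, ne_eq, OfNat.ofNat_ne_zero, not_false_eq_true, zero_pow,
    mul_zero] at h
  have hle : ∫ t in a..d, (s t - s d) ^ 2 ≤
      ∫ t in a..d, (2 * ((s t - s d) ^ 2 + 2 * ((t - a) * ((s t - s d) * u t))) +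
        4 * ((t - a) * u t) ^ 2) := by
    refine intervalIntegral.integral_mono_on had hi1
      (((hi1.add hi2).const_mul 2).add (hi3.const_mul 4)) fun t _ => ?_
    -- The right side minus the left side is exactly this square; the multiple of the exact
    -- derivative integrates to zero.
    nlinarith [sq_nonneg ((s t - s d) + 2 * ((t - a) * u t))]
  rw [intervalIntegral.integral_add ((hi1.add hi2).const_mul 2) (hi3.const_mul 4),
    intervalIntegral.integral_const_mul, intervalIntegral.integral_const_mul, h] at hle
  linarith

/-- Reversed time `t = nh - r` makes the steps tile `[0, nh]` from right to left, hence the sign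
change in the telescoping sum. -/
theorem sum_integral_uniform_partition {w : ℝ → ℝ} {n : ℕ} {h : ℝ} (hh : 0 ≤ h)
    (hw : ContinuousOn w (Ici 0)) :
    ∑ k ∈ Finset.Icc 1 n, ∫ t in ((n : ℝ) * h - k * h)..((n : ℝ) * h - ((k : ℝ) - 1) * h), w t =
      ∫ t in (0 : ℝ)..(n * h), w t := by
  have e1 : Finset.Icc 1 n = Finset.Ico 1 (n + 1) := rfl
  rw [e1, Finset.sum_Ico_eq_sum_range, Nat.add_sub_cancel]
  have hadj := intervalIntegral.sum_integral_adjacent_intervals (f := w) (μ := volume)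
    (a := fun i : ℕ => (n : ℝ) * h - i * h) (n := n) (fun i hi => by
      refine (hw.mono fun t ht => ?_).intervalIntegrable
      have h1 : (i : ℝ) + 1 ≤ n := by exact_mod_cast hi
      rw [uIcc_of_ge (by push_cast; nlinarith)] at ht
      have h2 := ht.1
      push_cast at h2
      rw [mem_Ici]
      nlinarith)
  simp only [Nat.cast_zero, zero_mul, sub_zero, sub_self] at hadj
  rw [intervalIntegral.integral_symm, ← hadj, ← Finset.sum_neg_distrib]
  refine Finset.sum_congr rfl fun i _ => ?_
  rw [← intervalIntegral.integral_symm]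
  push_cast
  congr 1 <;> ring

/-- The time-discretisation error of one Fourier mode. -/
theorem sum_integral_sub_sq_le {s u : ℝ → ℝ} (hs : Continuous s) (hu : ContinuousOn u (Ici 0))
    (hd : ∀ t, 0 < t → HasDerivAt s (u t) t) {n : ℕ} {h : ℝ} (hh : 0 < h) :
    ∑ k ∈ Finset.Icc 1 n, ∫ r in (((k : ℝ) - 1) * h)..((k : ℝ) * h),
        (s ((n : ℝ) * h - r) - s ((n : ℝ) * h - ((k : ℝ) - 1) * h)) ^ 2 ≤
      4 * h ^ 2 * ∫ t in (0 : ℝ)..(n * h), u t ^ 2 ∧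
    ∑ k ∈ Finset.Icc 1 n, ∫ r in (((k : ℝ) - 1) * h)..((k : ℝ) * h),
        (s ((n : ℝ) * h - r) - s ((n : ℝ) * h - ((k : ℝ) - 1) * h)) ^ 2 ≤
      4 * ∫ t in (0 : ℝ)..(n * h), (t * u t) ^ 2 := by
  -- In reversed time the frozen value sits at the right end of the step, as in the Hardy
  -- inequality. The weight `t - a` is at most `h` and also at most `t`; these two majorants `w`
  -- give the two bounds.
  have hstep : ∀ k ∈ Finset.Icc 1 n, ∀ w : ℝ → ℝ, ContinuousOn w (Ici 0) →
      (∀ t ∈ Icc ((n : ℝ) * h - k * h) ((n : ℝ) * h - ((k : ℝ) - 1) * h),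
        ((t - ((n : ℝ) * h - k * h)) * u t) ^ 2 ≤ w t) →
      ∫ r in (((k : ℝ) - 1) * h)..((k : ℝ) * h),
        (s ((n : ℝ) * h - r) - s ((n : ℝ) * h - ((k : ℝ) - 1) * h)) ^ 2 ≤
      4 * ∫ t in ((n : ℝ) * h - k * h)..((n : ℝ) * h - ((k : ℝ) - 1) * h), w t := by
    intro k hk w hw hle
    have hkn : (k : ℝ) ≤ n := by exact_mod_cast (Finset.mem_Icc.1 hk).2
    have ha : 0 ≤ (n : ℝ) * h - k * h := by nlinarith
    have had : (n : ℝ) * h - k * h ≤ (n : ℝ) * h - ((k : ℝ) - 1) * h := by nlinarith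
    have hsub : Icc ((n : ℝ) * h - k * h) ((n : ℝ) * h - ((k : ℝ) - 1) * h) ⊆ Ici 0 :=
      fun t ht => ha.trans ht.1
    rw [intervalIntegral.integral_comp_sub_left
      (fun t => (s t - s ((n : ℝ) * h - ((k : ℝ) - 1) * h)) ^ 2) ((n : ℝ) * h)]
    refine (integral_sub_right_sq_le had hs (hu.mono hsub)
      fun t ht => hd t (ha.trans_lt ht.1)).trans ?_
    refine mul_le_mul_of_nonneg_left ?_ (by norm_num)
    refine intervalIntegral.integral_mono_on had ?_ ?_ hle
    · refine ContinuousOn.intervalIntegrable ?_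
      rw [uIcc_of_le had]
      have := hu.mono hsub
      fun_prop
    · refine ContinuousOn.intervalIntegrable ?_
      rw [uIcc_of_le had]
      exact hw.mono hsub
  constructor
  · have hw : ContinuousOn (fun t => h ^ 2 * u t ^ 2) (Ici 0) := by fun_prop
    refine (Finset.sum_le_sum fun k hk => hstep k hk _ hw fun t ht => ?_).trans ?_
    · rw [mul_pow]
      refine mul_le_mul_of_nonneg_right ?_ (sq_nonneg _)
      refine pow_le_pow_left₀ (by linarith [ht.1]) ?_ 2
      nlinarith [ht.2]
    · rw [← Finset.mul_sum, sum_integral_uniform_partition hh.le hw,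
        intervalIntegral.integral_const_mul, mul_assoc]
  · have hw : ContinuousOn (fun t => (t * u t) ^ 2) (Ici 0) := by fun_prop
    refine (Finset.sum_le_sum fun k hk => hstep k hk _ hw fun t ht => ?_).trans ?_
    · rw [mul_pow, mul_pow]
      refine mul_le_mul_of_nonneg_right ?_ (sq_nonneg _)
      have hkn : (k : ℝ) ≤ n := by exact_mod_cast (Finset.mem_Icc.1 hk).2
      refine pow_le_pow_left₀ (by linarith [ht.1]) ?_ 2
      nlinarith
    · rw [← Finset.mul_sum, sum_integral_uniform_partition hh.le hw]

/-- The time-discretisation error of the scalar resolvents, uniformly in the eigenvalue. -/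
theorem IsKernel.exists_sum_integral_sub_sq_le {b : ℝ → ℝ} (hb : IsKernel b) {μ₀ T : ℝ}
    (hμ₀ : 0 < μ₀) (hT : 0 < T) (γ : ℝ) :
    ∃ C : ℝ, 0 < C ∧ ∀ μ, μ₀ ≤ μ → ∀ s, IsScalarResolvent b μ s →
      ∀ σ : ℝ, 0 < σ → σ ≤ 1 / rho b → γ < rho b * σ / 2 →
        ∀ (n : ℕ) (h : ℝ), 0 < h → n * h = T →
          ∑ k ∈ Finset.Icc 1 n, ∫ r in (((k : ℝ) - 1) * h)..((k : ℝ) * h),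
            (s ((n : ℝ) * h - r) - s ((n : ℝ) * h - ((k : ℝ) - 1) * h)) ^ 2 ≤
          C * h ^ (2 * γ) * μ ^ (σ - 1 / rho b) := by
  obtain ⟨C, hC, hL2⟩ := hb.exists_integral_sq_le
  obtain ⟨c', hc', hgrow'⟩ := hb.exists_le_balance hμ₀
  -- Taking `c ≤ 1` gives `c^(ρσ-1) ≤ c⁻¹` for all admissible `σ`, so the constant does not depend
  -- on `σ`.
  set c := min c' 1 with hcdef
  have hc : 0 < c := lt_min hc' one_pos
  have hc1 : c ≤ 1 := min_le_right _ _
  have hρ : 0 < rho b := by linarith [hb.one_lt_rho]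
  set B := max 1 T with hBdef
  have hB1 : 1 ≤ B := le_max_left _ _
  have hB0 : 0 < B := by linarith
  refine ⟨4 * C * B ^ (1 + 2 * |γ|) * c⁻¹, by positivity,
    fun μ hμ s hs σ hσ0 hσ hγ n h hh hnh => ?_⟩
  have hμ0 : 0 < μ := hμ₀.trans_le hμ
  obtain ⟨x, hx, hbal⟩ := hb.exists_balance hμ0
  have hcx : c * μ ^ (1 / rho b) ≤ x :=
    (mul_le_mul_of_nonneg_right (min_le_left _ _) (by positivity)).trans (hgrow' μ hμ x hx hbal)
  obtain ⟨hI1, hI2⟩ := hL2 μ hμ0 x hx hbal s hs T hT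
  have hu : ContinuousOn (fun t => -(μ * lconv b s t)) (Ici 0) :=
    (continuousOn_const.mul hs.continuousOn_lconv).neg
  obtain ⟨hE1, hE2⟩ := sum_integral_sub_sq_le hs.continuous hu hs.hasDerivAt (n := n) hh
  set E := ∑ k ∈ Finset.Icc 1 n, ∫ r in (((k : ℝ) - 1) * h)..((k : ℝ) * h),
            (s ((n : ℝ) * h - r) - s ((n : ℝ) * h - ((k : ℝ) - 1) * h)) ^ 2
  simp only [mul_neg, neg_sq] at hE1 hE2
  rw [hnh] at hE1 hE2
  have hρσ1 : rho b * σ ≤ 1 := by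
    have := mul_le_mul_of_nonneg_left hσ hρ.le
    rwa [mul_one_div_cancel hρ.ne'] at this
  have hρσ0 : 0 < rho b * σ := mul_pos hρ hσ0
  have hxh : 0 < h * x := mul_pos hh hx
  -- Interpolation of `h² x = (hx)² / x` and `1 / x`: any exponent in `[0, 2]` on `hx` is allowed,
  -- by splitting at `hx = 1`.
  have hmain : E ≤ 4 * C * ((h * x) ^ (rho b * σ) / x) := by
    rcases le_total (h * x) 1 with hle | hle
    · have h1 : (h * x) ^ (2 : ℝ) ≤ (h * x) ^ (rho b * σ) :=
        Real.rpow_le_rpow_of_exponent_ge hxh hle (by linarith)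
      rw [Real.rpow_two] at h1
      calc E ≤ 4 * h ^ 2 * (C * x) :=
            hE1.trans (mul_le_mul_of_nonneg_left hI1 (by positivity))
        _ = 4 * C * ((h * x) ^ 2 / x) := by field_simp
        _ ≤ _ := by gcongr
    · have h1 : 1 ≤ (h * x) ^ (rho b * σ) := Real.one_le_rpow hle hρσ0.le
      calc E ≤ 4 * (C / x) := hE2.trans (mul_le_mul_of_nonneg_left hI2 (by norm_num))
        _ = 4 * C * (1 / x) := by ring
        _ ≤ _ := by gcongr
  have hsplit : (h * x) ^ (rho b * σ) / x = h ^ (rho b * σ) * x ^ (rho b * σ - 1) := by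
    rw [Real.mul_rpow hh.le hx.le, Real.rpow_sub_one hx.ne', mul_div_assoc]
  have hx1 : x ^ (rho b * σ - 1) ≤ c⁻¹ * μ ^ (σ - 1 / rho b) := by
    calc x ^ (rho b * σ - 1) ≤ (c * μ ^ (1 / rho b)) ^ (rho b * σ - 1) :=
          Real.rpow_le_rpow_of_nonpos (by positivity) hcx (by linarith)
      _ = c ^ (rho b * σ - 1) * μ ^ (σ - 1 / rho b) := by
          rw [Real.mul_rpow hc.le (by positivity), ← Real.rpow_mul hμ0.le]
          congr 2
          field_simp
      _ ≤ _ := by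
          refine mul_le_mul_of_nonneg_right ?_ (by positivity)
          rw [← Real.rpow_neg_one c]
          exact Real.rpow_le_rpow_of_exponent_ge hc hc1 (by linarith)
  have hhT : h ≤ B := by
    refine le_trans ?_ (le_max_right _ _)
    have hn : (1 : ℝ) ≤ n := by
      have : n ≠ 0 := by rintro rfl; simp at hnh; linarith
      exact_mod_cast Nat.one_le_iff_ne_zero.2 this
    nlinarith
  -- The spare exponent `ρσ - 2γ` lies in `(0, 1 + 2|γ|]` and `h ≤ T ≤ B` with `B ≥ 1`.
  have hh1 : h ^ (rho b * σ) ≤ B ^ (1 + 2 * |γ|) * h ^ (2 * γ) := by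
    have : rho b * σ = (rho b * σ - 2 * γ) + 2 * γ := by ring
    rw [this, Real.rpow_add hh]
    refine mul_le_mul_of_nonneg_right ?_ (by positivity)
    calc h ^ (rho b * σ - 2 * γ) ≤ B ^ (rho b * σ - 2 * γ) :=
          Real.rpow_le_rpow hh.le hhT (by linarith)
      _ ≤ _ := Real.rpow_le_rpow_of_exponent_le hB1 (by linarith [neg_abs_le γ])
  calc E ≤ 4 * C * (h ^ (rho b * σ) * x ^ (rho b * σ - 1)) := by rw [← hsplit]; exact hmain
    _ ≤ 4 * C * ((B ^ (1 + 2 * |γ|) * h ^ (2 * γ)) * (c⁻¹ * μ ^ (σ - 1 / rho b))) := by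
        gcongr
    _ = _ := by ring

/-! ### Spectral decomposition through the compact inverse -/

section Spectral

variable {H : Type*} [NormedAddCommGroup H] [InnerProductSpace ℝ H] {A : H →ₗ.[ℝ] H}

/-- `K` is the bounded inverse of `A`. -/
structure IsInverse (A : H →ₗ.[ℝ] H) (K : H →L[ℝ] H) : Prop where
  right : ∀ y : H, ∃ h : K y ∈ A.domain, A ⟨K y, h⟩ = y
  left : ∀ x : A.domain, K (A x) = (x : H)

/-- It replaces the unbounded eigenvalue problem, domain condition included, by an equation for the
bounded operator `K`. -/
theorem IsInverse.mem_eigenspace_iff {K : H →L[ℝ] H} (hK : IsInverse A K) {μ : ℝ} {x : H} :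
    x ∈ eigenspace A μ ↔ μ • K x = x := by
  constructor
  · rintro ⟨h, e⟩
    rw [← map_smul, ← e]
    exact hK.left ⟨x, h⟩
  · intro h
    obtain ⟨h1, h2⟩ := hK.right (μ • x)
    have e : K (μ • x) = x := by rw [map_smul, h]
    refine ⟨e ▸ h1, ?_⟩
    have h3 : (⟨x, e ▸ h1⟩ : A.domain) = ⟨K (μ • x), h1⟩ := Subtype.ext e.symm
    rw [h3, h2]

variable [CompleteSpace H]

theorem IsPosOperator.exists_isInverse (hA : IsPosOperator A) :
    ∃ K : H →L[ℝ] H, IsCompactOperator K ∧ IsInverse A K := by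
  obtain ⟨K, hK, h1, h2⟩ := hA.compact_inverse
  exact ⟨K, hK, h1, h2⟩

theorem IsPosOperator.inner_map_left (hA : IsPosOperator A) (x y : A.domain) :
    inner ℝ (A x) (y : H) = inner ℝ (x : H) (A y) := by
  have h := LinearPMap.adjoint_isFormalAdjoint hA.dense_domain
  rw [LinearPMap.isSelfAdjoint_def.mp hA.isSelfAdjoint] at h
  exact h x y

theorem IsInverse.inner_left {K : H →L[ℝ] H} (hK : IsInverse A K) (hA : IsPosOperator A)
    (x y : H) : inner ℝ (K x) y = inner ℝ x (K y) := by
  obtain ⟨hx, ex⟩ := hK.right x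
  obtain ⟨hy, ey⟩ := hK.right y
  have h := hA.inner_map_left ⟨K x, hx⟩ ⟨K y, hy⟩
  rw [ex, ey] at h
  exact h.symm

theorem IsPosOperator.topologicalClosure_eigenspace (hA : IsPosOperator A) (μ : ℝ) :
    (eigenspace A μ).topologicalClosure = eigenspace A μ := by
  obtain ⟨K, -, hK⟩ := hA.exists_isInverse
  have h : (eigenspace A μ : Set H) = {x | μ • K x = x} := by
    ext x
    exact hK.mem_eigenspace_iff
  have hc : IsClosed (eigenspace A μ : Set H) := by
    rw [h]
    exact isClosed_eq (by fun_prop) continuous_id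
  exact hc.submodule_topologicalClosure_eq

theorem IsPosOperator.eigenproj_mem (hA : IsPosOperator A) (μ : ℝ) (x : H) :
    eigenproj A μ x ∈ eigenspace A μ := by
  have h : eigenproj A μ x ∈ (eigenspace A μ).topologicalClosure :=
    Submodule.starProjection_apply_mem _ x
  rwa [hA.topologicalClosure_eigenspace μ] at h

theorem eigenproj_of_mem {μ : ℝ} {x : H} (hx : x ∈ eigenspace A μ) : eigenproj A μ x = x :=
  Submodule.starProjection_eq_self_iff.mpr (Submodule.le_topologicalClosure _ hx)

theorem eigenproj_inner (μ : ℝ) (x y : H) :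
    inner ℝ (eigenproj A μ x) y = inner ℝ x (eigenproj A μ y) :=
  Submodule.starProjection_isSymmetric _ x y

theorem IsPosOperator.inner_eq_zero (hA : IsPosOperator A) {μ ν : ℝ} (h : μ ≠ ν) {x y : H}
    (hx : x ∈ eigenspace A μ) (hy : y ∈ eigenspace A ν) : inner ℝ x y = 0 := by
  obtain ⟨K, -, hK⟩ := hA.exists_isInverse
  have h1 : inner ℝ x y = μ * inner ℝ x (K y) := by
    rw [← hK.inner_left hA, ← real_inner_smul_left, hK.mem_eigenspace_iff.mp hx]
  have h2 : inner ℝ x y = ν * inner ℝ x (K y) := by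
    rw [← real_inner_smul_right, hK.mem_eigenspace_iff.mp hy]
  have h3 : (μ - ν) * inner ℝ x (K y) = 0 := by linarith
  rcases mul_eq_zero.mp h3 with h4 | h4
  · exact absurd (sub_eq_zero.mp h4) h
  · rw [h1, h4, mul_zero]

theorem IsPosOperator.eigenproj_of_mem_ne (hA : IsPosOperator A) {μ ν : ℝ} (h : μ ≠ ν) {x : H}
    (hx : x ∈ eigenspace A μ) : eigenproj A ν x = 0 := by
  rw [← inner_self_eq_zero (𝕜 := ℝ), eigenproj_inner, eigenproj_of_mem (hA.eigenproj_mem ν x)]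
  exact hA.inner_eq_zero h hx (hA.eigenproj_mem ν x)

theorem IsPosOperator.orthogonalFamily (hA : IsPosOperator A) :
    OrthogonalFamily ℝ (fun μ => (eigenspace A μ).topologicalClosure)
      fun μ => ((eigenspace A μ).topologicalClosure).subtypeₗᵢ := by
  intro μ ν h x y
  exact hA.inner_eq_zero h ((hA.topologicalClosure_eigenspace μ).le x.2)
    ((hA.topologicalClosure_eigenspace ν).le y.2)

/-- The spectral theorem for the compact symmetric `K`: its eigenspace for `μ` is contained in that
of `A` for `μ⁻¹`, so the eigenspaces of `A` are total. -/
theorem IsPosOperator.hasSum_eigenproj (hA : IsPosOperator A) (x : H) :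
    HasSum (fun μ => eigenproj A μ x) x := by
  obtain ⟨K, hKc, hK⟩ := hA.exists_isInverse
  have hsymm : (K : H →ₗ[ℝ] H).IsSymmetric := fun x y => hK.inner_left hA x y
  have hle : ∀ μ : ℝ, Module.End.eigenspace (K : Module.End ℝ H) μ ≤
      ⨆ μ, (eigenspace A μ).topologicalClosure := by
    intro μ
    refine le_trans ?_ (le_iSup (fun μ => (eigenspace A μ).topologicalClosure) μ⁻¹)
    intro y hy
    rw [Module.End.mem_eigenspace_iff] at hy
    have hy' : K y = μ • y := hy
    apply Submodule.le_topologicalClosure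
    rw [hK.mem_eigenspace_iff, hy']
    -- For `μ = 0` the inverse is the default value `0`, which is harmless: `K y = 0` forces `y =
    -- 0`.
    rcases eq_or_ne μ 0 with h0 | h0
    · obtain ⟨h1, h2⟩ := hK.right y
      have e : (⟨K y, h1⟩ : A.domain) = 0 := Subtype.ext (by
        simp only [hy', h0, zero_smul, ZeroMemClass.coe_zero])
      rw [e, LinearPMap.map_zero] at h2
      rw [← h2, smul_zero, smul_zero]
    · exact inv_smul_smul₀ h0 y
  have htot : (⨆ μ, (eigenspace A μ).topologicalClosure).topologicalClosure = ⊤ := by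
    rw [Submodule.topologicalClosure_eq_top_iff, eq_bot_iff,
      ← ContinuousLinearMap.orthogonalComplement_iSup_eigenspaces_eq_bot hKc hsymm]
    exact Submodule.orthogonal_le (iSup_le hle)
  have hs := IsHilbertSum.mkInternal _ hA.orthogonalFamily htot.ge
  obtain ⟨w, hw⟩ : ∃ w, hs.linearIsometryEquiv.symm w = x := hs.linearIsometryEquiv.symm.surjective x
  have hsum := hs.hasSum_linearIsometryEquiv_symm w
  rw [hw] at hsum
  have hmem : ∀ μ, ((w μ : H)) ∈ eigenspace A μ := fun μ =>
    (hA.topologicalClosure_eigenspace μ).le (w μ).2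
  have hcoef : ∀ ν, eigenproj A ν x = w ν := by
    intro ν
    have h1 := hsum.mapL (eigenproj A ν)
    have h2 : HasSum (fun μ => eigenproj A ν (w μ : H)) (eigenproj A ν (w ν : H)) :=
      hasSum_single ν fun μ hμ => hA.eigenproj_of_mem_ne hμ (hmem μ)
    rw [eigenproj_of_mem (hmem ν)] at h2
    exact h1.unique h2
  simp_rw [hcoef]
  exact hsum

theorem IsPosOperator.hasSum_norm_sq (hA : IsPosOperator A) (x : H) :
    HasSum (fun μ => ‖eigenproj A μ x‖ ^ 2) (‖x‖ ^ 2) := by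
  have h := (hA.hasSum_eigenproj x).mapL (innerSL ℝ x)
  simp only [innerSL_apply_apply, real_inner_self_eq_norm_sq] at h
  convert! h using 2 with μ
  rw [← real_inner_self_eq_norm_sq, eigenproj_inner, eigenproj_of_mem (hA.eigenproj_mem μ x)]

theorem IsPosOperator.ext (hA : IsPosOperator A) {x y : H}
    (h : ∀ μ, eigenproj A μ x = eigenproj A μ y) : x = y := by
  refine (hA.hasSum_eigenproj x).unique ?_
  simp_rw [h]
  exact hA.hasSum_eigenproj y

/-- An eigenvector satisfies `y = μ K y`, so `μ ≥ 1 / ‖K‖`; adding `1` avoids dividing by zero on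
the trivial space. Sums over all real `μ` thus see only positive `μ` bounded away from `0`. -/
theorem IsPosOperator.exists_lowerBound (hA : IsPosOperator A) :
    ∃ μ₀ : ℝ, 0 < μ₀ ∧ ∀ μ, μ < μ₀ → eigenproj A μ = 0 := by
  obtain ⟨K, -, hK⟩ := hA.exists_isInverse
  have hpos : 0 < ‖K‖ + 1 := by positivity
  refine ⟨1 / (‖K‖ + 1), by positivity, fun μ hμ => ?_⟩
  ext x
  by_contra hne
  have hmem := hA.eigenproj_mem μ x
  set y := eigenproj A μ x
  have hne' : y ≠ 0 := hne
  have hy : 0 < ‖y‖ := norm_pos_iff.mpr hne'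
  have h0 : 0 ≤ μ := by
    obtain ⟨h1, h2⟩ := hmem
    have h3 := hA.nonneg ⟨y, h1⟩
    rw [h2, real_inner_smul_left, real_inner_self_eq_norm_sq] at h3
    exact nonneg_of_mul_nonneg_left h3 (by positivity)
  have h4 : ‖y‖ ≤ μ * (‖K‖ * ‖y‖) := by
    calc ‖y‖ = ‖μ • K y‖ := by rw [hK.mem_eigenspace_iff.mp hmem]
      _ = μ * ‖K y‖ := by rw [norm_smul, Real.norm_of_nonneg h0]
      _ ≤ _ := by gcongr; exact K.le_opNorm y
  rw [lt_div_iff₀ hpos] at hμ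
  nlinarith

theorem IsInverse.eigenproj_map {K : H →L[ℝ] H} (hK : IsInverse A K) (hA : IsPosOperator A)
    (μ : ℝ) (x : H) : μ • eigenproj A μ (K x) = eigenproj A μ x := by
  refine ext_inner_right ℝ fun y => ?_
  rw [real_inner_smul_left, eigenproj_inner, hK.inner_left hA, ← real_inner_smul_right,
    hK.mem_eigenspace_iff.mp (hA.eigenproj_mem μ y), eigenproj_inner]

theorem IsPosOperator.eigenproj_map (hA : IsPosOperator A) (μ : ℝ) (x : A.domain) :
    eigenproj A μ (A x) = μ • eigenproj A μ (x : H) := by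
  obtain ⟨K, -, hK⟩ := hA.exists_isInverse
  rw [← hK.eigenproj_map hA, hK.left]

theorem IsPosOperator.exists_hasSum_smul (hA : IsPosOperator A) {m : ℝ → ℝ} {M : ℝ}
    (hm : ∀ μ, |m μ| ≤ M) (x : H) :
    ∃ y, HasSum (fun μ => m μ • eigenproj A μ x) y ∧
      ∀ ν, eigenproj A ν y = m ν • eigenproj A ν x := by
  have hs : Summable fun μ => m μ • eigenproj A μ x := by
    have h := (hA.orthogonalFamily.summable_iff_norm_sq_summable
      (fun μ => m μ • ⟨eigenproj A μ x, Submodule.starProjection_apply_mem _ x⟩)).mpr (by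
        refine Summable.of_nonneg_of_le (fun μ => by positivity) (fun μ => ?_)
          ((hA.hasSum_norm_sq x).summable.mul_left (M ^ 2))
        rw [norm_smul, mul_pow, Real.norm_eq_abs]
        have := hm μ
        have := abs_nonneg (m μ)
        gcongr
        exact le_rfl)
    exact h
  obtain ⟨y, hy⟩ := hs
  refine ⟨y, hy, fun ν => ?_⟩
  have h1 := hy.mapL (eigenproj A ν)
  have h2 : HasSum (fun μ => eigenproj A ν (m μ • eigenproj A μ x))
      (eigenproj A ν (m ν • eigenproj A ν x)) :=
    hasSum_single ν fun μ hμ =>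
      hA.eigenproj_of_mem_ne hμ (Submodule.smul_mem _ _ (hA.eigenproj_mem μ x))
  rw [eigenproj_of_mem (Submodule.smul_mem _ _ (hA.eigenproj_mem ν x))] at h2
  exact h1.unique h2

/-- Functional calculus for a bounded multiplier: linearity and the norm bound are checked on each
eigenspace, by injectivity of the coordinates and Parseval. -/
theorem IsPosOperator.exists_diagonal (hA : IsPosOperator A) {m : ℝ → ℝ} {M : ℝ}
    (hm : ∀ μ, |m μ| ≤ M) :
    ∃ D : H →L[ℝ] H, ∀ ν x, eigenproj A ν (D x) = m ν • eigenproj A ν x := by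
  choose D hD using fun x => (hA.exists_hasSum_smul hm x)
  have hM : 0 ≤ M := (abs_nonneg _).trans (hm 0)
  let L : H →ₗ[ℝ] H :=
    { toFun := D
      map_add' := fun x y => hA.ext fun ν => by simp only [map_add, (hD _).2, smul_add]
      map_smul' := fun c x => hA.ext fun ν => by
        simp only [map_smul, (hD _).2, RingHom.id_apply, smul_comm c] }
  refine ⟨L.mkContinuous M fun x => ?_, fun ν x => (hD x).2 ν⟩
  have h : ‖D x‖ ^ 2 ≤ (M * ‖x‖) ^ 2 := by
    rw [mul_pow]
    refine hasSum_le (fun ν => ?_) (hA.hasSum_norm_sq (D x))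
      ((hA.hasSum_norm_sq x).mul_left (M ^ 2))
    rw [(hD x).2, norm_smul, mul_pow, Real.norm_eq_abs]
    have := hm ν
    gcongr
  exact (sq_le_sq₀ (norm_nonneg _) (by positivity)).mp h

end Spectral

/-! ### Resolvent families mode by mode -/

section Resolvent

variable {H : Type*} [NormedAddCommGroup H] [InnerProductSpace ℝ H] [CompleteSpace H]
  {A : H →ₗ.[ℝ] H} {b : ℝ → ℝ}

/-- Dominated convergence in the Parseval series of `‖f t - f t₀‖²`, with majorant `4 ‖P_μ x‖²`. -/
theorem IsPosOperator.continuousOn_of_eigenproj (hA : IsPosOperator A) {f : ℝ → H} {x : H}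
    {m : ℝ → ℝ → ℝ} (hm : ∀ μ, ContinuousOn (m μ) (Ici 0)) (hm1 : ∀ μ t, 0 ≤ t → |m μ t| ≤ 1)
    (hf : ∀ t, 0 ≤ t → ∀ μ, eigenproj A μ (f t) = m μ t • eigenproj A μ x) :
    ContinuousOn f (Ici 0) := by
  intro t₀ ht₀
  have hsq : Tendsto (fun t => ∑' μ, (m μ t - m μ t₀) ^ 2 * ‖eigenproj A μ x‖ ^ 2)
      (𝓝[Ici 0] t₀) (𝓝 (∑' _ : ℝ, (0 : ℝ))) := by
    refine tendsto_tsum_of_dominated_convergence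
      ((hA.hasSum_norm_sq x).summable.mul_left 4) (fun μ => ?_) ?_
    · have h1 : Tendsto (fun t => (m μ t - m μ t₀) ^ 2 * ‖eigenproj A μ x‖ ^ 2) (𝓝[Ici 0] t₀)
          (𝓝 ((m μ t₀ - m μ t₀) ^ 2 * ‖eigenproj A μ x‖ ^ 2)) :=
        (((hm μ t₀ ht₀).tendsto.sub_const _).pow 2).mul_const _
      simpa using h1
    · filter_upwards [self_mem_nhdsWithin] with t ht μ
      rw [Real.norm_of_nonneg (by positivity)]
      have h1 := abs_le.mp (hm1 μ t ht)
      have h2 := abs_le.mp (hm1 μ t₀ ht₀)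
      gcongr
      nlinarith
  rw [tsum_zero] at hsq
  have heq : ∀ᶠ t in 𝓝[Ici 0] t₀,
      ∑' μ, (m μ t - m μ t₀) ^ 2 * ‖eigenproj A μ x‖ ^ 2 = ‖f t - f t₀‖ ^ 2 := by
    filter_upwards [self_mem_nhdsWithin] with t ht
    rw [← (hA.hasSum_norm_sq (f t - f t₀)).tsum_eq]
    congr 1 with μ
    rw [map_sub, hf t ht, hf t₀ ht₀, ← sub_smul, norm_smul, mul_pow, Real.norm_eq_abs, sq_abs]
  have h2 := (hsq.congr' heq).sqrt
  simp only [Real.sqrt_sq (norm_nonneg _), Real.sqrt_zero] at h2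
  exact tendsto_iff_norm_sub_tendsto_zero.mpr h2

theorem IsKernel.map_integral_smul (hb : IsKernel b) (L : H →L[ℝ] H) {f : ℝ → H}
    (hf : ContinuousOn f (Ici 0)) {t : ℝ} (ht : 0 ≤ t) :
    L (∫ r in (0 : ℝ)..t, (∫ τ in (0 : ℝ)..(t - r), b τ) • f r) =
      ∫ r in (0 : ℝ)..t, kernelPrimitive b (t - r) • L (f r) := by
  have hint : ∫ r in (0 : ℝ)..t, (∫ τ in (0 : ℝ)..(t - r), b τ) • f r =
      ∫ r in (0 : ℝ)..t, kernelPrimitive b (t - r) • f r := by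
    refine intervalIntegral.integral_congr fun r hr => ?_
    rw [uIcc_of_le ht] at hr
    exact congrArg (· • f r) (kernelPrimitive_of_nonneg b (sub_nonneg.mpr hr.2)).symm
  have hii : IntervalIntegrable (fun r => kernelPrimitive b (t - r) • f r) volume 0 t := by
    apply ContinuousOn.intervalIntegrable
    rw [uIcc_of_le ht]
    exact (hb.continuous_kernelPrimitive.comp (by fun_prop)).continuousOn.smul
      (hf.mono fun r hr => hr.1)
  rw [hint, ← ContinuousLinearMap.intervalIntegral_comp_comm _ hii]
  simp only [map_smul]

theorem IsKernel.exists_isResolventFamily (hb : IsKernel b) (hA : IsPosOperator A) :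
    ∃ S : ℝ → H →L[ℝ] H, IsResolventFamily A b S := by
  obtain ⟨K, -, hK⟩ := hA.exists_isInverse
  obtain ⟨μ₀, hμ₀, hlow⟩ := hA.exists_lowerBound
  choose s hs using fun μ => hb.exists_isScalarResolvent μ
  -- The value `1` where `s μ t` is not known to be bounded has no influence: negative `μ` carry no
  -- eigenvectors, and negative times are irrelevant.
  set m : ℝ → ℝ → ℝ := fun μ t => if 0 ≤ μ ∧ 0 ≤ t then s μ t else 1 with hm
  have hm1 : ∀ μ t, |m μ t| ≤ 1 := by
    intro μ t
    simp only [hm]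
    split_ifs with h
    · exact (hs μ).abs_le_one hb h.1 h.2
    · simp
  choose S hS using fun t => hA.exists_diagonal (m := fun μ => m μ t) (M := 1) fun μ => hm1 μ t
  have hcont : ∀ μ, ContinuousOn (m μ) (Ici 0) := by
    intro μ
    by_cases h : 0 ≤ μ
    · refine (hs μ).continuous.continuousOn.congr fun t ht => ?_
      exact if_pos (And.intro h ht)
    · refine continuousOn_const (c := (1 : ℝ)).congr fun t _ => ?_
      simp only [hm, h, false_and, if_false]
  have hScont : ∀ x : H, ContinuousOn (fun t => S t x) (Ici 0) := fun x =>
    hA.continuousOn_of_eigenproj hcont (fun μ t _ => hm1 μ t) fun t _ μ => hS t μ x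
  -- This identity gives both the invariance of the domain and the commutation with `A`.
  have hcomm : ∀ t, ∀ x : A.domain, S t x = K (S t (A x)) := by
    intro t x
    refine hA.ext fun ν => ?_
    by_cases hν : ν < μ₀
    · simp [hlow ν hν]
    · have hν0 : ν ≠ 0 := by linarith [not_lt.mp hν] |> fun h : 0 < ν => h.ne'
      apply smul_right_injective H hν0
      simp only
      rw [hK.eigenproj_map hA, hS, hS, hA.eigenproj_map, smul_comm]
  refine ⟨S, hScont, ?_, fun t _ x => ?_, fun t ht x => ?_⟩
  · ext x
    refine hA.ext fun ν => ?_
    rw [hS]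
    simp only [hm, (hs ν).zero, ite_self, one_smul, ContinuousLinearMap.id_apply]
  · obtain ⟨h1, h2⟩ := hK.right (S t (A x))
    have h3 : S t x ∈ A.domain := by rw [hcomm t x]; exact h1
    refine ⟨h3, ?_⟩
    have h4 : (⟨S t x, h3⟩ : A.domain) = ⟨K (S t (A x)), h1⟩ := Subtype.ext (hcomm t x)
    rw [h4, h2]
  · refine hA.ext fun ν => ?_
    by_cases hν : ν < μ₀
    · simp [hlow ν hν]
    have hν0 : 0 ≤ ν := hμ₀.le.trans (not_lt.mp hν)
    have hproj : ∫ r in (0 : ℝ)..t, kernelPrimitive b (t - r) • eigenproj A ν (S r (A x)) =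
        ∫ r in (0 : ℝ)..t, ((ν * kernelPrimitive b (t - r)) * s ν r) • eigenproj A ν x := by
      refine intervalIntegral.integral_congr fun r hr => ?_
      rw [uIcc_of_le ht] at hr
      simp only [hS, hm, if_pos (And.intro hν0 hr.1), hA.eigenproj_map, smul_smul]
      congr 1
      ring
    rw [map_add, hb.map_integral_smul _ (hScont _) ht, hproj,
      intervalIntegral.integral_smul_const, hS, ← add_smul]
    simp only [hm, if_pos (And.intro hν0 ht)]
    rw [(hs ν).equation t ht, one_smul]

/-- For `x` in the domain both sides solve the same Volterra equation, so they agree by uniqueness;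
density of the domain and boundedness extend this to all `x`. -/
theorem IsResolventFamily.eigenproj_apply {S : ℝ → H →L[ℝ] H} (hS : IsResolventFamily A b S)
    (hA : IsPosOperator A) (hb : IsKernel b) {μ : ℝ} {s : ℝ → ℝ} (hs : IsScalarResolvent b μ s)
    {t : ℝ} (ht : 0 ≤ t) (x : H) :
    eigenproj A μ (S t x) = s t • eigenproj A μ x := by
  have hdom : ∀ x : A.domain, eigenproj A μ (S t x) = s t • eigenproj A μ (x : H) := by
    intro x
    rw [← sub_eq_zero]
    have hk : Continuous fun t => μ * kernelPrimitive b t :=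
      hb.continuous_kernelPrimitive.const_mul μ
    have hPS : ContinuousOn (fun t => eigenproj A μ (S t x)) (Ici 0) :=
      (eigenproj A μ).continuous.comp_continuousOn (hS.continuousOn x)
    have hsP : Continuous fun t => s t • eigenproj A μ (x : H) := hs.continuous.smul continuous_const
    refine volterra_eq_zero (k := fun t => μ * kernelPrimitive b t)
      (d := fun t => eigenproj A μ (S t x) - s t • eigenproj A μ (x : H)) hk
      (hPS.sub hsP.continuousOn) (fun t ht => ?_) ht
    have hkt : Continuous fun r => μ * kernelPrimitive b (t - r) := hk.comp (by fun_prop)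
    have hproj : ∫ r in (0 : ℝ)..t, kernelPrimitive b (t - r) • eigenproj A μ (S r (A x)) =
        ∫ r in (0 : ℝ)..t, (μ * kernelPrimitive b (t - r)) • eigenproj A μ (S r x) := by
      refine intervalIntegral.integral_congr fun r hr => ?_
      rw [uIcc_of_le ht] at hr
      obtain ⟨h1, h2⟩ := hS.commute r hr.1 x
      rw [← h2, hA.eigenproj_map, smul_smul, mul_comm]
    have e1 := congrArg (eigenproj A μ) (hS.equation t ht x)
    rw [map_add, hb.map_integral_smul _ (hS.continuousOn _) ht, hproj] at e1
    have e2 := congrArg (fun c : ℝ => c • eigenproj A μ (x : H)) (hs.equation t ht)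
    simp only [add_smul, one_smul] at e2
    rw [← intervalIntegral.integral_smul_const] at e2
    simp only [smul_sub, smul_smul]
    rw [intervalIntegral.integral_sub, neg_sub, eq_sub_of_add_eq e1, eq_sub_of_add_eq e2]
    · abel
    · apply ContinuousOn.intervalIntegrable
      rw [uIcc_of_le ht]
      exact hkt.continuousOn.smul (hPS.mono fun r hr => hr.1)
    · exact ((hkt.mul hs.continuous).smul continuous_const).intervalIntegrable _ _
  have h := Continuous.ext_on hA.dense_domain (f := fun x => eigenproj A μ (S t x))
    (g := fun x => s t • eigenproj A μ x) (by fun_prop) (by fun_prop)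
    (fun x hx => hdom ⟨x, hx⟩)
  exact congrFun h x

theorem IsPosOperator.hasSum_fracNorm_sq (hA : IsPosOperator A) {r : ℝ} (hr : r ≤ 0) (x : H) :
    HasSum (fun μ => μ ^ r * ‖eigenproj A μ x‖ ^ 2) (fracNorm A r x ^ 2) := by
  obtain ⟨μ₀, hμ₀, hlow⟩ := hA.exists_lowerBound
  -- The cutoff makes the multiplier bounded; below `μ₀` the projections vanish, so the series is
  -- unchanged.
  have hM : ∀ μ, |if μ < μ₀ then 0 else μ ^ (r / 2)| ≤ μ₀ ^ (r / 2) := by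
    intro μ
    split_ifs with h
    · simpa using Real.rpow_nonneg hμ₀.le _
    · have h' := not_lt.mp h
      rw [abs_of_nonneg (Real.rpow_nonneg (hμ₀.le.trans h') _)]
      exact Real.rpow_le_rpow_of_nonpos hμ₀ h' (by linarith)
  obtain ⟨y, hy, hPy⟩ := hA.exists_hasSum_smul hM x
  have hfrac : fracPow A (r / 2) x = y := by
    rw [← hy.tsum_eq, fracPow]
    congr 1 with μ
    by_cases h : μ < μ₀
    · simp [hlow μ h]
    · simp [h]
  rw [fracNorm, hfrac]
  convert! hA.hasSum_norm_sq y using 2 with μ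
  rw [hPy, norm_smul, mul_pow, Real.norm_eq_abs, sq_abs]
  by_cases h : μ < μ₀
  · simp [hlow μ h]
  · rw [if_neg h, ← Real.rpow_natCast (μ ^ (r / 2)), ← Real.rpow_mul (hμ₀.le.trans (not_lt.mp h))]
    norm_num

theorem IsResolventFamily.hasSum_integral {S : ℝ → H →L[ℝ] H} (hS : IsResolventFamily A b S)
    (hA : IsPosOperator A) (hb : IsKernel b) {s : ℝ → ℝ → ℝ}
    (hs : ∀ μ, IsScalarResolvent b μ (s μ)) {a c N : ℝ} (hac : a ≤ c) (hcN : c ≤ N) (x : H) :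
    HasSum (fun μ => (∫ r in a..c, (s μ (N - r) - s μ (N - a)) ^ 2) * ‖eigenproj A μ x‖ ^ 2)
      (∫ r in a..c, ‖(S (N - r) - S (N - a)) x‖ ^ 2) := by
  obtain ⟨μ₀, hμ₀, hlow⟩ := hA.exists_lowerBound
  have hsum := (hA.hasSum_norm_sq x).summable
  -- Dominated convergence for series needs a countable index set, whereas the spectral sum runs
  -- over all reals; only countably many projections of `x` are nonzero.
  have hcount := hsum.countable_support
  set ι := Function.support fun μ => ‖eigenproj A μ x‖ ^ 2
  have : Countable ι := hcount
  have hpos : ∀ μ ∈ ι, 0 ≤ μ := by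
    intro μ hμ
    by_contra h
    apply hμ
    simp [hlow μ (by linarith)]
  have hsub : ∀ f : ℝ → ℝ, (Function.support fun μ => f μ * ‖eigenproj A μ x‖ ^ 2) ⊆ ι := by
    intro f μ hμ h0
    apply hμ
    simp only at h0 ⊢
    rw [h0, mul_zero]
  rw [← hasSum_subtype_iff_of_support_subset (hsub _)]
  have hmain := intervalIntegral.hasSum_integral_of_dominated_convergence (ι := ι) (μ := volume)
    (a := a) (b := c)
    (F := fun μ r => (s μ (N - r) - s μ (N - a)) ^ 2 * ‖eigenproj A μ x‖ ^ 2)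
    (f := fun r => ‖(S (N - r) - S (N - a)) x‖ ^ 2)
    (fun μ _ => 4 * ‖eigenproj A μ x‖ ^ 2) (fun μ => ?_) (fun μ => ?_) ?_ ?_ ?_
  · convert! hmain using 2 with μ
    simp only [Function.comp_apply]
    rw [intervalIntegral.integral_mul_const]
  · have hc := (hs μ).continuous
    exact Continuous.aestronglyMeasurable (by fun_prop)
  · refine Eventually.of_forall fun r hr => ?_
    rw [uIoc_of_le hac] at hr
    rw [Real.norm_of_nonneg (by positivity)]
    have h1 := abs_le.mp ((hs μ).abs_le_one hb (hpos μ μ.2) (T := N - r) (by linarith [hr.2]))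
    have h2 := abs_le.mp ((hs μ).abs_le_one hb (hpos μ μ.2) (T := N - a) (by linarith))
    gcongr
    nlinarith
  · exact Eventually.of_forall fun r _ => (hsum.mul_left 4).subtype ι
  · exact intervalIntegrable_const
  · refine Eventually.of_forall fun r hr => ?_
    rw [uIoc_of_le hac] at hr
    have h := hA.hasSum_norm_sq ((S (N - r) - S (N - a)) x)
    refine (hasSum_subtype_iff_of_support_subset
      (hsub fun μ => (s μ (N - r) - s μ (N - a)) ^ 2)).mpr ?_
    convert! h using 2 with μ
    rw [sub_apply, map_sub, hS.eigenproj_apply hA hb (hs μ) (by linarith [hr.2]),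
      hS.eigenproj_apply hA hb (hs μ) (by linarith), ← sub_smul, norm_smul, mul_pow,
      Real.norm_eq_abs, sq_abs]

end Resolvent

end StochVolterra

end

theorem lemma4p3 {H : Type*} [NormedAddCommGroup H] [InnerProductSpace ℝ H] [CompleteSpace H]
    [TopologicalSpace.SeparableSpace H]
    (A : H →ₗ.[ℝ] H) (hA : StochVolterra.IsPosOperator A)
    (b : ℝ → ℝ) (hb : StochVolterra.IsKernel b) :
    (∃ S : ℝ → H →L[ℝ] H, StochVolterra.IsResolventFamily A b S) ∧
    ∀ S : ℝ → H →L[ℝ] H, StochVolterra.IsResolventFamily A b S →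
      ∀ T : ℝ, 0 < T → ∀ γ : ℝ, ∃ C : ℝ, 0 < C ∧
        ∀ s : ℝ, 0 < s → s ≤ 1 / StochVolterra.rho b → γ < StochVolterra.rho b * s / 2 →
          ∀ (n : ℕ) (Δt : ℝ), 0 < Δt → n * Δt = T → ∀ x : H,
            Real.sqrt (∑ k ∈ Finset.Icc 1 n,
                ∫ r in (((k : ℝ) - 1) * Δt)..((k : ℝ) * Δt),
                  ‖(S ((n : ℝ) * Δt - r) - S ((n : ℝ) * Δt - ((k : ℝ) - 1) * Δt)) x‖ ^ 2)
              ≤ C * Δt ^ γ * StochVolterra.fracNorm A (s - 1 / StochVolterra.rho b) x := by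
  refine ⟨hb.exists_isResolventFamily hA, fun S hS T hT γ => ?_⟩
  obtain ⟨μ₀, hμ₀, hlow⟩ := hA.exists_lowerBound
  obtain ⟨C, hC, hbound⟩ := hb.exists_sum_integral_sub_sq_le hμ₀ hT γ
  choose u hu using fun μ => hb.exists_isScalarResolvent μ
  refine ⟨√C, Real.sqrt_pos.mpr hC, fun s hs hsρ hγ n h hh hn x => ?_⟩
  have hnorm : 0 ≤ StochVolterra.fracNorm A (s - 1 / StochVolterra.rho b) x := norm_nonneg _
  have hsum := hasSum_sum fun k (hk : k ∈ Finset.Icc 1 n) =>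
    hS.hasSum_integral hA hb hu (a := ((k : ℝ) - 1) * h) (c := (k : ℝ) * h) (N := (n : ℝ) * h)
      (by nlinarith) (by
        have : (k : ℝ) ≤ n := by exact_mod_cast (Finset.mem_Icc.mp hk).2
        gcongr) x
  -- Termwise comparison of two Parseval series: the scalar bound for each `μ ≥ μ₀`, and zero on
  -- both sides below `μ₀`.
  have hle := hasSum_le (fun μ => ?_) hsum
    ((hA.hasSum_fracNorm_sq (sub_nonpos.mpr hsρ) x).mul_left (C * h ^ (2 * γ)))
  · refine Real.sqrt_le_iff.mpr ⟨by positivity, hle.trans_eq ?_⟩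
    rw [mul_pow, mul_pow, Real.sq_sqrt hC.le, ← Real.rpow_natCast (h ^ γ), ← Real.rpow_mul hh.le]
    congr 3
    push_cast
    ring
  · rw [← Finset.sum_mul, ← mul_assoc]
    by_cases hμ : μ < μ₀
    · simp [hlow μ hμ]
    · gcongr
      exact hbound μ (not_lt.mp hμ) (u μ) (hu μ) s hs hsρ hγ n h hh hn
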